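/- Let $\theta_0,\theta_x,\theta_\infty\in\mathbb C$ and consider the fifth Painlevé equation $$ \text{(V)}\quad \frac{d^2y}{dx^2}=\Bigl(\frac1{2y}+\frac1{y-1}\Bigr)\Bigl(\frac{dy}{dx}\Bigr)^2-\frac1x\frac{dy}{dx} +\frac{(y-1)^2}{8x^2}\Bigl((\theta_0-\theta_x+\theta_\infty)^2y-\frac{(\theta_0-\theta_x-\theta_\infty)^2}{y}\Bigr) +(1-\theta_0-\theta_x)\frac yx-\frac{y(y+1)}{2(y-1)} . $$ Let $\mathcal R$ be the universal covering of $\mathbb C\setminus\{0\}$, and let $\Sigma_*=\{\sigma\in\mathbb R:\sigma\le-1\}\cup\{0\}\cup\{\sigma\in\mathbb R:\sigma\ge1\}\subset\mathbb C$. Let $\Sigma_0\subset\mathbb C\setminus\Sigma_*$ be a bounded domain with $\operatorname{dist}(\Sigma_0,\Sigma_*)>0$, and suppose that $(\sigma^2-(\theta_0\pm\theta_x)^2)(\sigma^2-\theta_\infty^2)\neq0$, for both signs, for every $\sigma$ in the closure of $\Sigma_0$. For $\sigma\in\Sigma_0$, $\rho\in\mathbb C\setminus\{0\}$ and $\varepsilon>0$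 put $$ \begin{aligned} \Omega_{\sigma,\rho}(\varepsilon)&=\{x\in\mathcal R:\ |x(\rho x^\sigma)|<\varepsilon,\ |x(\rho x^\sigma)^{-1}|<\varepsilon\},\\ \Omega^+_{\sigma,\rho}(\varepsilon)&=\{x\in\mathcal R:\ |\rho x^\sigma|<\varepsilon,\ |x(\rho x^\sigma)^{-1}|<\varepsilon\},\\ \Omega^-_{\sigma,\rho}(\varepsilon)&=\{x\in\mathcal R:\ |x(\rho x^\sigma)|<\varepsilon,\ |(\rho x^\sigma)^{-1}|<\varepsilon\}, \end{aligned} $$ and $\Omega^\pm(\Sigma_0,\varepsilon)=\{(\sigma,\rho,x):\sigma\in\Sigma_0,\ \rho\in\mathbb C\setminus\{0\},\ x\in\Omega^\pm_{\sigma,\rho}(\varepsilon)\}$. Then there are a number $\varepsilon_0>0$, depending only on $\Sigma_0$ and $(\theta_0,\theta_x,\theta_\infty)$, and a two-parameter family of functions $y(\sigma,\rho,x)$, $(\sigma,\rho)\in\Sigma_0\times(\mathbb C\setminus\{0\})$, such that for each $(\sigma,\rho)$ the function $y(\sigma,\rho,\cdot)$ is a meromorphic solution of (V) on $\Omega_{\sigma,\rho}(\varepsilon_0)$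 (that is, it is meromorphic and satisfies (V) at all points where it is holomorphic and different from $0$ and $1$), and on $\Omega^+_{\sigma,\rho}(\varepsilon_0)\cup\Omega^-_{\sigma,\rho}(\varepsilon_0)$ it is a holomorphic solution of (V) that does not take the values $0$ and $1$. Moreover: (i) $y(\sigma,\rho,x)$ is holomorphic in $(\sigma,\rho,x)\in\Omega^+(\Sigma_0,\varepsilon_0)\cup\Omega^-(\Sigma_0,\varepsilon_0)$. (ii) There are functions $c^\pm_j$ ($j\ge2$) and $c^\pm_{jn}$ ($j\ge0$, $n\ge1$) of $\sigma\in\Sigma_0$, each given by a rational function of $\sigma$ with coefficients in $\mathbb Q[\theta_0,\theta_x,\theta_\infty]$ and without poles in $\Sigma_0$, such that $$ y(\sigma,\rho,x)=1+\frac{4\sigma^2(\theta_0+\theta_x-\sigma)}{(\sigma+\theta_\infty)(\theta_0^2-(\sigma+\theta_x)^2)}\,\rho x^\sigma+\sum_{j\ge2}c^+_j(\sigma)(\rho x^\sigma)^j+\sum_{n\ge1}x^n\sum_{j\ge0}c^+_{jn}(\sigma)(\rho x^\sigma)^{-n+j} $$ in $\Omega^+(\Sigma_0,\varepsilon_0)$,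 and $$ y(\sigma,\rho,x)=1-\frac{4\sigma^2(\theta_0+\theta_x+\sigma)}{(\sigma-\theta_\infty)(\theta_0^2-(\sigma-\theta_x)^2)}\,(\rho x^\sigma)^{-1}+\sum_{j\ge2}c^-_j(\sigma)(\rho x^\sigma)^{-j}+\sum_{n\ge1}x^n\sum_{j\ge0}c^-_{jn}(\sigma)(\rho x^\sigma)^{n-j} $$ in $\Omega^-(\Sigma_0,\varepsilon_0)$, where the series (both the single series and the double series) converge absolutely. -/

import Mathlib

/-!
Points of the universal covering of `ℂ ∖ {0}` are described by their logarithm: the covering map is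
`Complex.exp : ℂ → ℂ ∖ {0}` (`Complex.isCoveringMap_exp`), and `ℂ` is simply connected. The point
with logarithm `u` lies over `x = exp u`, and `x ^ σ` is the function `exp (σ * u)` of it.
-/

namespace PainleveFive

/-- The derivation `d/dx` on functions on the universal covering of `ℂ ∖ {0}`,
in the coordinate `u = log x`. -/
noncomputable def xDeriv (f : ℂ → ℂ) (u : ℂ) : ℂ :=
  deriv f u / Complex.exp u

/-- The fifth Painlevé equation, as an identity at the point `x = exp u` of the covering. -/
def Equation (θ₀ θₓ θᵢ : ℂ) (f : ℂ → ℂ) (u : ℂ) : Prop :=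
  xDeriv (xDeriv f) u =
    (1 / (2 * f u) + 1 / (f u - 1)) * (xDeriv f u) ^ 2
      - 1 / Complex.exp u * xDeriv f u
      + (f u - 1) ^ 2 / (8 * Complex.exp u ^ 2)
          * ((θ₀ - θₓ + θᵢ) ^ 2 * f u - (θ₀ - θₓ - θᵢ) ^ 2 / f u)
      + (1 - θ₀ - θₓ) * (f u / Complex.exp u)
      - f u * (f u + 1) / (2 * (f u - 1))

/-- `f` solves the fifth Painlevé equation at `u` in the strict sense: it is holomorphic there,
avoids the singular values `0` and `1` of the equation, and satisfies the equation. -/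
def SolvesAt (θ₀ θₓ θᵢ : ℂ) (f : ℂ → ℂ) (u : ℂ) : Prop :=
  AnalyticAt ℂ f u ∧ f u ≠ 0 ∧ f u ≠ 1 ∧ Equation θ₀ θₓ θᵢ f u

/-- `f` is a meromorphic solution on `U`: it is meromorphic there, and satisfies the equation at all
points at which it is holomorphic and different from the singular values `0` and `1`. -/
def IsMeromorphicSolutionOn (θ₀ θₓ θᵢ : ℂ) (f : ℂ → ℂ) (U : Set ℂ) : Prop :=
  MeromorphicOn f U ∧
    ∀ u ∈ U, AnalyticAt ℂ f u → f u ≠ 0 → f u ≠ 1 → Equation θ₀ θₓ θᵢ f u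

/-- The set `{σ ≤ -1} ∪ {0} ∪ {σ ≥ 1}` of real numbers, as a subset of `ℂ`. -/
def sigmaStar : Set ℂ :=
  {s | ∃ r : ℝ, (r ≤ -1 ∨ r = 0 ∨ 1 ≤ r) ∧ s = (r : ℂ)}

/-- `ρ x ^ σ` at the point `x = exp u` of the covering. -/
noncomputable def rhoPow (σ ρ u : ℂ) : ℂ :=
  ρ * Complex.exp (σ * u)

/-- The points `x` with `|x (ρ x^σ)| < ε` and `|x (ρ x^σ)⁻¹| < ε`. -/
def omegaFull (σ ρ : ℂ) (ε : ℝ) : Set ℂ :=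
  {u | ‖Complex.exp u * rhoPow σ ρ u‖ < ε ∧ ‖Complex.exp u * (rhoPow σ ρ u)⁻¹‖ < ε}

/-- The points `x` with `|ρ x^σ| < ε` and `|x (ρ x^σ)⁻¹| < ε`. -/
def omegaPlus (σ ρ : ℂ) (ε : ℝ) : Set ℂ :=
  {u | ‖rhoPow σ ρ u‖ < ε ∧ ‖Complex.exp u * (rhoPow σ ρ u)⁻¹‖ < ε}

/-- The points `x` with `|x (ρ x^σ)| < ε` and `|(ρ x^σ)⁻¹| < ε`. -/
def omegaMinus (σ ρ : ℂ) (ε : ℝ) : Set ℂ :=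
  {u | ‖Complex.exp u * rhoPow σ ρ u‖ < ε ∧ ‖(rhoPow σ ρ u)⁻¹‖ < ε}

/-- The set of `(σ, ρ, x)` with `σ ∈ S`, `ρ ≠ 0` and `x ∈ omegaPlus σ ρ ε`. -/
def OmegaPlusTotal (S : Set ℂ) (ε : ℝ) : Set (ℂ × ℂ × ℂ) :=
  {p | p.1 ∈ S ∧ p.2.1 ≠ 0 ∧ p.2.2 ∈ omegaPlus p.1 p.2.1 ε}

/-- The set of `(σ, ρ, x)` with `σ ∈ S`, `ρ ≠ 0` and `x ∈ omegaMinus σ ρ ε`. -/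
def OmegaMinusTotal (S : Set ℂ) (ε : ℝ) : Set (ℂ × ℂ × ℂ) :=
  {p | p.1 ∈ S ∧ p.2.1 ≠ 0 ∧ p.2.2 ∈ omegaMinus p.1 p.2.1 ε}

/-- The ring `ℚ[θ₀, θₓ, θ_∞]`, as a subring of `ℂ`. -/
noncomputable def QTheta (θ₀ θₓ θᵢ : ℂ) : Subalgebra ℚ ℂ :=
  Algebra.adjoin ℚ {θ₀, θₓ, θᵢ}

/-- On `S`, `c` is given by a rational function of `σ` over `ℚ[θ₀, θₓ, θ_∞]` without poles in `S`. -/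
def IsRationalOn (θ₀ θₓ θᵢ : ℂ) (S : Set ℂ) (c : ℂ → ℂ) : Prop :=
  ∃ p q : Polynomial (QTheta θ₀ θₓ θᵢ), ∀ σ ∈ S,
    Polynomial.aeval σ q ≠ 0 ∧ c σ = Polynomial.aeval σ p / Polynomial.aeval σ q

/-- With `x = exp u`, `ξ = ρ x^σ`, the number `v` is the sum of the absolutely convergent series
`1 + a ξ + ∑_{j ≥ 2} c j ξ^j + ∑_{n ≥ 1} x^n ∑_{j ≥ 0} d j n ξ^(-n+j)`. -/
def IsPlusSum (σ ρ u : ℂ) (a : ℂ) (c : ℕ → ℂ) (d : ℕ → ℕ → ℂ) (v : ℂ) : Prop :=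
  Summable (fun j : ℕ => c (j + 2) * rhoPow σ ρ u ^ (j + 2)) ∧
  Summable (fun p : ℕ × ℕ => Complex.exp u ^ (p.1 + 1) *
    (d p.2 (p.1 + 1) * rhoPow σ ρ u ^ (-((p.1 : ℤ) + 1) + (p.2 : ℤ)))) ∧
  v = 1 + a * rhoPow σ ρ u
    + ∑' j : ℕ, c (j + 2) * rhoPow σ ρ u ^ (j + 2)
    + ∑' n : ℕ, Complex.exp u ^ (n + 1) *
        ∑' j : ℕ, d j (n + 1) * rhoPow σ ρ u ^ (-((n : ℤ) + 1) + (j : ℤ))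

/-- With `x = exp u`, `ξ = ρ x^σ`, the number `v` is the sum of the absolutely convergent series
`1 - a ξ⁻¹ + ∑_{j ≥ 2} c j ξ^(-j) + ∑_{n ≥ 1} x^n ∑_{j ≥ 0} d j n ξ^(n-j)`. -/
def IsMinusSum (σ ρ u : ℂ) (a : ℂ) (c : ℕ → ℂ) (d : ℕ → ℕ → ℂ) (v : ℂ) : Prop :=
  Summable (fun j : ℕ => c (j + 2) * rhoPow σ ρ u ^ (-((j : ℤ) + 2))) ∧
  Summable (fun p : ℕ × ℕ => Complex.exp u ^ (p.1 + 1) *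
    (d p.2 (p.1 + 1) * rhoPow σ ρ u ^ (((p.1 : ℤ) + 1) - (p.2 : ℤ)))) ∧
  v = 1 - a * (rhoPow σ ρ u)⁻¹
    + ∑' j : ℕ, c (j + 2) * rhoPow σ ρ u ^ (-((j : ℤ) + 2))
    + ∑' n : ℕ, Complex.exp u ^ (n + 1) *
        ∑' j : ℕ, d j (n + 1) * rhoPow σ ρ u ^ (((n : ℤ) + 1) - (j : ℤ))

end PainleveFive

/-! ### Weighted ℓ¹ norms and absolutely convergent evaluation of power series in ξ and t. -/

namespace PainleveFive

open MvPowerSeries Finset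
open scoped ENNReal NNReal

/-! Equation (V) comes from an isomonodromic deformation. Let `A₀`, `Aₓ` be traceless 2×2 matrices
with determinants `-θ₀²/4`, `-θₓ²/4`, let `J = diag(1, -1)`, and let `A₀ + Aₓ` have upper left entry
`-θ_∞/2`. If `x Aₓ' = [A₀, Aₓ] + (x/2)[J, Aₓ]` and `x (A₀ + Aₓ)' = (x/2)[J, Aₓ]`, then `y = (Aₓ)₁₂
((A₀)₁₁ + θ₀/2) / ((A₀)₁₂ ((Aₓ)₁₁ + θₓ/2))` solves (V). This is `equation_of_schlesinger`, which
passes through the first order system of `equation_of_jimboMiwa`. So it suffices to solve the matrix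
system.

The leading part of `A₀ + Aₓ` has eigenvalues `±σ/2`. In a basis diagonalising it, `J` becomes the
matrix with rows `(k, 1+k)`, `(1-k, -k)`, where `σ k = -θ_∞`. With `ξ = ρ x^σ` and `t = x/ξ`, write
`Aₓ` with rows `(a, ξ b)`, `(c/ξ, -a)` and `A₀ + Aₓ` as `diag(σ/2, -σ/2)` plus a perturbation. Every
forcing term then carries a factor `t`, `x = ξ t` or `x ξ = ξ² t`, so `a`, `b`, `c` are series in
monomials `ξ^j t^n` with `j ≤ 2n`. Such a monomial is an eigenvector of `x d/dx` with eigenvalue `n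
+ (j-n)σ`, `|j-n| ≤ n`; the distance of `σ` from `Σ_*` bounds the inverses of these numbers and of
the shifted ones that occur (`exists_nonResonant`).

Integrating gives the fixed-point equation of `step`. It gains one power of `t` per application
(`step_tCong`), which yields a unique formal solution, and it preserves a ball of a weighted ℓ¹ norm
(`step_tBound`), which yields convergence where `|x ξ|` and `|x/ξ|` are small, that is on Ω. The
determinants are first integrals (`det_ax`, `det_a0`). Thus `y` is a quotient of holomorphic
functions on Ω.

On Ω⁺ both `ξ` and `t` are small. Clearing the powers of `ξ` gives `y = 1 + ξ V/D` with power series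
`V`, `D` (`transcendent_eq`); the non-degeneracy hypotheses make `D` invertible, uniformly in `σ`
(`wnorm_inv_le`). Coefficients are rational in `σ` because each arises from finitely many steps of
the recursion (`tRat_sol`, `ratFam_serY`). On Ω⁻ one exchanges the two eigenvectors: this replaces
`(σ, ρ)` by `(-σ, ρ⁻¹)`, and uniqueness of the formal solution shows that `y` is unchanged
(`transcendent_symm`). -/

/-- Exponents of monomials `ξ ^ j t ^ n`. -/
abbrev Idx := Fin 2 →₀ ℕ

/-- Formal power series in two variables `ξ`, `t`. -/
abbrev Ser := MvPowerSeries (Fin 2) ℂ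

/-- The weighted `ℓ¹`-norm of a power series. -/
noncomputable def wnorm (w : Idx → ℝ≥0∞) (f : Ser) : ℝ≥0∞ := ∑' α, ‖coeff α f‖ₑ * w α

/-- A submultiplicative weight on exponents. -/
def IsWeight (w : Idx → ℝ≥0∞) : Prop := ∀ α β, w (α + β) ≤ w α * w β

theorem wnorm_add_le (w : Idx → ℝ≥0∞) (f g : Ser) : wnorm w (f + g) ≤ wnorm w f + wnorm w g := by
  unfold wnorm
  rw [← ENNReal.tsum_add]
  refine ENNReal.tsum_le_tsum fun α => ?_
  rw [← add_mul, map_add]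
  gcongr
  exact enorm_add_le _ _

theorem wnorm_neg (w : Idx → ℝ≥0∞) (f : Ser) : wnorm w (-f) = wnorm w f := by
  simp [wnorm]

theorem wnorm_sub_le (w : Idx → ℝ≥0∞) (f g : Ser) : wnorm w (f - g) ≤ wnorm w f + wnorm w g := by
  rw [sub_eq_add_neg, ← wnorm_neg w g]
  exact wnorm_add_le _ _ _

theorem wnorm_C_mul (w : Idx → ℝ≥0∞) (z : ℂ) (f : Ser) : wnorm w (C z * f) = ‖z‖ₑ * wnorm w f := by
  simp [wnorm, coeff_C_mul, enorm_mul, mul_assoc, ENNReal.tsum_mul_left]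

theorem wnorm_eq_of_single {w : Idx → ℝ≥0∞} {f : Ser} (α : Idx) (h : ∀ β ≠ α, coeff β f = 0) :
    wnorm w f = ‖coeff α f‖ₑ * w α :=
  tsum_eq_single α fun β hβ => by simp [h β hβ]

theorem wnorm_C (w : Idx → ℝ≥0∞) (z : ℂ) : wnorm w (C z) = ‖z‖ₑ * w 0 := by
  rw [wnorm_eq_of_single 0 fun β hβ => coeff_C_of_ne_zero hβ z]
  simp

theorem wnorm_X (w : Idx → ℝ≥0∞) (i : Fin 2) :
    wnorm w (X i) = w (Finsupp.single i 1) := by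
  rw [wnorm_eq_of_single (Finsupp.single i 1) fun β hβ => by simp [coeff_X, hβ]]
  simp

theorem wnorm_mono {w w' : Idx → ℝ≥0∞} (h : ∀ α, w α ≤ w' α) (f : Ser) : wnorm w f ≤ wnorm w' f :=
  ENNReal.tsum_le_tsum fun α => by gcongr; exact h α

/-- The product of the norms is a double sum; regrouping it along antidiagonals dominates the Cauchy
product term by term, by submultiplicativity of the weight. -/
theorem wnorm_mul_le {w : Idx → ℝ≥0∞} (hw : IsWeight w) (f g : Ser) :
    wnorm w (f * g) ≤ wnorm w f * wnorm w g := by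
  have h1 : wnorm w f * wnorm w g = ∑' p : Idx × Idx,
      (‖coeff p.1 f‖ₑ * w p.1) * (‖coeff p.2 g‖ₑ * w p.2) := by
    unfold wnorm
    rw [ENNReal.tsum_prod', ← ENNReal.tsum_mul_right]
    simp_rw [ENNReal.tsum_mul_left]
  rw [h1, ← HasAntidiagonal.sigmaAntidiagonalEquivProd.tsum_eq, ENNReal.tsum_sigma']
  refine ENNReal.tsum_le_tsum fun α => ?_
  rw [tsum_fintype, coeff_mul, univ_eq_attach]
  refine le_of_le_of_eq ?_ (sum_attach (antidiagonal α) (fun p : Idx × Idx =>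
    ‖coeff p.1 f‖ₑ * w p.1 * (‖coeff p.2 g‖ₑ * w p.2))).symm
  calc _ ≤ (∑ p ∈ antidiagonal α, ‖coeff p.1 f * coeff p.2 g‖ₑ) * w α := by
        gcongr; exact enorm_sum_le _ _
    _ ≤ _ := by
        rw [sum_mul]
        refine sum_le_sum fun p hp => ?_
        rw [enorm_mul, ← mem_antidiagonal.1 hp]
        calc _ ≤ ‖coeff p.1 f‖ₑ * ‖coeff p.2 g‖ₑ * (w p.1 * w p.2) := by gcongr; exact hw _ _
          _ = _ := by ring

/-- The value of the monomial with exponent `α` at `(ξ, t)`. -/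
def chr (ξ t : ℂ) (α : Idx) : ℂ := ξ ^ α 0 * t ^ α 1

theorem chr_add (ξ t : ℂ) (α β : Idx) : chr ξ t (α + β) = chr ξ t α * chr ξ t β := by
  simp [chr, pow_add]; ring

/-- The series `f` converges absolutely at `(ξ, t)`, with sum `v`. -/
structure HasEv (ξ t : ℂ) (f : Ser) (v : ℂ) : Prop where
  summable : Summable fun α => ‖coeff α f * chr ξ t α‖
  tsum : ∑' α, coeff α f * chr ξ t α = v

namespace HasEv

variable {ξ t : ℂ} {f g : Ser} {v w : ℂ}

theorem congr (hf : HasEv ξ t f v) (hfg : f = g) (hvw : v = w) : HasEv ξ t g w := hfg ▸ hvw ▸ hf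

theorem unique (hf : HasEv ξ t f v) (hf' : HasEv ξ t f w) : v = w := hf.tsum ▸ hf'.tsum

theorem of_eq (hf : HasEv ξ t f v) (hf' : HasEv ξ t g w) (h : f = g) : v = w :=
  hf.unique (h ▸ hf')

theorem hasSum (hf : HasEv ξ t f v) : HasSum (fun α => coeff α f * chr ξ t α) v :=
  hf.tsum ▸ hf.summable.of_norm.hasSum

theorem add (hf : HasEv ξ t f v) (hg : HasEv ξ t g w) : HasEv ξ t (f + g) (v + w) := by
  constructor
  · refine Summable.of_nonneg_of_le (fun _ => norm_nonneg _) (fun α => ?_)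
      (hf.summable.add hg.summable)
    rw [map_add, add_mul]
    exact norm_add_le _ _
  · simp only [map_add, add_mul]
    exact (hf.hasSum.add hg.hasSum).tsum_eq

theorem neg (hf : HasEv ξ t f v) : HasEv ξ t (-f) (-v) := by
  constructor
  · simpa using hf.summable
  · simpa using hf.hasSum.neg.tsum_eq

theorem sub (hf : HasEv ξ t f v) (hg : HasEv ξ t g w) : HasEv ξ t (f - g) (v - w) := by
  rw [sub_eq_add_neg, sub_eq_add_neg]
  exact hf.add hg.neg

theorem mul (hf : HasEv ξ t f v) (hg : HasEv ξ t g w) : HasEv ξ t (f * g) (v * w) := by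
  have key : ∀ α, coeff α (f * g) * chr ξ t α = ∑ p ∈ antidiagonal α,
      (coeff p.1 f * chr ξ t p.1) * (coeff p.2 g * chr ξ t p.2) := fun α => by
    rw [coeff_mul, sum_mul]
    refine sum_congr rfl fun p hp => ?_
    rw [← mem_antidiagonal.1 hp, chr_add]; ring
  constructor
  · have := summable_sum_mul_antidiagonal_of_summable_mul
      (Summable.mul_of_nonneg hf.summable hg.summable (fun _ => norm_nonneg _)
        fun _ => norm_nonneg _)
    refine this.of_nonneg_of_le (fun _ => norm_nonneg _) fun α => ?_
    rw [key]
    refine (norm_sum_le _ _).trans (le_of_eq ?_)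
    simp
  · simp only [key]
    have hs := summable_mul_of_summable_norm hf.summable hg.summable
    have h := hf.hasSum.summable.tsum_mul_tsum_eq_tsum_sum_antidiagonal hg.hasSum.summable hs
    rw [hf.tsum, hg.tsum] at h
    exact h.symm

theorem of_single (α : Idx) (h : ∀ β ≠ α, coeff β f = 0) :
    HasEv ξ t f (coeff α f * chr ξ t α) :=
  ⟨summable_of_ne_finset_zero (s := {α}) fun β hβ => by simp [h β (by simpa using hβ)],
    tsum_eq_single α fun β hβ => by simp [h β hβ]⟩

theorem const (z : ℂ) : HasEv ξ t (C z) z :=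
  (of_single 0 fun β hβ => coeff_C_of_ne_zero hβ z).congr rfl (by simp [chr])

theorem X0 : HasEv ξ t (X 0) ξ :=
  (of_single (Finsupp.single 0 1) fun β hβ => by simp [coeff_X, hβ]).congr rfl (by simp [chr])

theorem X1 : HasEv ξ t (X 1) t :=
  (of_single (Finsupp.single 1 1) fun β hβ => by simp [coeff_X, hβ]).congr rfl (by simp [chr])

theorem one : HasEv ξ t 1 1 := (const 1).congr (map_one _) rfl

/-- Domination of `|ξ^j t^n|` by the weight is the link between norms and domains: `coneWeight` is
used on Ω, `polyWeight` on Ω⁺. -/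
theorem of_wnorm {w : Idx → ℝ≥0∞} (hw : wnorm w f ≠ ∞) (h : ∀ α, ‖chr ξ t α‖ₑ ≤ w α) :
    HasEv ξ t f (∑' α, coeff α f * chr ξ t α) := by
  refine ⟨?_, rfl⟩
  have : ∑' α, ‖coeff α f * chr ξ t α‖ₑ ≠ ∞ := by
    refine ne_top_of_le_ne_top hw (ENNReal.tsum_le_tsum fun α => ?_)
    rw [enorm_mul]
    gcongr
    exact h α
  exact tsum_enorm_ne_top_iff_summable_norm.1 this

end HasEv

end PainleveFive

/-! ### The derivation `x d/dx`, its inverses, and non-resonance. -/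

namespace PainleveFive

open MvPowerSeries Finset
open scoped ENNReal NNReal

/-- The eigenvalue of `x d/dx` on the monomial `ξ ^ j t ^ n`, where `ξ = ρ x ^ σ`, `t = x / ξ`. -/
def eig (σ : ℂ) (α : Idx) : ℂ := α 0 * σ + α 1 * (1 - σ)

/-- The derivation `x d/dx` on formal series. -/
def delta (σ : ℂ) (f : Ser) : Ser := fun α => eig σ α * coeff α f

/-- The inverse of `x d/dx + lam` on formal series. -/
noncomputable def invDelta (σ lam : ℂ) (f : Ser) : Ser := fun α => (eig σ α + lam)⁻¹ * coeff α f

/-- The monomial `x = ξ t`. -/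
noncomputable def serX : Ser := X 0 * X 1

/-- The monomial `x ξ = ξ ^ 2 t`. -/
noncomputable def serS : Ser := X 0 ^ 2 * X 1

theorem coeff_delta (σ : ℂ) (f : Ser) (α : Idx) : coeff α (delta σ f) = eig σ α * coeff α f := rfl

theorem coeff_invDelta (σ lam : ℂ) (f : Ser) (α : Idx) :
    coeff α (invDelta σ lam f) = (eig σ α + lam)⁻¹ * coeff α f := rfl

theorem eig_add (σ : ℂ) (α β : Idx) : eig σ (α + β) = eig σ α + eig σ β := by
  simp [eig]; ring

theorem delta_add (σ : ℂ) (f g : Ser) : delta σ (f + g) = delta σ f + delta σ g := by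
  ext α; simp [coeff_delta, mul_add]

theorem delta_sub (σ : ℂ) (f g : Ser) : delta σ (f - g) = delta σ f - delta σ g := by
  ext α; simp [coeff_delta, mul_sub]

theorem delta_mul (σ : ℂ) (f g : Ser) : delta σ (f * g) = delta σ f * g + f * delta σ g := by
  ext α
  simp only [coeff_delta, coeff_mul, map_add, ← sum_add_distrib, mul_sum]
  refine sum_congr rfl fun p hp => ?_
  rw [← mem_antidiagonal.1 hp, eig_add]; ring

theorem delta_C (σ z : ℂ) : delta σ (C z) = 0 := by
  ext α
  rw [coeff_delta, coeff_C]
  split_ifs with h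
  · simp [h, eig]
  · simp

theorem delta_X0 (σ : ℂ) : delta σ (X 0) = C σ * X 0 := by
  ext α
  rw [coeff_delta, coeff_C_mul, coeff_X]
  split_ifs with h
  · simp [h, eig]
  · simp

theorem delta_X1 (σ : ℂ) : delta σ (X 1) = C (1 - σ) * X 1 := by
  ext α
  rw [coeff_delta, coeff_C_mul, coeff_X]
  split_ifs with h
  · simp [h, eig]
  · simp

theorem delta_serX (σ : ℂ) : delta σ serX = serX := by
  rw [serX, delta_mul, delta_X0, delta_X1, map_sub, map_one]; ring

theorem delta_serS (σ : ℂ) : delta σ serS = C (1 + σ) * serS := by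
  rw [serS, pow_two, delta_mul, delta_mul, delta_X0, delta_X1, map_sub, map_one, map_add, map_one]
  ring

theorem invDelta_sub (σ lam : ℂ) (f g : Ser) :
    invDelta σ lam (f - g) = invDelta σ lam f - invDelta σ lam g := by
  ext α; simp [coeff_invDelta, mul_sub]

theorem X_pow_dvd_invDelta (σ lam : ℂ) {f : Ser} {N : ℕ} (h : (X 1 : Ser) ^ N ∣ f) :
    (X 1 : Ser) ^ N ∣ invDelta σ lam f := by
  rw [X_pow_dvd_iff] at h ⊢
  intro α hα
  rw [coeff_invDelta, h α hα, mul_zero]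

/-- Only monomials `ξ ^ j t ^ n` with `j ≤ 2 n` occur in `f`. -/
def Supported (f : Ser) : Prop := ∀ α : Idx, 2 * α 1 < α 0 → coeff α f = 0

/-- The weight `r ^ n` on the monomials `ξ ^ j t ^ n` with `j ≤ 2 n`, infinite on the others. -/
noncomputable def coneWeight (r : ℝ≥0) (α : Idx) : ℝ≥0∞ := if α 0 ≤ 2 * α 1 then (r : ℝ≥0∞) ^ α 1 else ∞

/-- The cone `j ≤ 2n` is closed under addition. Outside it the value `∞` must absorb, and `r ≠ 0`
prevents products `0 * ∞ = 0`. -/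
theorem isWeight_coneWeight {r : ℝ≥0} (hr : r ≠ 0) : IsWeight (coneWeight r) := by
  intro α β
  have h0 : ∀ γ : Idx, coneWeight r γ ≠ 0 := fun γ => by
    unfold coneWeight
    split_ifs
    · exact pow_ne_zero _ (by exact_mod_cast hr)
    · simp
  by_cases hα : α 0 ≤ 2 * α 1
  · by_cases hβ : β 0 ≤ 2 * β 1
    · have : (α + β) 0 ≤ 2 * (α + β) 1 := by simp; omega
      simp only [coneWeight, if_pos hα, if_pos hβ, if_pos this]
      simp [pow_add]
    · rw [show coneWeight r β = ∞ from if_neg hβ, ENNReal.mul_top (h0 _)]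
      exact le_top
  · rw [show coneWeight r α = ∞ from if_neg hα, ENNReal.top_mul (h0 _)]
    exact le_top

theorem Supported.of_wnorm {r : ℝ≥0} {f : Ser} (h : wnorm (coneWeight r) f ≠ ∞) : Supported f := by
  intro α hα
  by_contra h0
  refine ENNReal.ne_top_of_tsum_ne_top h α ?_
  rw [show coneWeight r α = ∞ from if_neg (by omega), ENNReal.mul_top (by simpa using h0)]

/-- `q` bounds the inverse of `x d/dx + lam` on the monomials `ξ ^ j t ^ n` with `j ≤ 2 n`. -/
def InvBound (q : ℝ≥0) (σ lam : ℂ) : Prop :=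
  ∀ α : Idx, α 0 ≤ 2 * α 1 → ‖(eig σ α + lam)⁻¹‖ₑ ≤ q

theorem wnorm_invDelta_le {q : ℝ≥0} {σ lam : ℂ} (h : InvBound q σ lam) (r : ℝ≥0) (f : Ser) :
    wnorm (coneWeight r) (invDelta σ lam f) ≤ q * wnorm (coneWeight r) f := by
  unfold wnorm
  rw [← ENNReal.tsum_mul_left]
  refine ENNReal.tsum_le_tsum fun α => ?_
  rw [coeff_invDelta, enorm_mul, ← mul_assoc]
  by_cases hα : α 0 ≤ 2 * α 1
  · gcongr
    exact h α hα
  · rw [show coneWeight r α = ∞ from if_neg hα]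
    by_cases h0 : coeff α f = 0
    · simp [h0]
    -- The right side has to be `∞`, so `q = 0` must be excluded: it would force `lam = 0` at the
    -- exponent 0, while `ξ t` has eigenvalue 1.
    · by_cases hq : q = 0
      · have h1 := h 0 (by simp)
        have h2 : lam = 0 := by simpa [eig, hq] using h1
        have h3 := h (Finsupp.single 1 1) (by simp)
        have h4 := h (Finsupp.single 1 1 + Finsupp.single 0 1) (by simp)
        simp [eig, hq, h2] at h3 h4
      · rw [ENNReal.mul_top (a := (q : ℝ≥0∞) * _) (by simp [hq, h0])]
        exact le_top

theorem delta_invDelta {σ lam : ℂ} {f : Ser}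
    (h : ∀ α, coeff α f ≠ 0 → eig σ α + lam ≠ 0) :
    delta σ (invDelta σ lam f) = f - C lam * invDelta σ lam f := by
  ext α
  rw [coeff_delta, map_sub, coeff_C_mul, coeff_invDelta]
  by_cases h0 : coeff α f = 0
  · simp [h0]
  · field_simp [h α h0]
    ring

/-- Without resonances the kernel of `x d/dx` consists of constants; this turns conserved quantities
into numbers. -/
theorem eq_C_of_delta_eq_zero {σ : ℂ} {f : Ser} (hf : delta σ f = 0)
    (h : ∀ α ≠ 0, coeff α f ≠ 0 → eig σ α ≠ 0) : f = C (coeff 0 f) := by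
  ext α
  rw [coeff_C]
  split_ifs with h0
  · rw [h0]
  · by_contra h1
    have := congrArg (coeff α) hf
    rw [coeff_delta] at this
    exact mul_ne_zero (h α h0 h1) h1 this

/-- Every number `N + m σ` with `|m| ≤ N`, `N ≥ 1` has absolute value at least `c`. -/
def NonResonant (c : ℝ≥0) (σ : ℂ) : Prop :=
  ∀ (N : ℕ) (m : ℤ), 1 ≤ N → |m| ≤ N → c ≤ ‖(N : ℂ) + m * σ‖₊

theorem NonResonant.inv_le {c : ℝ≥0} {σ : ℂ} (h : NonResonant c σ) (hc : c ≠ 0) {z : ℂ} {N : ℕ}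
    {m : ℤ} (hN : 1 ≤ N) (hm : |m| ≤ N) (hz : z = N + m * σ) : ‖z⁻¹‖ₑ ≤ (c⁻¹ : ℝ≥0) := by
  have := h N m hN hm
  rw [← hz] at this
  rw [enorm_eq_nnnorm, nnnorm_inv]
  gcongr

theorem NonResonant.ne_zero {c : ℝ≥0} {σ : ℂ} (h : NonResonant c σ) (hc : c ≠ 0) {z : ℂ} {N : ℕ}
    {m : ℤ} (hN : 1 ≤ N) (hm : |m| ≤ N) (hz : z = N + m * σ) : z ≠ 0 := by
  have := h N m hN hm
  rw [← hz] at this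
  rintro rfl
  simp at this
  exact hc this

/-- The normal form `N + m σ`, here with `N = n + 1`, `m = j - n`. In the cone `|j - n| ≤ n`, so
there is room for the shifts `m ± 1` in the two companions below. -/
theorem eig_add_one (σ : ℂ) (α : Idx) :
    eig σ α + 1 = ((α 1 + 1 : ℕ) : ℂ) + (((α 0 : ℤ) - α 1 : ℤ) : ℂ) * σ := by
  simp [eig]; ring

theorem eig_add_one_add (σ : ℂ) (α : Idx) :
    eig σ α + (1 + σ) = ((α 1 + 1 : ℕ) : ℂ) + (((α 0 : ℤ) - α 1 + 1 : ℤ) : ℂ) * σ := by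
  simp [eig]; ring

theorem eig_add_one_sub (σ : ℂ) (α : Idx) :
    eig σ α + (1 - σ) = ((α 1 + 1 : ℕ) : ℂ) + (((α 0 : ℤ) - α 1 - 1 : ℤ) : ℂ) * σ := by
  simp [eig]; ring

theorem eig_eq (σ : ℂ) (α : Idx) :
    eig σ α = ((α 1 : ℕ) : ℂ) + (((α 0 : ℤ) - α 1 : ℤ) : ℂ) * σ := by
  simp [eig]; ring

theorem eq_zero_of_cone {α : Idx} (h : α 0 ≤ 2 * α 1) (h1 : ¬ 1 ≤ α 1) : α = 0 := by
  ext i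
  fin_cases i
  · change α 0 = 0
    omega
  · change α 1 = 0
    omega


theorem NonResonant.eig_add_one_ne {c : ℝ≥0} {σ : ℂ} (h : NonResonant c σ)
    (hc : c ≠ 0) {α : Idx} (hα : α 0 ≤ 2 * α 1) : eig σ α + 1 ≠ 0 :=
  h.ne_zero hc (by omega) (by rw [abs_le]; omega) (eig_add_one σ α)

theorem NonResonant.eig_add_one_add_ne {c : ℝ≥0} {σ : ℂ} (h : NonResonant c σ)
    (hc : c ≠ 0) {α : Idx} (hα : α 0 ≤ 2 * α 1) :
    eig σ α + (1 + σ) ≠ 0 :=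
  h.ne_zero hc (by omega) (by rw [abs_le]; omega) (eig_add_one_add σ α)

theorem NonResonant.eig_add_one_sub_ne {c : ℝ≥0} {σ : ℂ} (h : NonResonant c σ)
    (hc : c ≠ 0) {α : Idx} (hα : α 0 ≤ 2 * α 1) :
    eig σ α + (1 - σ) ≠ 0 :=
  h.ne_zero hc (by omega) (by rw [abs_le]; omega) (eig_add_one_sub σ α)

theorem NonResonant.eig_ne {c : ℝ≥0} {σ : ℂ} (h : NonResonant c σ)
    (hc : c ≠ 0) {α : Idx} (hα : α 0 ≤ 2 * α 1) (h0 : α ≠ 0) : eig σ α ≠ 0 := by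
  have h1 : 1 ≤ α 1 := by
    by_contra h1
    exact h0 (eq_zero_of_cone hα h1)
  exact h.ne_zero hc h1 (by rw [abs_le]; omega) (eig_eq σ α)

theorem NonResonant.invBound_one {c : ℝ≥0} {σ : ℂ} (h : NonResonant c σ)
    (hc : c ≠ 0) : InvBound c⁻¹ σ 1 := fun α hα =>
  h.inv_le hc (by omega) (by rw [abs_le]; omega) (eig_add_one σ α)

theorem NonResonant.invBound_one_add {c : ℝ≥0} {σ : ℂ} (h : NonResonant c σ)
    (hc : c ≠ 0) : InvBound c⁻¹ σ (1 + σ) := fun α hα =>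
  h.inv_le hc (by omega) (by rw [abs_le]; omega) (eig_add_one_add σ α)

theorem NonResonant.invBound_one_sub {c : ℝ≥0} {σ : ℂ} (h : NonResonant c σ)
    (hc : c ≠ 0) : InvBound c⁻¹ σ (1 - σ) := fun α hα =>
  h.inv_le hc (by omega) (by rw [abs_le]; omega) (eig_add_one_sub σ α)

/-- In the cone `n = 0` forces the exponent 0, where the convention `0⁻¹ = 0` makes the bound
trivial. Accordingly `invDelta σ 0` picks the primitive without constant term. -/
theorem NonResonant.invBound_zero {c : ℝ≥0} {σ : ℂ} (h : NonResonant c σ)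
    (hc : c ≠ 0) : InvBound c⁻¹ σ 0 := fun α hα => by
  by_cases h1 : 1 ≤ α 1
  · rw [add_zero]
    exact h.inv_le hc h1 (by rw [abs_le]; omega) (eig_eq σ α)
  · rw [eq_zero_of_cone hα h1]
    simp [eig]

end PainleveFive

/-! ### The Schlesinger system as a formal fixed-point problem. -/

namespace PainleveFive

open MvPowerSeries Finset
open scoped ENNReal NNReal

/-- The exponent `σ`, the constant `k`, and the leading coefficients of the three unknown series. -/
structure InitData where
  σ : ℂ
  k : ℂ
  a : ℂ
  b : ℂ
  c : ℂ

namespace InitData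

variable (P : InitData)

/-- The perturbation of the upper right entry of `A₀ + Aₓ`, divided by `ξ`. -/
noncomputable def pertB (F : Ser × Ser × Ser) : Ser :=
  C P.k * serX * invDelta P.σ (1 + P.σ) F.2.1 - C (1 + P.k) * X 1 * invDelta P.σ 1 F.1

/-- The perturbation of the lower left entry of `A₀ + Aₓ`. -/
noncomputable def pertNu (F : Ser × Ser × Ser) : Ser :=
  C (1 - P.k) * serX * invDelta P.σ 1 F.1 - C P.k * X 1 * invDelta P.σ (1 - P.σ) F.2.2

/-- The perturbation of the lower left entry of `A₀ + Aₓ`, multiplied by `ξ`. -/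
noncomputable def pertC (F : Ser × Ser × Ser) : Ser :=
  C (1 - P.k) * serS * invDelta P.σ 1 F.1 - C P.k * serX * invDelta P.σ (1 - P.σ) F.2.2

/-- The perturbation of the upper left entry of `A₀ + Aₓ`. -/
noncomputable def pertA (F : Ser × Ser × Ser) : Ser :=
  C (1 / 2) * (C (1 + P.k) * X 1 * invDelta P.σ (1 - P.σ) F.2.2
    - C (1 - P.k) * serS * invDelta P.σ (1 + P.σ) F.2.1)

/-- The derivative of the upper left entry of `Aₓ`. -/
noncomputable def rhsA (F : Ser × Ser × Ser) : Ser :=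
  P.pertB F * F.2.2 - P.pertC F * F.2.1
    + C (1 / 2) * (C (1 + P.k) * X 1 * F.2.2 - C (1 - P.k) * serS * F.2.1)

/-- The derivative of the upper right entry of `Aₓ`, divided by `ξ`. -/
noncomputable def rhsB (F : Ser × Ser × Ser) : Ser :=
  C 2 * (P.pertA F * F.2.1 - P.pertB F * F.1) + C P.k * serX * F.2.1 - C (1 + P.k) * X 1 * F.1

/-- The derivative of the lower left entry of `Aₓ`, multiplied by `ξ`. -/
noncomputable def rhsC (F : Ser × Ser × Ser) : Ser :=
  C 2 * (P.pertC F * F.1 - P.pertA F * F.2.2) + C (1 - P.k) * serS * F.1 - C P.k * serX * F.2.2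

/-- The fixed points of this map are the formal solutions of the Schlesinger system. -/
noncomputable def step (F : Ser × Ser × Ser) : Ser × Ser × Ser :=
  (C P.a + invDelta P.σ 0 (P.rhsA F), C P.b + invDelta P.σ 0 (P.rhsB F),
    C P.c + invDelta P.σ 0 (P.rhsC F))

/-- The iterates of `step`. -/
noncomputable def iter (N : ℕ) : Ser × Ser × Ser := P.step^[N] 0

/-- The formal solution of the Schlesinger system. -/
noncomputable def sol : Ser × Ser × Ser :=
  (fun α => coeff α (P.iter (α 1 + 1)).1, fun α => coeff α (P.iter (α 1 + 1)).2.1,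
    fun α => coeff α (P.iter (α 1 + 1)).2.2)

end InitData

/-- Congruence of triples of series modulo `t ^ N`. -/
def TCong (N : ℕ) (F G : Ser × Ser × Ser) : Prop :=
  (X 1 : Ser) ^ N ∣ F.1 - G.1 ∧ (X 1 : Ser) ^ N ∣ F.2.1 - G.2.1 ∧ (X 1 : Ser) ^ N ∣ F.2.2 - G.2.2

theorem TCong.refl (N : ℕ) (F : Ser × Ser × Ser) : TCong N F F := by simp [TCong]

theorem TCong.symm {N : ℕ} {F G : Ser × Ser × Ser} (h : TCong N F G) : TCong N G F :=
  ⟨dvd_sub_comm.1 h.1, dvd_sub_comm.1 h.2.1, dvd_sub_comm.1 h.2.2⟩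

theorem TCong.trans {N : ℕ} {F G H : Ser × Ser × Ser} (h : TCong N F G) (h' : TCong N G H) :
    TCong N F H :=
  ⟨by simpa using dvd_add h.1 h'.1, by simpa using dvd_add h.2.1 h'.2.1,
    by simpa using dvd_add h.2.2 h'.2.2⟩

theorem TCong.mono {M N : ℕ} (hMN : M ≤ N) {F G : Ser × Ser × Ser} (h : TCong N F G) :
    TCong M F G :=
  ⟨(pow_dvd_pow _ hMN).trans h.1, (pow_dvd_pow _ hMN).trans h.2.1, (pow_dvd_pow _ hMN).trans h.2.2⟩

theorem TCong.zero (F G : Ser × Ser × Ser) : TCong 0 F G := by simp [TCong]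

theorem eq_of_forall_X_pow_dvd {f g : Ser} (h : ∀ N, (X 1 : Ser) ^ N ∣ f - g) : f = g := by
  ext α
  have := X_pow_dvd_iff.1 (h (α 1 + 1)) α (by omega)
  rwa [map_sub, sub_eq_zero] at this

theorem eq_of_forall_tCong {F G : Ser × Ser × Ser} (h : ∀ N, TCong N F G) : F = G :=
  Prod.ext (eq_of_forall_X_pow_dvd fun N => (h N).1)
    (Prod.ext (eq_of_forall_X_pow_dvd fun N => (h N).2.1)
      (eq_of_forall_X_pow_dvd fun N => (h N).2.2))

theorem X_pow_dvd_invDelta_sub (σ lam : ℂ) {f g : Ser} {N : ℕ} (h : (X 1 : Ser) ^ N ∣ f - g) :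
    ∃ q, invDelta σ lam f - invDelta σ lam g = (X 1 : Ser) ^ N * q := by
  rw [← invDelta_sub]
  exact X_pow_dvd_invDelta σ lam h

/-- Split `f g - f' g' = (f - f') g + f' (g - g')`. The second term gains its extra power of `t`
from the divisibility of `f'`. -/
theorem mul_sub_mul_eq {f f' g g' : Ser} {N : ℕ} (hf : ∃ q, f - f' = (X 1 : Ser) ^ (N + 1) * q)
    (hf' : ∃ q, f' = (X 1 : Ser) * q) (hg : (X 1 : Ser) ^ N ∣ g - g') :
    ∃ q, f * g - f' * g' = (X 1 : Ser) ^ (N + 1) * q := by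
  obtain ⟨q, hq⟩ := hf
  obtain ⟨q', hq'⟩ := hf'
  obtain ⟨p, hp⟩ := hg
  exact ⟨q * g + q' * p, by linear_combination g * hq + f' * hp + (X 1) ^ N * p * hq'⟩

namespace InitData

variable (P : InitData)

/-- The gain of one power comes from the explicit factor `t`, which is also contained in `x = ξ t`;
for `pertC` and `pertA` it is also contained in `x ξ = ξ² t`. -/
theorem pertB_sub {N : ℕ} {F G : Ser × Ser × Ser} (h : TCong N F G) :
    ∃ q, P.pertB F - P.pertB G = (X 1 : Ser) ^ (N + 1) * q := by
  obtain ⟨p, hp⟩ := X_pow_dvd_invDelta_sub P.σ (1 + P.σ) h.2.1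
  obtain ⟨q, hq⟩ := X_pow_dvd_invDelta_sub P.σ 1 h.1
  refine ⟨C P.k * X 0 * p - C (1 + P.k) * q, ?_⟩
  simp only [pertB, serX]
  linear_combination C P.k * X 0 * X 1 * hp - C (1 + P.k) * X 1 * hq

theorem pertC_sub {N : ℕ} {F G : Ser × Ser × Ser} (h : TCong N F G) :
    ∃ q, P.pertC F - P.pertC G = (X 1 : Ser) ^ (N + 1) * q := by
  obtain ⟨p, hp⟩ := X_pow_dvd_invDelta_sub P.σ (1 - P.σ) h.2.2
  obtain ⟨q, hq⟩ := X_pow_dvd_invDelta_sub P.σ 1 h.1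
  refine ⟨C (1 - P.k) * X 0 ^ 2 * q - C P.k * X 0 * p, ?_⟩
  simp only [pertC, serX, serS]
  linear_combination C (1 - P.k) * X 0 ^ 2 * X 1 * hq - C P.k * X 0 * X 1 * hp

theorem pertA_sub {N : ℕ} {F G : Ser × Ser × Ser} (h : TCong N F G) :
    ∃ q, P.pertA F - P.pertA G = (X 1 : Ser) ^ (N + 1) * q := by
  obtain ⟨p, hp⟩ := X_pow_dvd_invDelta_sub P.σ (1 - P.σ) h.2.2
  obtain ⟨q, hq⟩ := X_pow_dvd_invDelta_sub P.σ (1 + P.σ) h.2.1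
  refine ⟨C (1 / 2) * (C (1 + P.k) * p - C (1 - P.k) * X 0 ^ 2 * q), ?_⟩
  simp only [pertA, serS]
  linear_combination C (1 / 2) * (C (1 + P.k) * X 1 * hp - C (1 - P.k) * X 0 ^ 2 * X 1 * hq)

theorem pertB_eq (F : Ser × Ser × Ser) : ∃ q, P.pertB F = X 1 * q :=
  ⟨C P.k * X 0 * invDelta P.σ (1 + P.σ) F.2.1 - C (1 + P.k) * invDelta P.σ 1 F.1, by
    simp only [pertB, serX]; ring⟩

theorem pertC_eq (F : Ser × Ser × Ser) : ∃ q, P.pertC F = X 1 * q :=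
  ⟨C (1 - P.k) * X 0 ^ 2 * invDelta P.σ 1 F.1 - C P.k * X 0 * invDelta P.σ (1 - P.σ) F.2.2, by
    simp only [pertC, serX, serS]; ring⟩

theorem pertA_eq (F : Ser × Ser × Ser) : ∃ q, P.pertA F = X 1 * q :=
  ⟨C (1 / 2) * (C (1 + P.k) * invDelta P.σ (1 - P.σ) F.2.2
    - C (1 - P.k) * X 0 ^ 2 * invDelta P.σ (1 + P.σ) F.2.1), by
    simp only [pertA, serS]; ring⟩

theorem pertC_eq_mul_pertNu (F : Ser × Ser × Ser) : P.pertC F = X 0 * P.pertNu F := by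
  simp only [pertC, pertNu, serX, serS]; ring

/-- The t-adic contraction: every term on the right of the system contains a perturbation or one of
`t`, `x`, `x ξ`, all divisible by `t`. -/
theorem step_tCong {N : ℕ} {F G : Ser × Ser × Ser} (h : TCong N F G) :
    TCong (N + 1) (P.step F) (P.step G) := by
  have hB := P.pertB_sub h
  have hC := P.pertC_sub h
  have hA := P.pertA_sub h
  have hB' := P.pertB_eq G
  have hC' := P.pertC_eq G
  have hA' := P.pertA_eq G
  obtain ⟨pa, ha⟩ := h.1
  obtain ⟨pb, hb⟩ := h.2.1
  obtain ⟨pc, hc⟩ := h.2.2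
  refine ⟨?_, ?_, ?_⟩
  · obtain ⟨u, hu⟩ := mul_sub_mul_eq hB hB' h.2.2
    obtain ⟨v, hv⟩ := mul_sub_mul_eq hC hC' h.2.1
    simp only [step, add_sub_add_left_eq_sub, ← invDelta_sub]
    refine X_pow_dvd_invDelta _ _
      ⟨u - v + C (1 / 2) * (C (1 + P.k) * pc - C (1 - P.k) * X 0 ^ 2 * pb), ?_⟩
    simp only [rhsA, serS]
    linear_combination hu - hv
      + C (1 / 2) * (C (1 + P.k) * X 1 * hc - C (1 - P.k) * X 0 ^ 2 * X 1 * hb)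
  · obtain ⟨u, hu⟩ := mul_sub_mul_eq hA hA' h.2.1
    obtain ⟨v, hv⟩ := mul_sub_mul_eq hB hB' h.1
    simp only [step, add_sub_add_left_eq_sub, ← invDelta_sub]
    refine X_pow_dvd_invDelta _ _
      ⟨C 2 * (u - v) + C P.k * X 0 * pb - C (1 + P.k) * pa, ?_⟩
    simp only [rhsB, serX]
    linear_combination C 2 * (hu - hv) + C P.k * X 0 * X 1 * hb - C (1 + P.k) * X 1 * ha
  · obtain ⟨u, hu⟩ := mul_sub_mul_eq hC hC' h.1
    obtain ⟨v, hv⟩ := mul_sub_mul_eq hA hA' h.2.2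
    simp only [step, add_sub_add_left_eq_sub, ← invDelta_sub]
    refine X_pow_dvd_invDelta _ _
      ⟨C 2 * (u - v) + C (1 - P.k) * X 0 ^ 2 * pa - C P.k * X 0 * pc, ?_⟩
    simp only [rhsC, serX, serS]
    linear_combination C 2 * (hu - hv) + C (1 - P.k) * X 0 ^ 2 * X 1 * ha - C P.k * X 0 * X 1 * hc

theorem iter_succ (N : ℕ) : P.iter (N + 1) = P.step (P.iter N) :=
  Function.iterate_succ_apply' _ _ _

theorem iter_tCong_succ (N : ℕ) : TCong N (P.iter (N + 1)) (P.iter N) := by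
  induction N with
  | zero => exact TCong.zero _ _
  | succ N ih =>
    have := P.step_tCong ih
    rwa [← P.iter_succ, ← P.iter_succ] at this

theorem iter_tCong {M N : ℕ} (h : N ≤ M) : TCong N (P.iter M) (P.iter N) := by
  induction M, h using Nat.le_induction with
  | base => exact TCong.refl _ _
  | succ M hM ih => exact ((P.iter_tCong_succ M).mono hM).trans ih

/-- The coefficients at `t^n` no longer change from iterate `n + 1` on, so reading them off there
gives the t-adic limit. -/
theorem sol_tCong (N : ℕ) : TCong N P.sol (P.iter N) := by
  have key : ∀ α : Idx, α 1 < N → TCong (α 1 + 1) (P.iter (α 1 + 1)) (P.iter N) := fun α hα =>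
    (P.iter_tCong hα).symm
  refine ⟨X_pow_dvd_iff.2 fun α hα => ?_, X_pow_dvd_iff.2 fun α hα => ?_,
    X_pow_dvd_iff.2 fun α hα => ?_⟩
  · exact X_pow_dvd_iff.1 (key α hα).1 α (by omega)
  · exact X_pow_dvd_iff.1 (key α hα).2.1 α (by omega)
  · exact X_pow_dvd_iff.1 (key α hα).2.2 α (by omega)

theorem step_sol : P.step P.sol = P.sol := by
  refine eq_of_forall_tCong fun N => ?_
  have h1 := (P.step_tCong (P.sol_tCong N))
  rw [← P.iter_succ] at h1
  exact (h1.trans (P.sol_tCong (N + 1)).symm).mono (by omega)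

/-- Uniqueness by the same contraction; it later identifies the solutions for `σ` and `-σ`. -/
theorem eq_sol_of_step_eq {F : Ser × Ser × Ser} (h : P.step F = F) : F = P.sol := by
  refine eq_of_forall_tCong fun N => ?_
  induction N with
  | zero => exact TCong.zero _ _
  | succ N ih =>
    rw [← h, ← P.step_sol]
    exact P.step_tCong ih

end InitData

end PainleveFive

/-! ### A priori bounds and convergence of the formal solution. -/

namespace PainleveFive

open MvPowerSeries Finset
open scoped ENNReal NNReal

theorem X_eq_monomial (i : Fin 2) : (X i : Ser) = monomial (Finsupp.single i 1) 1 := rfl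

theorem wnorm_monomial (w : Idx → ℝ≥0∞) (α : Idx) : wnorm w (monomial α (1 : ℂ)) = w α := by
  rw [wnorm_eq_of_single α fun β hβ => by simp [coeff_monomial, hβ]]
  simp

theorem serX_eq_monomial : serX = monomial (Finsupp.single 0 1 + Finsupp.single 1 1) 1 := by
  simp [serX, X_eq_monomial, monomial_mul_monomial]

theorem serS_eq_monomial : serS = monomial (Finsupp.single 0 2 + Finsupp.single 1 1) 1 := by
  rw [serS, X_pow_eq, X_eq_monomial, monomial_mul_monomial, one_mul]

theorem wnorm_coneWeight_serX (r : ℝ≥0) : wnorm (coneWeight r) serX = r := by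
  rw [serX_eq_monomial, wnorm_monomial]; simp [coneWeight]

theorem wnorm_coneWeight_serS (r : ℝ≥0) : wnorm (coneWeight r) serS = r := by
  rw [serS_eq_monomial, wnorm_monomial]; simp [coneWeight]

theorem wnorm_coneWeight_X (r : ℝ≥0) : wnorm (coneWeight r) (X 1) = r := by
  rw [wnorm_X]; simp [coneWeight]

theorem wnorm_coneWeight_C (r : ℝ≥0) (z : ℂ) : wnorm (coneWeight r) (C z) = ‖z‖ₑ := by
  rw [wnorm_C]; simp [coneWeight]

theorem wnorm_mul_le_of_le {w : Idx → ℝ≥0∞} (hw : IsWeight w) {f g : Ser} {A B : ℝ≥0∞}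
    (hf : wnorm w f ≤ A) (hg : wnorm w g ≤ B) : wnorm w (f * g) ≤ A * B :=
  (wnorm_mul_le hw f g).trans (mul_le_mul' hf hg)

theorem wnorm_add_le_of_le {w : Idx → ℝ≥0∞} {f g : Ser} {A B : ℝ≥0∞}
    (hf : wnorm w f ≤ A) (hg : wnorm w g ≤ B) : wnorm w (f + g) ≤ A + B :=
  (wnorm_add_le w f g).trans (add_le_add hf hg)

theorem wnorm_sub_le_of_le {w : Idx → ℝ≥0∞} {f g : Ser} {A B : ℝ≥0∞}
    (hf : wnorm w f ≤ A) (hg : wnorm w g ≤ B) : wnorm w (f - g) ≤ A + B :=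
  (wnorm_sub_le w f g).trans (add_le_add hf hg)

theorem wnorm_C_mul_le_of_le {w : Idx → ℝ≥0∞} {z : ℂ} {f : Ser} {A B : ℝ≥0∞}
    (hz : ‖z‖ₑ ≤ A) (hf : wnorm w f ≤ B) : wnorm w (C z * f) ≤ A * B :=
  (wnorm_C_mul w z f).trans_le (mul_le_mul' hz hf)

/-- All three series have norm at most `B`. -/
def TBound (w : Idx → ℝ≥0∞) (B : ℝ≥0∞) (F : Ser × Ser × Ser) : Prop :=
  wnorm w F.1 ≤ B ∧ wnorm w F.2.1 ≤ B ∧ wnorm w F.2.2 ≤ B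

namespace InitData

/-- The constants of `P` are at most `K` in absolute value, and the operators inverted in the
recursion have inverses bounded by `q`. -/
structure BoundedBy (P : InitData) (K q : ℝ≥0) : Prop where
  k : ‖P.k‖ₑ ≤ K
  a : ‖P.a‖ₑ ≤ K
  b : ‖P.b‖ₑ ≤ K
  c : ‖P.c‖ₑ ≤ K
  inv_zero : InvBound q P.σ 0
  inv_one : InvBound q P.σ 1
  inv_one_add : InvBound q P.σ (1 + P.σ)
  inv_one_sub : InvBound q P.σ (1 - P.σ)

namespace BoundedBy

variable {P : InitData} {K q : ℝ≥0} (h : P.BoundedBy K q)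

theorem one_add (h : P.BoundedBy K q) : ‖1 + P.k‖ₑ ≤ ((1 + K : ℝ≥0) : ℝ≥0∞) := by
  push_cast
  refine (enorm_add_le _ _).trans (add_le_add ?_ h.k)
  simp

theorem one_sub (h : P.BoundedBy K q) : ‖1 - P.k‖ₑ ≤ ((1 + K : ℝ≥0) : ℝ≥0∞) := by
  push_cast
  refine (enorm_sub_le).trans (add_le_add ?_ h.k)
  simp

theorem k' (h : P.BoundedBy K q) : ‖P.k‖ₑ ≤ ((1 + K : ℝ≥0) : ℝ≥0∞) :=
  h.k.trans (by exact_mod_cast le_add_self)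

/-- Each of the two summands is a constant of size at most `1 + K`, times a monomial of norm `r`,
times an inverse of norm at most `q` applied to a series of norm at most `B`. The other
perturbations are estimated in the same way. -/
theorem wnorm_pertB_le (h : P.BoundedBy K q) {r B : ℝ≥0} (hr : r ≠ 0) {F : Ser × Ser × Ser}
    (hF : TBound (coneWeight r) B F) :
    wnorm (coneWeight r) (P.pertB F) ≤ ((2 * ((1 + K) * r * (q * B)) : ℝ≥0) : ℝ≥0∞) := by
  have hw := isWeight_coneWeight hr
  refine (wnorm_sub_le_of_le
    (wnorm_mul_le_of_le hw (wnorm_C_mul_le_of_le h.k' (wnorm_coneWeight_serX r).le)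
      ((wnorm_invDelta_le h.inv_one_add r _).trans (mul_le_mul_right hF.2.1 _)))
    (wnorm_mul_le_of_le hw (wnorm_C_mul_le_of_le h.one_add (wnorm_coneWeight_X r).le)
      ((wnorm_invDelta_le h.inv_one r _).trans (mul_le_mul_right hF.1 _)))).trans (le_of_eq ?_)
  push_cast
  ring

theorem wnorm_pertNu_le (h : P.BoundedBy K q) {r B : ℝ≥0} (hr : r ≠ 0) {F : Ser × Ser × Ser}
    (hF : TBound (coneWeight r) B F) :
    wnorm (coneWeight r) (P.pertNu F) ≤ ((2 * ((1 + K) * r * (q * B)) : ℝ≥0) : ℝ≥0∞) := by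
  have hw := isWeight_coneWeight hr
  refine (wnorm_sub_le_of_le
    (wnorm_mul_le_of_le hw (wnorm_C_mul_le_of_le h.one_sub (wnorm_coneWeight_serX r).le)
      ((wnorm_invDelta_le h.inv_one r _).trans (mul_le_mul_right hF.1 _)))
    (wnorm_mul_le_of_le hw (wnorm_C_mul_le_of_le h.k' (wnorm_coneWeight_X r).le)
      ((wnorm_invDelta_le h.inv_one_sub r _).trans (mul_le_mul_right hF.2.2 _)))).trans
    (le_of_eq ?_)
  push_cast
  ring

theorem wnorm_pertC_le (h : P.BoundedBy K q) {r B : ℝ≥0} (hr : r ≠ 0) {F : Ser × Ser × Ser}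
    (hF : TBound (coneWeight r) B F) :
    wnorm (coneWeight r) (P.pertC F) ≤ ((2 * ((1 + K) * r * (q * B)) : ℝ≥0) : ℝ≥0∞) := by
  have hw := isWeight_coneWeight hr
  refine (wnorm_sub_le_of_le
    (wnorm_mul_le_of_le hw (wnorm_C_mul_le_of_le h.one_sub (wnorm_coneWeight_serS r).le)
      ((wnorm_invDelta_le h.inv_one r _).trans (mul_le_mul_right hF.1 _)))
    (wnorm_mul_le_of_le hw (wnorm_C_mul_le_of_le h.k' (wnorm_coneWeight_serX r).le)
      ((wnorm_invDelta_le h.inv_one_sub r _).trans (mul_le_mul_right hF.2.2 _)))).trans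
    (le_of_eq ?_)
  push_cast
  ring

theorem enorm_half : ‖(1 / 2 : ℂ)‖ₑ ≤ ((1 : ℝ≥0) : ℝ≥0∞) := by
  rw [enorm_eq_nnnorm]
  norm_cast
  rw [← NNReal.coe_le_coe]
  norm_num

theorem wnorm_pertA_le (h : P.BoundedBy K q) {r B : ℝ≥0} (hr : r ≠ 0) {F : Ser × Ser × Ser}
    (hF : TBound (coneWeight r) B F) :
    wnorm (coneWeight r) (P.pertA F) ≤ ((2 * ((1 + K) * r * (q * B)) : ℝ≥0) : ℝ≥0∞) := by
  have hw := isWeight_coneWeight hr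
  refine (wnorm_C_mul_le_of_le enorm_half (wnorm_sub_le_of_le
    (wnorm_mul_le_of_le hw (wnorm_C_mul_le_of_le h.one_add (wnorm_coneWeight_X r).le)
      ((wnorm_invDelta_le h.inv_one_sub r _).trans (mul_le_mul_right hF.2.2 _)))
    (wnorm_mul_le_of_le hw (wnorm_C_mul_le_of_le h.one_sub (wnorm_coneWeight_serS r).le)
      ((wnorm_invDelta_le h.inv_one_add r _).trans (mul_le_mul_right hF.2.1 _))))).trans
    (le_of_eq ?_)
  push_cast
  ring

/-- A bound for `step` in terms of the constants. -/
theorem step_tBound (h : P.BoundedBy K q) {r B : ℝ≥0} (hr : r ≠ 0)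
    (hB : K + q * (4 * ((2 * ((1 + K) * r * (q * B))) * B) + 2 * ((1 + K) * r * B)) ≤ B)
    {F : Ser × Ser × Ser} (hF : TBound (coneWeight r) B F) :
    TBound (coneWeight r) B (P.step F) := by
  have hw := isWeight_coneWeight hr
  have h2 : ‖(2 : ℂ)‖ₑ ≤ ((2 : ℝ≥0) : ℝ≥0∞) := by
    rw [enorm_eq_nnnorm]; norm_cast
  have hb := h.wnorm_pertB_le hr hF
  have hc := h.wnorm_pertC_le hr hF
  have ha := h.wnorm_pertA_le hr hF
  have hB' : (K : ℝ≥0∞) + (q : ℝ≥0∞) * ((4 * ((2 * ((1 + K) * r * (q * B))) * B)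
      + 2 * ((1 + K) * r * B) : ℝ≥0) : ℝ≥0∞) ≤ B := by exact_mod_cast hB
  have key : ∀ z f, ‖z‖ₑ ≤ (K : ℝ≥0∞) →
      wnorm (coneWeight r) f ≤ ((4 * ((2 * ((1 + K) * r * (q * B))) * B)
        + 2 * ((1 + K) * r * B) : ℝ≥0) : ℝ≥0∞) →
      wnorm (coneWeight r) (C z + invDelta P.σ 0 f) ≤ B := fun z f hz hf =>
    (wnorm_add_le_of_le ((wnorm_coneWeight_C r z).trans_le hz)
      ((wnorm_invDelta_le h.inv_zero r f).trans (mul_le_mul_right hf _))).trans hB'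
  refine ⟨key _ _ h.a ?_, key _ _ h.b ?_, key _ _ h.c ?_⟩
  · refine (wnorm_add_le_of_le
      (wnorm_sub_le_of_le (wnorm_mul_le_of_le hw hb hF.2.2) (wnorm_mul_le_of_le hw hc hF.2.1))
      (wnorm_C_mul_le_of_le enorm_half (wnorm_sub_le_of_le
        (wnorm_mul_le_of_le hw (wnorm_C_mul_le_of_le h.one_add (wnorm_coneWeight_X r).le) hF.2.2)
        (wnorm_mul_le_of_le hw (wnorm_C_mul_le_of_le h.one_sub (wnorm_coneWeight_serS r).le)
          hF.2.1)))).trans ?_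
    norm_cast
    calc _ = 2 * (2 * ((1 + K) * r * (q * B)) * B) + 2 * ((1 + K) * r * B) := by ring
      _ ≤ _ := by gcongr; norm_num
  · refine (wnorm_sub_le_of_le (wnorm_add_le_of_le (wnorm_C_mul_le_of_le h2
      (wnorm_sub_le_of_le (wnorm_mul_le_of_le hw ha hF.2.1) (wnorm_mul_le_of_le hw hb hF.1)))
        (wnorm_mul_le_of_le hw (wnorm_C_mul_le_of_le h.k' (wnorm_coneWeight_serX r).le) hF.2.1))
        (wnorm_mul_le_of_le hw (wnorm_C_mul_le_of_le h.one_add (wnorm_coneWeight_X r).le)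
          hF.1)).trans (le_of_eq ?_)
    push_cast
    ring
  · refine (wnorm_sub_le_of_le (wnorm_add_le_of_le (wnorm_C_mul_le_of_le h2
      (wnorm_sub_le_of_le (wnorm_mul_le_of_le hw hc hF.1) (wnorm_mul_le_of_le hw ha hF.2.2)))
        (wnorm_mul_le_of_le hw (wnorm_C_mul_le_of_le h.one_sub (wnorm_coneWeight_serS r).le) hF.1))
        (wnorm_mul_le_of_le hw (wnorm_C_mul_le_of_le h.k' (wnorm_coneWeight_serX r).le)
          hF.2.2)).trans (le_of_eq ?_)
    push_cast
    ring

end BoundedBy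

end InitData

theorem wnorm_le_of_finset {w : Idx → ℝ≥0∞} {f : Ser} {B : ℝ≥0∞}
    (h : ∀ s : Finset Idx, ∃ g : Ser, wnorm w g ≤ B ∧ ∀ α ∈ s, coeff α f = coeff α g) :
    wnorm w f ≤ B := by
  unfold wnorm
  rw [ENNReal.tsum_eq_iSup_sum]
  refine iSup_le fun s => ?_
  obtain ⟨g, hg, hs⟩ := h s
  refine le_trans ?_ hg
  rw [sum_congr rfl fun α hα => by rw [hs α hα]]
  exact ENNReal.sum_le_tsum s

/-- The norm is a supremum of finite partial sums, and finitely many coefficients agree with those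
of some approximant; so norm bounds survive t-adic limits. -/
theorem wnorm_le_of_X_pow_dvd {w : Idx → ℝ≥0∞} {f : Ser} {B : ℝ≥0∞} (g : ℕ → Ser)
    (hg : ∀ N, wnorm w (g N) ≤ B) (h : ∀ N, (X 1 : Ser) ^ N ∣ f - g N) : wnorm w f ≤ B := by
  refine wnorm_le_of_finset fun s => ⟨g (s.sup (fun α => α 1) + 1), hg _, fun α hα => ?_⟩
  have h1 : α 1 ≤ s.sup fun α => α 1 := le_sup (f := fun α : Idx => α 1) hα
  have := X_pow_dvd_iff.1 (h (s.sup (fun α => α 1) + 1)) α (by omega)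
  rwa [map_sub, sub_eq_zero] at this

namespace InitData

variable {P : InitData}

theorem BoundedBy.iter_tBound {K q : ℝ≥0} (h : P.BoundedBy K q) {r B : ℝ≥0} (hr : r ≠ 0)
    (hB : K + q * (4 * ((2 * ((1 + K) * r * (q * B))) * B) + 2 * ((1 + K) * r * B)) ≤ B) (N : ℕ) :
    TBound (coneWeight r) B (P.iter N) := by
  induction N with
  | zero => simp [iter, TBound, wnorm]
  | succ N ih =>
    rw [P.iter_succ]
    exact h.step_tBound hr hB ih

theorem BoundedBy.sol_tBound {K q : ℝ≥0} (h : P.BoundedBy K q) {r B : ℝ≥0} (hr : r ≠ 0)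
    (hB : K + q * (4 * ((2 * ((1 + K) * r * (q * B))) * B) + 2 * ((1 + K) * r * B)) ≤ B) :
    TBound (coneWeight r) B P.sol :=
  ⟨wnorm_le_of_X_pow_dvd _ (fun N => (h.iter_tBound hr hB N).1) fun N => (P.sol_tCong N).1,
    wnorm_le_of_X_pow_dvd _ (fun N => (h.iter_tBound hr hB N).2.1) fun N => (P.sol_tCong N).2.1,
    wnorm_le_of_X_pow_dvd _ (fun N => (h.iter_tBound hr hB N).2.2) fun N => (P.sol_tCong N).2.2⟩

end InitData

/-- There is a radius for which `step` preserves a ball. -/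
theorem exists_radius (K q : ℝ≥0) : ∃ r B : ℝ≥0, r ≠ 0 ∧ r ≤ 1 ∧
    K + q * (4 * ((2 * ((1 + K) * r * (q * B))) * B) + 2 * ((1 + K) * r * B)) ≤ B := by
  -- For `B = K + 1` the part of the bound beyond `K` is `A r`, and `r = (A + 1)⁻¹` makes it at most
  -- 1.
  set A : ℝ≥0 := q * (4 * ((2 * ((1 + K) * (q * (K + 1)))) * (K + 1)) + 2 * ((1 + K) * (K + 1)))
  refine ⟨(A + 1)⁻¹, K + 1, by positivity, ?_, ?_⟩
  · exact inv_le_one_of_one_le₀ (by simp)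
  · have : K + q * (4 * ((2 * ((1 + K) * (A + 1)⁻¹ * (q * (K + 1)))) * (K + 1))
      + 2 * ((1 + K) * (A + 1)⁻¹ * (K + 1))) = K + A / (A + 1) := by
      rw [div_eq_mul_inv]; simp only [A]; ring
    rw [this]
    gcongr
    exact div_le_one_of_le₀ (by simp) (by simp)

end PainleveFive

/-! ### Differential equations and first integrals of the formal solution. -/

namespace PainleveFive

open MvPowerSeries Finset
open scoped ENNReal NNReal

namespace Supported

variable {f g : Ser}

theorem add (hf : Supported f) (hg : Supported g) : Supported (f + g) := fun α hα => by
  simp [hf α hα, hg α hα]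

theorem sub (hf : Supported f) (hg : Supported g) : Supported (f - g) := fun α hα => by
  simp [hf α hα, hg α hα]

theorem mul (hf : Supported f) (hg : Supported g) : Supported (f * g) := fun α hα => by
  rw [coeff_mul]
  refine sum_eq_zero fun p hp => ?_
  have h0 : p.1 0 + p.2 0 = α 0 := by rw [← mem_antidiagonal.1 hp]; rfl
  have h1 : p.1 1 + p.2 1 = α 1 := by rw [← mem_antidiagonal.1 hp]; rfl
  by_cases h : 2 * p.1 1 < p.1 0
  · rw [hf _ h, zero_mul]
  · rw [hg p.2 (by omega), mul_zero]

theorem const (z : ℂ) : Supported (C z) := fun α hα =>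
  coeff_C_of_ne_zero (by rintro rfl; simp at hα) z

theorem monomial (β : Idx) (z : ℂ) (hβ : β 0 ≤ 2 * β 1) :
    Supported (MvPowerSeries.monomial β z) := fun α hα => by
  rw [coeff_monomial, if_neg]
  rintro rfl
  omega

theorem serX : Supported serX := serX_eq_monomial ▸ monomial _ _ (by simp)

theorem serS : Supported serS := serS_eq_monomial ▸ monomial _ _ (by simp)

theorem X1 : Supported (X 1) := X_eq_monomial 1 ▸ monomial _ _ (by simp)

theorem invDelta (hf : Supported f) (σ lam : ℂ) : Supported (invDelta σ lam f) := fun α hα => by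
  rw [coeff_invDelta, hf α hα, mul_zero]

theorem le_of_coeff_ne (hf : Supported f) {α : Idx} (h : coeff α f ≠ 0) : α 0 ≤ 2 * α 1 := by
  by_contra h1
  exact h (hf α (by omega))

end Supported

namespace InitData

variable {P : InitData}

/-- All three series are supported on `j ≤ 2 n`. -/
def TSupported (F : Ser × Ser × Ser) : Prop := Supported F.1 ∧ Supported F.2.1 ∧ Supported F.2.2

variable {F : Ser × Ser × Ser}

theorem supported_pertB (hF : TSupported F) : Supported (P.pertB F) :=
  (((Supported.const _).mul .serX).mul (hF.2.1.invDelta _ _)).sub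
    (((Supported.const _).mul .X1).mul (hF.1.invDelta _ _))

theorem supported_pertC (hF : TSupported F) : Supported (P.pertC F) :=
  (((Supported.const _).mul .serS).mul (hF.1.invDelta _ _)).sub
    (((Supported.const _).mul .serX).mul (hF.2.2.invDelta _ _))

theorem supported_pertA (hF : TSupported F) : Supported (P.pertA F) :=
  (Supported.const _).mul ((((Supported.const _).mul .X1).mul (hF.2.2.invDelta _ _)).sub
    (((Supported.const _).mul .serS).mul (hF.2.1.invDelta _ _)))

theorem supported_rhsA (hF : TSupported F) : Supported (P.rhsA F) :=
  (((supported_pertB hF).mul hF.2.2).sub ((supported_pertC hF).mul hF.2.1)).add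
    ((Supported.const _).mul ((((Supported.const _).mul .X1).mul hF.2.2).sub
      (((Supported.const _).mul .serS).mul hF.2.1)))

theorem supported_rhsB (hF : TSupported F) : Supported (P.rhsB F) :=
  (((Supported.const _).mul (((supported_pertA hF).mul hF.2.1).sub
    ((supported_pertB hF).mul hF.1))).add (((Supported.const _).mul .serX).mul hF.2.1)).sub
    (((Supported.const _).mul .X1).mul hF.1)

theorem supported_rhsC (hF : TSupported F) : Supported (P.rhsC F) :=
  (((Supported.const _).mul (((supported_pertC hF).mul hF.1).sub
    ((supported_pertA hF).mul hF.2.2))).add (((Supported.const _).mul .serS).mul hF.1)).sub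
    (((Supported.const _).mul .serX).mul hF.2.2)

theorem coeff_zero_pertB : constantCoeff (P.pertB F) = 0 := by
  obtain ⟨q, hq⟩ := P.pertB_eq F
  simp [hq]

theorem coeff_zero_pertC : constantCoeff (P.pertC F) = 0 := by
  obtain ⟨q, hq⟩ := P.pertC_eq F
  simp [hq]

theorem coeff_zero_pertA : constantCoeff (P.pertA F) = 0 := by
  obtain ⟨q, hq⟩ := P.pertA_eq F
  simp [hq]

theorem coeff_zero_pertNu : constantCoeff (P.pertNu F) = 0 := by
  simp [pertNu, serX]

theorem coeff_zero_rhsA : constantCoeff (P.rhsA F) = 0 := by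
  simp [rhsA, coeff_zero_pertB, coeff_zero_pertC, serS]

theorem coeff_zero_rhsB : constantCoeff (P.rhsB F) = 0 := by
  simp [rhsB, coeff_zero_pertB, coeff_zero_pertA, serX]

theorem coeff_zero_rhsC : constantCoeff (P.rhsC F) = 0 := by
  simp [rhsC, coeff_zero_pertA, coeff_zero_pertC, serX, serS]

theorem sol_fst (P : InitData) : P.sol.1 = C P.a + invDelta P.σ 0 (P.rhsA P.sol) :=
  (congrArg Prod.fst P.step_sol).symm

theorem sol_snd (P : InitData) : P.sol.2.1 = C P.b + invDelta P.σ 0 (P.rhsB P.sol) :=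
  (congrArg (fun F => F.2.1) P.step_sol).symm

theorem sol_trd (P : InitData) : P.sol.2.2 = C P.c + invDelta P.σ 0 (P.rhsC P.sol) :=
  (congrArg (fun F => F.2.2) P.step_sol).symm

theorem constantCoeff_invDelta {σ lam : ℂ} {f : Ser} (h : constantCoeff f = 0) :
    constantCoeff (invDelta σ lam f) = 0 := by
  rw [← coeff_zero_eq_constantCoeff_apply, coeff_invDelta, coeff_zero_eq_constantCoeff_apply, h,
    mul_zero]

theorem constantCoeff_sol_fst (P : InitData) : constantCoeff P.sol.1 = P.a := by
  rw [sol_fst, map_add, constantCoeff_invDelta coeff_zero_rhsA]; simp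

theorem constantCoeff_sol_snd (P : InitData) : constantCoeff P.sol.2.1 = P.b := by
  rw [sol_snd, map_add, constantCoeff_invDelta coeff_zero_rhsB]; simp

theorem constantCoeff_sol_trd (P : InitData) : constantCoeff P.sol.2.2 = P.c := by
  rw [sol_trd, map_add, constantCoeff_invDelta coeff_zero_rhsC]; simp

/-- The formal solution is supported on `j ≤ 2 n`, and no eigenvalue occurring in the recursion
vanishes. -/
structure Regular (P : InitData) : Prop where
  supp : TSupported P.sol
  nonres : ∃ c : ℝ≥0, c ≠ 0 ∧ NonResonant c P.σ

/-- The only vanishing eigenvalue in the cone belongs to the exponent 0, and there the coefficient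
is zero by hypothesis. -/
theorem Regular.delta_invDelta_zero (h : P.Regular) {f : Ser} (hf : Supported f)
    (h0 : constantCoeff f = 0) : delta P.σ (invDelta P.σ 0 f) = f := by
  obtain ⟨c, hc, hn⟩ := h.nonres
  rw [delta_invDelta, map_zero, zero_mul, sub_zero]
  intro α hα
  rw [add_zero]
  refine hn.eig_ne hc (hf.le_of_coeff_ne hα) ?_
  rintro rfl
  exact hα h0

theorem Regular.delta_invDelta_one (h : P.Regular) {f : Ser} (hf : Supported f) :
    delta P.σ (invDelta P.σ 1 f) = f - invDelta P.σ 1 f := by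
  obtain ⟨c, hc, hn⟩ := h.nonres
  rw [delta_invDelta, map_one, one_mul]
  exact fun α hα => hn.eig_add_one_ne hc (hf.le_of_coeff_ne hα)

theorem Regular.delta_invDelta_one_add (h : P.Regular) {f : Ser} (hf : Supported f) :
    delta P.σ (invDelta P.σ (1 + P.σ) f) = f - C (1 + P.σ) * invDelta P.σ (1 + P.σ) f := by
  obtain ⟨c, hc, hn⟩ := h.nonres
  exact delta_invDelta fun α hα => hn.eig_add_one_add_ne hc (hf.le_of_coeff_ne hα)

theorem Regular.delta_invDelta_one_sub (h : P.Regular) {f : Ser} (hf : Supported f) :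
    delta P.σ (invDelta P.σ (1 - P.σ) f) = f - C (1 - P.σ) * invDelta P.σ (1 - P.σ) f := by
  obtain ⟨c, hc, hn⟩ := h.nonres
  exact delta_invDelta fun α hα => hn.eig_add_one_sub_ne hc (hf.le_of_coeff_ne hα)

theorem Regular.delta_fst (h : P.Regular) : delta P.σ P.sol.1 = P.rhsA P.sol := by
  conv_lhs => rw [P.sol_fst]
  rw [delta_add, delta_C, zero_add,
    h.delta_invDelta_zero (supported_rhsA h.supp) coeff_zero_rhsA]

theorem Regular.delta_snd (h : P.Regular) : delta P.σ P.sol.2.1 = P.rhsB P.sol := by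
  conv_lhs => rw [P.sol_snd]
  rw [delta_add, delta_C, zero_add,
    h.delta_invDelta_zero (supported_rhsB h.supp) coeff_zero_rhsB]

theorem Regular.delta_trd (h : P.Regular) : delta P.σ P.sol.2.2 = P.rhsC P.sol := by
  conv_lhs => rw [P.sol_trd]
  rw [delta_add, delta_C, zero_add,
    h.delta_invDelta_zero (supported_rhsC h.supp) coeff_zero_rhsC]

/-- Moving `x d/dx + σ` past the factor `x` shifts it to `x d/dx + 1 + σ`, and past `t` to `x d/dx +
1`; these are the operators inverted in `pertB`. -/
theorem Regular.delta_pertB (h : P.Regular) : delta P.σ (P.pertB P.sol) =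
    -(C P.σ * P.pertB P.sol) + C P.k * serX * P.sol.2.1 - C (1 + P.k) * X 1 * P.sol.1 := by
  simp only [pertB, delta_sub, delta_mul, delta_C, delta_serX, delta_X1,
    h.delta_invDelta_one_add h.supp.2.1, h.delta_invDelta_one h.supp.1]
  simp only [map_add, map_sub, map_one]
  ring

theorem Regular.delta_pertC (h : P.Regular) : delta P.σ (P.pertC P.sol) =
    C P.σ * P.pertC P.sol + C (1 - P.k) * serS * P.sol.1 - C P.k * serX * P.sol.2.2 := by
  simp only [pertC, delta_sub, delta_mul, delta_C, delta_serX, delta_serS,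
    h.delta_invDelta_one_sub h.supp.2.2, h.delta_invDelta_one h.supp.1]
  simp only [map_add, map_sub, map_one]
  ring

theorem Regular.delta_pertA (h : P.Regular) : delta P.σ (P.pertA P.sol) =
    C (1 / 2) * (C (1 + P.k) * X 1 * P.sol.2.2 - C (1 - P.k) * serS * P.sol.2.1) := by
  simp only [pertA, delta_sub, delta_mul, delta_C, delta_X1, delta_serS,
    h.delta_invDelta_one_sub h.supp.2.2, h.delta_invDelta_one_add h.supp.2.1]
  simp only [map_add, map_sub, map_one]
  ring

theorem Regular.eq_C (h : P.Regular) {f : Ser} (hf : Supported f) (h0 : delta P.σ f = 0) :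
    f = C (constantCoeff f) := by
  obtain ⟨c, hc, hn⟩ := h.nonres
  exact eq_C_of_delta_eq_zero h0 fun α hα h1 => hn.eig_ne hc (hf.le_of_coeff_ne h1) hα

theorem C_half_mul_two : (C (1 / 2) : Ser) * 2 = 1 := by
  rw [← map_ofNat (C (σ := Fin 2) (R := ℂ)) 2, ← map_mul]; norm_num

/-- The left side is `-det Aₓ`. The system has commutator form, so its derivative cancels
identically, and non-resonance leaves only the constant term. -/
theorem Regular.det_ax (h : P.Regular) :
    P.sol.1 * P.sol.1 + P.sol.2.1 * P.sol.2.2 = C (P.a ^ 2 + P.b * P.c) := by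
  rw [h.eq_C ((h.supp.1.mul h.supp.1).add (h.supp.2.1.mul h.supp.2.2))]
  · congr 1
    simp [constantCoeff_sol_fst, constantCoeff_sol_snd, constantCoeff_sol_trd]; ring
  · simp only [delta_add, delta_mul, h.delta_fst, h.delta_snd, h.delta_trd, rhsA, rhsB, rhsC,
      map_ofNat]
    linear_combination P.sol.1 * (C (1 + P.k) * X 1 * P.sol.2.2 - C (1 - P.k) * serS * P.sol.2.1)
      * C_half_mul_two

theorem Regular.det_a0 (h : P.Regular) :
    (C (P.σ / 2) + P.pertA P.sol - P.sol.1) * (C (P.σ / 2) + P.pertA P.sol - P.sol.1)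
      + (P.pertB P.sol - P.sol.2.1) * (P.pertC P.sol - P.sol.2.2)
      = C ((P.σ / 2 - P.a) ^ 2 + P.b * P.c) := by
  have hs := h.supp
  have hA := ((Supported.const (P.σ / 2)).add (supported_pertA (P := P) hs)).sub hs.1
  rw [h.eq_C ((hA.mul hA).add (((supported_pertB hs).sub hs.2.1).mul
    ((supported_pertC hs).sub hs.2.2)))]
  · congr 1
    simp [constantCoeff_sol_fst, constantCoeff_sol_snd, constantCoeff_sol_trd, coeff_zero_pertA,
      coeff_zero_pertB, coeff_zero_pertC]; ring
  · have e : C P.σ = (2 : Ser) * C (P.σ / 2) := by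
      rw [← map_ofNat (C (σ := Fin 2) (R := ℂ)) 2, ← map_mul]; congr 1; ring
    simp only [delta_add, delta_sub, delta_mul, delta_C, h.delta_fst, h.delta_snd, h.delta_trd,
      h.delta_pertA, h.delta_pertB, h.delta_pertC, rhsA, rhsB, rhsC, map_ofNat, e]
    ring

/-- This is the trace of the perturbation of `A₀ + Aₓ` against the conjugated `J`: the diagonal of
`A₀ + Aₓ` in the original basis does not move. It follows from the definitions alone, for any triple
of series. -/
theorem diag_eq_zero (F : Ser × Ser × Ser) :
    C (2 * P.k) * P.pertA F + C (1 + P.k) * P.pertNu F + C (1 - P.k) * (X 0 * P.pertB F) = 0 := by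
  simp only [pertA, pertNu, pertB, serX, serS, map_mul, map_ofNat]
  linear_combination C P.k * (C (1 + P.k) * X 1 * invDelta P.σ (1 - P.σ) F.2.2
    - C (1 - P.k) * X 0 ^ 2 * X 1 * invDelta P.σ (1 + P.σ) F.2.1) * C_half_mul_two

end InitData

end PainleveFive

/-! ### Evaluation of cone-supported series on the universal covering. -/

namespace PainleveFive

open MvPowerSeries Finset
open scoped ENNReal NNReal

/-- `t = x / (ρ x ^ σ)` at the point `x = exp u`. -/
noncomputable def tVar (σ ρ u : ℂ) : ℂ := Complex.exp u * (rhoPow σ ρ u)⁻¹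

/-- The sum of the series `f` at `ξ = ρ x ^ σ`, `t = x / ξ`, `x = exp u`. -/
noncomputable def evalAt (σ ρ : ℂ) (f : Ser) (u : ℂ) : ℂ :=
  ∑' α, coeff α f * chr (rhoPow σ ρ u) (tVar σ ρ u) α

theorem rhoPow_ne_zero {ρ : ℂ} (hρ : ρ ≠ 0) (σ u : ℂ) : rhoPow σ ρ u ≠ 0 :=
  mul_ne_zero hρ (Complex.exp_ne_zero _)

theorem rhoPow_mul_tVar {ρ : ℂ} (hρ : ρ ≠ 0) (σ u : ℂ) :
    rhoPow σ ρ u * tVar σ ρ u = Complex.exp u := by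
  have := rhoPow_ne_zero hρ σ u
  rw [tVar]; field_simp

theorem hasDerivAt_rhoPow (σ ρ u : ℂ) : HasDerivAt (rhoPow σ ρ) (σ * rhoPow σ ρ u) u := by
  have h : HasDerivAt (fun u : ℂ => σ * u) (σ * 1) u := (hasDerivAt_id u).const_mul σ
  exact (h.cexp.const_mul ρ).congr_deriv (by rw [rhoPow]; ring)

theorem hasDerivAt_tVar {ρ : ℂ} (hρ : ρ ≠ 0) (σ u : ℂ) :
    HasDerivAt (tVar σ ρ) ((1 - σ) * tVar σ ρ u) u := by
  have h0 := rhoPow_ne_zero hρ σ u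
  refine ((Complex.hasDerivAt_exp u).mul ((hasDerivAt_rhoPow σ ρ u).inv h0)).congr_deriv ?_
  rw [tVar]
  simp only [Pi.inv_apply]
  field_simp
  ring

/-- In the coordinate `u = log x` the operator `x d/dx` is `d/du`, so `delta` corresponds to the
ordinary derivative. -/
theorem hasDerivAt_chr {ρ : ℂ} (hρ : ρ ≠ 0) (σ u : ℂ) (α : Idx) :
    HasDerivAt (fun u => chr (rhoPow σ ρ u) (tVar σ ρ u) α)
      (eig σ α * chr (rhoPow σ ρ u) (tVar σ ρ u) α) u := by
  refine (((hasDerivAt_rhoPow σ ρ u).pow (α 0)).mul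
    ((hasDerivAt_tVar hρ σ u).pow (α 1))).congr_deriv ?_
  have key : ∀ (n : ℕ) (z : ℂ), (n : ℂ) * z ^ (n - 1) * z = n * z ^ n := fun n z => by
    rcases n with _ | n
    · simp
    · simp [pow_succ]; ring
  have h0 := key (α 0) (rhoPow σ ρ u)
  have h1 := key (α 1) (tVar σ ρ u)
  simp only [chr, eig, Pi.pow_apply]
  linear_combination σ * (tVar σ ρ u) ^ α 1 * h0 + (1 - σ) * (rhoPow σ ρ u) ^ α 0 * h1

/-- One has `|ξ^j t^n|² = |ξ² t|^j |t|^(2n-j)`, and both `|ξ² t| = |x ξ|` and `|t| = |x/ξ|` are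
below `r` on Ω. Hence the cone `j ≤ 2n` is the right support for this domain. -/
theorem enorm_chr_le {σ ρ u : ℂ} (hρ : ρ ≠ 0) {r : ℝ≥0} (hu : u ∈ omegaFull σ ρ r) (α : Idx) :
    ‖chr (rhoPow σ ρ u) (tVar σ ρ u) α‖ₑ ≤ coneWeight r α := by
  unfold coneWeight
  split_ifs with h
  · rw [enorm_eq_nnnorm]
    norm_cast
    rw [← NNReal.coe_le_coe]
    push_cast
    obtain ⟨h1, h2⟩ := hu
    rw [← rhoPow_mul_tVar hρ σ u] at h1
    change ‖tVar σ ρ u‖ < r at h2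
    rw [norm_mul, norm_mul] at h1
    simp only [chr, norm_mul, norm_pow]
    set a := ‖rhoPow σ ρ u‖
    set b := ‖tVar σ ρ u‖
    have ha : 0 ≤ a := norm_nonneg _
    have hb : 0 ≤ b := norm_nonneg _
    obtain ⟨m, hm⟩ := Nat.exists_eq_add_of_le h
    refine le_of_sq_le_sq ?_ (by positivity)
    calc (a ^ α 0 * b ^ α 1) ^ 2 = a ^ (2 * α 0) * b ^ (2 * α 1) := by ring
      _ = (a * b * a) ^ α 0 * b ^ m := by rw [hm]; ring
      _ ≤ (r : ℝ) ^ α 0 * (r : ℝ) ^ m := by gcongr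
      _ = (r ^ α 1) ^ 2 := by rw [← pow_add, ← hm]; ring
  · exact le_top

theorem isOpen_omegaFull {ρ : ℂ} (hρ : ρ ≠ 0) (σ : ℂ) (ε : ℝ) : IsOpen (omegaFull σ ρ ε) := by
  have h1 : Continuous (rhoPow σ ρ) := by unfold rhoPow; fun_prop
  have h2 : Continuous fun u => (rhoPow σ ρ u)⁻¹ := h1.inv₀ (rhoPow_ne_zero hρ σ)
  exact (isOpen_lt (Complex.continuous_exp.mul h1).norm continuous_const).inter
    (isOpen_lt (Complex.continuous_exp.mul h2).norm continuous_const)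

theorem hasEv_evalAt {σ ρ u : ℂ} (hρ : ρ ≠ 0) {r : ℝ≥0} {f : Ser}
    (hf : wnorm (coneWeight r) f ≠ ∞) (hu : u ∈ omegaFull σ ρ r) :
    HasEv (rhoPow σ ρ u) (tVar σ ρ u) f (evalAt σ ρ f u) :=
  HasEv.of_wnorm hf (enorm_chr_le hρ hu)

theorem differentiableOn_evalAt {σ ρ : ℂ} (hρ : ρ ≠ 0) {r : ℝ≥0} {f : Ser}
    (hf : wnorm (coneWeight r) f ≠ ∞) :
    DifferentiableOn ℂ (evalAt σ ρ f) (omegaFull σ ρ r) ∧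
    ∀ u ∈ omegaFull σ ρ r, HasSum (fun α => coeff α (delta σ f) *
      chr (rhoPow σ ρ u) (tVar σ ρ u) α) (deriv (evalAt σ ρ f) u) := by
  have hs : Summable fun α => (‖coeff α f‖ₑ * coneWeight r α).toReal := ENNReal.summable_toReal hf
  have hle : ∀ (α : Idx) (u : ℂ), u ∈ omegaFull σ ρ r →
      ‖coeff α f * chr (rhoPow σ ρ u) (tVar σ ρ u) α‖ ≤ (‖coeff α f‖ₑ * coneWeight r α).toReal :=
    fun α u hu => by
      rw [← toReal_enorm, enorm_mul]
      refine ENNReal.toReal_mono (ENNReal.ne_top_of_tsum_ne_top hf α) ?_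
      gcongr
      exact enorm_chr_le hρ hu α
  have hd : ∀ α : Idx, ∀ u, HasDerivAt (fun u => coeff α f * chr (rhoPow σ ρ u) (tVar σ ρ u) α)
      (coeff α f * (eig σ α * chr (rhoPow σ ρ u) (tVar σ ρ u) α)) u := fun α u =>
    (hasDerivAt_chr hρ σ u α).const_mul _
  have hdiff : ∀ α : Idx, DifferentiableOn ℂ
      (fun u => coeff α f * chr (rhoPow σ ρ u) (tVar σ ρ u) α) (omegaFull σ ρ r) := fun α u _ =>
    (hd α u).differentiableAt.differentiableWithinAt
  have hopen := isOpen_omegaFull hρ σ r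
  refine ⟨Complex.differentiableOn_tsum_of_summable_norm hs hdiff hopen hle, fun u hu => ?_⟩
  have := Complex.hasSum_deriv_of_summable_norm hs hdiff hopen hle hu
  have e : (fun α => coeff α (delta σ f) * chr (rhoPow σ ρ u) (tVar σ ρ u) α) = fun α =>
      deriv (fun u => coeff α f * chr (rhoPow σ ρ u) (tVar σ ρ u) α) u := by
    funext α
    rw [(hd α u).deriv, coeff_delta]
    ring
  rw [e]
  exact this

theorem hasDerivAt_evalAt {σ ρ u : ℂ} (hρ : ρ ≠ 0) {r : ℝ≥0} {f g : Ser} {v : ℂ}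
    (hf : wnorm (coneWeight r) f ≠ ∞) (hu : u ∈ omegaFull σ ρ r) (hfg : delta σ f = g)
    (hg : HasEv (rhoPow σ ρ u) (tVar σ ρ u) g v) : HasDerivAt (evalAt σ ρ f) v u := by
  obtain ⟨h1, h2⟩ := differentiableOn_evalAt (σ := σ) hρ hf
  have h3 := h2 u hu
  rw [hfg] at h3
  rw [hg.hasSum.unique h3]
  exact (h1.differentiableAt ((isOpen_omegaFull hρ σ r).mem_nhds hu)).hasDerivAt

end PainleveFive

/-! ### From the Schlesinger system to the fifth Painlevé equation. -/

namespace PainleveFive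

open Filter Topology

/-- A solution of the first order system of Jimbo and Miwa solves the fifth Painlevé equation. -/
theorem equation_of_jimboMiwa {θ₀ θₓ θᵢ : ℂ} {f z : ℂ → ℂ} {u : ℂ} (h0 : f u ≠ 0) (h1 : f u ≠ 1)
    (hf : ∀ᶠ v in 𝓝 u, HasDerivAt f (Complex.exp v * f v - 2 * z v * (f v - 1) ^ 2
      - (f v - 1) * ((θ₀ - θₓ + θᵢ) / 2 * f v - (3 * θ₀ + θₓ + θᵢ) / 2)) v)
    (hz : HasDerivAt z (f u * z u * (z u + (θ₀ - θₓ + θᵢ) / 2)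
      - (z u + θ₀) * (z u + (θ₀ + θₓ + θᵢ) / 2) / f u) u) :
    Equation θ₀ θₓ θᵢ f u := by
  have hx := Complex.exp_ne_zero u
  have hfu := hf.self_of_nhds
  have hd : deriv f =ᶠ[𝓝 u] fun v => Complex.exp v * f v - 2 * z v * (f v - 1) ^ 2
      - (f v - 1) * ((θ₀ - θₓ + θᵢ) / 2 * f v - (3 * θ₀ + θₓ + θᵢ) / 2) :=
    hf.mono fun v hv => hv.deriv
  have he := Complex.hasDerivAt_exp u
  have h2 := (((he.mul hfu).sub ((hz.const_mul 2).mul ((hfu.sub_const 1).pow 2))).sub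
    ((hfu.sub_const 1).mul ((hfu.const_mul ((θ₀ - θₓ + θᵢ) / 2)).sub_const
      ((3 * θ₀ + θₓ + θᵢ) / 2)))).congr_of_eventuallyEq hd
  have h3 := (h2.div he hx).deriv
  have h4 : xDeriv f = deriv f / Complex.exp := rfl
  unfold Equation
  rw [h4, xDeriv, h3, Pi.div_apply, hfu.deriv]
  have h1' : f u - 1 ≠ 0 := sub_ne_zero.2 h1
  simp only [Pi.pow_apply]
  set x := Complex.exp u
  generalize hy : f u = y at *
  generalize z u = w at *
  -- With `s = y - 1` as an atom, what remains is a rational identity whose denominators can be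
  -- cleared.
  obtain ⟨s, rfl⟩ : ∃ s, y = s + 1 := ⟨y - 1, by ring⟩
  simp only [add_sub_cancel_right] at *
  field_simp
  ring

/-- The quotient of entries of the Schlesinger system that solves the fifth Painlevé equation. -/
theorem equation_of_schlesinger {θ₀ θₓ θᵢ : ℂ} {g h m g' m' y : ℂ → ℂ} {U : Set ℂ} (hU : IsOpen U)
    (hg : ∀ u ∈ U, HasDerivAt g (2 * (-θᵢ / 2 * g u - m u * h u) + Complex.exp u * g u) u)
    (hm : ∀ u ∈ U, HasDerivAt m (Complex.exp u * g u) u)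
    (hh : ∀ u ∈ U, HasDerivAt h (m u * g' u - m' u * g u) u)
    (hx : ∀ u ∈ U, h u ^ 2 + g u * g' u = θₓ ^ 2 / 4)
    (h0 : ∀ u ∈ U, (-θᵢ / 2 - h u) ^ 2 + (m u - g u) * (m' u - g' u) = θ₀ ^ 2 / 4)
    (hy : ∀ u, y u = g u * (-θᵢ / 2 - h u + θ₀ / 2) / ((m u - g u) * (h u + θₓ / 2)))
    {u : ℂ} (hu : u ∈ U) (hu0 : y u ≠ 0) (hu1 : y u ≠ 1) : Equation θ₀ θₓ θᵢ y u := by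
  -- Division by zero gives 0, so `y v ≠ 0` excludes the vanishing of the factors of the denominator
  -- as well as of the numerator.
  have key : ∀ v ∈ U, y v ≠ 0 → g v ≠ 0 ∧ m v - g v ≠ 0 ∧ h v + θₓ / 2 ≠ 0 ∧
      -θᵢ / 2 - h v + θ₀ / 2 ≠ 0 := fun v hv hv0 => by
    rw [hy v] at hv0
    refine ⟨?_, ?_, ?_, ?_⟩ <;> (intro h'; simp [h'] at hv0)
  have hyfun : y = fun u => g u * (-θᵢ / 2 - h u + θ₀ / 2) / ((m u - g u) * (h u + θₓ / 2)) :=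
    funext hy
  -- The variable `z` of Jimbo and Miwa is `(A₀)₁₁ - θ₀/2`. The two determinant relations eliminate
  -- the lower left entries from its derivative.
  have hz : ∀ v ∈ U, y v ≠ 0 → m v * g' v - m' v * g v =
      -(y v * (-θᵢ / 2 - h v - θ₀ / 2) * ((-θᵢ / 2 - h v - θ₀ / 2) + (θ₀ - θₓ + θᵢ) / 2)
      - ((-θᵢ / 2 - h v - θ₀ / 2) + θ₀) * ((-θᵢ / 2 - h v - θ₀ / 2) + (θ₀ + θₓ + θᵢ) / 2) / y v) :=
    fun v hv hv0 => by
      obtain ⟨k1, k2, k3, k4⟩ := key v hv hv0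
      have e1 : g' v = (θₓ ^ 2 / 4 - h v ^ 2) / g v := by
        rw [eq_div_iff k1, ← hx v hv]; ring
      have e2 : m' v = g' v + (θ₀ ^ 2 / 4 - (-θᵢ / 2 - h v) ^ 2) / (m v - g v) := by
        rw [← sub_eq_iff_eq_add', eq_div_iff k2, ← h0 v hv]; ring
      rw [e2, e1, hy v]
      generalize hp : m v - g v = p at *
      have hmp : m v = p + g v := by rw [← hp]; ring
      generalize hw : h v + θₓ / 2 = w at *
      have hhw : h v = w - θₓ / 2 := by rw [← hw]; ring
      rw [hmp]
      generalize hq : -θᵢ / 2 - h v + θ₀ / 2 = q at *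
      have hθ : θᵢ = θ₀ - 2 * h v - 2 * q := by rw [← hq]; ring
      rw [hθ, hhw]
      field_simp
      ring
  have hd : ∀ v ∈ U, y v ≠ 0 → HasDerivAt y (Complex.exp v * y v
      - 2 * (-θᵢ / 2 - h v - θ₀ / 2) * (y v - 1) ^ 2
      - (y v - 1) * ((θ₀ - θₓ + θᵢ) / 2 * y v - (3 * θ₀ + θₓ + θᵢ) / 2)) v := fun v hv hv0 => by
    obtain ⟨k1, k2, k3, k4⟩ := key v hv hv0
    have hh' := hh v hv
    rw [hz v hv hv0] at hh'
    have := ((hg v hv).mul ((hh'.const_sub (-θᵢ / 2)).add_const (θ₀ / 2))).div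
      (((hm v hv).sub (hg v hv)).mul (hh'.add_const (θₓ / 2))) (mul_ne_zero k2 k3)
    rw [hyfun]
    refine this.congr_deriv ?_
    simp only [Pi.mul_apply, Pi.sub_apply]
    rw [hy v]
    generalize hp : m v - g v = p at *
    have hmp : m v = p + g v := by rw [← hp]; ring
    generalize hw : h v + θₓ / 2 = w at *
    have hhw : h v = w - θₓ / 2 := by rw [← hw]; ring
    rw [hmp]
    generalize hq : -θᵢ / 2 - h v + θ₀ / 2 = q at *
    have hθ : θᵢ = θ₀ - 2 * h v - 2 * q := by rw [← hq]; ring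
    rw [hθ, hhw]
    field_simp
    ring
  have hcont : ∀ᶠ v in 𝓝 u, y v ≠ 0 := (hd u hu hu0).continuousAt.eventually_ne hu0
  refine equation_of_jimboMiwa (z := fun v => -θᵢ / 2 - h v - θ₀ / 2) hu0 hu1 ?_ ?_
  · filter_upwards [hcont, hU.mem_nhds hu] with v hv hvU using hd v hvU hv
  · refine (((hh u hu).const_sub (-θᵢ / 2)).sub_const (θ₀ / 2)).congr_deriv ?_
    rw [hz u hu hu0]
    ring

end PainleveFive

/-! ### The matrices in the original basis and the meromorphic solution. -/

namespace PainleveFive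

open MvPowerSeries Finset
open scoped ENNReal NNReal

namespace InitData

theorem Regular.delta_pertNu {P : InitData} (h : P.Regular) : delta P.σ (P.pertNu P.sol) =
    C (1 - P.k) * serX * P.sol.1 - C P.k * X 1 * P.sol.2.2 := by
  simp only [pertNu, delta_sub, delta_mul, delta_C, delta_serX, delta_X1,
    h.delta_invDelta_one_sub h.supp.2.2, h.delta_invDelta_one h.supp.1]
  simp only [map_sub, map_one]
  ring

variable (P : InitData) (ρ : ℂ)

/-- The upper right entry of `Aₓ`. -/
noncomputable def entryX12 (u : ℂ) : ℂ :=
  2 * evalAt P.σ ρ P.sol.1 u - rhoPow P.σ ρ u * evalAt P.σ ρ P.sol.2.1 u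
    + (rhoPow P.σ ρ u)⁻¹ * evalAt P.σ ρ P.sol.2.2 u

/-- The upper left entry of `Aₓ`. -/
noncomputable def entryX11 (u : ℂ) : ℂ :=
  P.k * evalAt P.σ ρ P.sol.1 u + ((1 + P.k) * ((rhoPow P.σ ρ u)⁻¹ * evalAt P.σ ρ P.sol.2.2 u)
    + (1 - P.k) * (rhoPow P.σ ρ u * evalAt P.σ ρ P.sol.2.1 u)) / 2

/-- The lower left entry of `Aₓ`. -/
noncomputable def entryX21 (u : ℂ) : ℂ :=
  (2 * (1 - P.k ^ 2) * evalAt P.σ ρ P.sol.1 u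
    + (1 - P.k) ^ 2 * (rhoPow P.σ ρ u * evalAt P.σ ρ P.sol.2.1 u)
    - (1 + P.k) ^ 2 * ((rhoPow P.σ ρ u)⁻¹ * evalAt P.σ ρ P.sol.2.2 u)) / 4

/-- The upper right entry of `A₀ + Aₓ`. -/
noncomputable def entryM12 (u : ℂ) : ℂ :=
  P.σ + 2 * evalAt P.σ ρ (P.pertA P.sol) u - rhoPow P.σ ρ u * evalAt P.σ ρ (P.pertB P.sol) u
    + evalAt P.σ ρ (P.pertNu P.sol) u

/-- The lower left entry of `A₀ + Aₓ`. -/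
noncomputable def entryM21 (u : ℂ) : ℂ :=
  (2 * (1 - P.k ^ 2) * (P.σ / 2 + evalAt P.σ ρ (P.pertA P.sol) u)
    + (1 - P.k) ^ 2 * (rhoPow P.σ ρ u * evalAt P.σ ρ (P.pertB P.sol) u)
    - (1 + P.k) ^ 2 * evalAt P.σ ρ (P.pertNu P.sol) u) / 4

/-- The fifth Painlevé transcendent belonging to the initial data. -/
noncomputable def transcendent (θ₀ θₓ θᵢ : ℂ) (u : ℂ) : ℂ :=
  P.entryX12 ρ u * (-θᵢ / 2 - P.entryX11 ρ u + θ₀ / 2)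
    / ((P.entryM12 ρ u - P.entryX12 ρ u) * (P.entryX11 ρ u + θₓ / 2))

/-- The initial data satisfy the constraints given by the parameters of the equation. -/
structure Admissible (P : InitData) (θ₀ θₓ θᵢ : ℂ) : Prop where
  diag : P.σ * P.k = -θᵢ
  detX : P.a ^ 2 + P.b * P.c = θₓ ^ 2 / 4
  det0 : (P.σ / 2 - P.a) ^ 2 + P.b * P.c = θ₀ ^ 2 / 4

/-- The formal solution and its associated series have finite norm. -/
structure ConvergentAt (P : InitData) (r : ℝ≥0) : Prop where
  a : wnorm (coneWeight r) P.sol.1 ≠ ∞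
  b : wnorm (coneWeight r) P.sol.2.1 ≠ ∞
  c : wnorm (coneWeight r) P.sol.2.2 ≠ ∞
  pertA : wnorm (coneWeight r) (P.pertA P.sol) ≠ ∞
  pertB : wnorm (coneWeight r) (P.pertB P.sol) ≠ ∞
  pertNu : wnorm (coneWeight r) (P.pertNu P.sol) ≠ ∞

variable {P ρ} {θ₀ θₓ θᵢ : ℂ} {r : ℝ≥0} {u : ℂ}

/-- Undoing the conjugation preserves traces and determinants. The first identity is half the trace
of `A₀ + Aₓ` against the conjugated `J`; the others transport `det_ax` and `det_a0`. -/
theorem ConvergentAt.mainIdentities (hc : P.ConvergentAt r) (h : P.Regular)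
    (hA : P.Admissible θ₀ θₓ θᵢ) (hρ : ρ ≠ 0) (hu : u ∈ omegaFull P.σ ρ r) :
    -θᵢ / 2 = P.k * (P.σ / 2 + evalAt P.σ ρ (P.pertA P.sol) u)
      + ((1 + P.k) * evalAt P.σ ρ (P.pertNu P.sol) u
        + (1 - P.k) * (rhoPow P.σ ρ u * evalAt P.σ ρ (P.pertB P.sol) u)) / 2 ∧
    P.entryX11 ρ u ^ 2 + P.entryX12 ρ u * P.entryX21 ρ u = θₓ ^ 2 / 4 ∧
    (-θᵢ / 2 - P.entryX11 ρ u) ^ 2 + (P.entryM12 ρ u - P.entryX12 ρ u)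
      * (P.entryM21 ρ u - P.entryX21 ρ u) = θ₀ ^ 2 / 4 := by
  have ea := hasEv_evalAt hρ hc.a hu
  have eb := hasEv_evalAt hρ hc.b hu
  have ec := hasEv_evalAt hρ hc.c hu
  have eA := hasEv_evalAt hρ hc.pertA hu
  have eB := hasEv_evalAt hρ hc.pertB hu
  have eN := hasEv_evalAt hρ hc.pertNu hu
  have eC := HasEv.X0.mul eN
  rw [← pertC_eq_mul_pertNu] at eC
  have h1 := ((ea.mul ea).add (eb.mul ec)).of_eq (HasEv.const _) h.det_ax
  have e1 := ((HasEv.const (P.σ / 2)).add eA).sub ea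
  have h2 := ((e1.mul e1).add ((eB.sub eb).mul (eC.sub ec))).of_eq (HasEv.const _) h.det_a0
  have h3 := ((((HasEv.const (2 * P.k)).mul eA).add ((HasEv.const (1 + P.k)).mul eN)).add
    ((HasEv.const (1 - P.k)).mul (HasEv.X0.mul eB))).of_eq ((HasEv.const 0).congr (map_zero _) rfl)
    (P.diag_eq_zero P.sol)
  have hξ := rhoPow_ne_zero hρ P.σ u
  rw [hA.detX] at h1
  rw [hA.det0] at h2
  have h4 : -θᵢ / 2 = P.k * (P.σ / 2 + evalAt P.σ ρ (P.pertA P.sol) u)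
      + ((1 + P.k) * evalAt P.σ ρ (P.pertNu P.sol) u
        + (1 - P.k) * (rhoPow P.σ ρ u * evalAt P.σ ρ (P.pertB P.sol) u)) / 2 := by
    rw [← hA.diag]
    linear_combination -1 / 2 * h3
  refine ⟨h4, ?_, ?_⟩
  · rw [← h1]
    simp only [entryX11, entryX12, entryX21]
    field_simp
    ring
  · rw [h4, ← h2]
    simp only [entryX11, entryX12, entryX21, entryM12, entryM21]
    field_simp
    ring

/-- The entries of `Aₓ` are constant linear combinations of `a`, `ξ b`, `c/ξ`. Differentiating `ξ`
and `ξ⁻¹` supplies the commutator with `diag(σ/2, -σ/2)`; the rest is the system for the series. -/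
theorem ConvergentAt.hasDerivAt_entries (hc : P.ConvergentAt r) (h : P.Regular)
    (hA : P.Admissible θ₀ θₓ θᵢ) (hρ : ρ ≠ 0) (hu : u ∈ omegaFull P.σ ρ r) :
    HasDerivAt (P.entryX12 ρ) (2 * (-θᵢ / 2 * P.entryX12 ρ u - P.entryM12 ρ u * P.entryX11 ρ u)
      + Complex.exp u * P.entryX12 ρ u) u ∧
    HasDerivAt (P.entryM12 ρ) (Complex.exp u * P.entryX12 ρ u) u ∧
    HasDerivAt (P.entryX11 ρ) (P.entryM12 ρ u * P.entryX21 ρ u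
      - P.entryM21 ρ u * P.entryX12 ρ u) u := by
  have ea := hasEv_evalAt hρ hc.a hu
  have eb := hasEv_evalAt hρ hc.b hu
  have ec := hasEv_evalAt hρ hc.c hu
  have eA := hasEv_evalAt hρ hc.pertA hu
  have eB := hasEv_evalAt hρ hc.pertB hu
  have eN := hasEv_evalAt hρ hc.pertNu hu
  have eC := HasEv.X0.mul eN
  rw [← pertC_eq_mul_pertNu] at eC
  have ex : HasEv (rhoPow P.σ ρ u) (tVar P.σ ρ u) serX _ := HasEv.X0.mul HasEv.X1
  have es : HasEv (rhoPow P.σ ρ u) (tVar P.σ ρ u) serS _ :=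
    ((HasEv.X0.mul HasEv.X0).mul HasEv.X1).congr (by rw [serS, pow_two]) rfl
  have et : HasEv (rhoPow P.σ ρ u) (tVar P.σ ρ u) (X 1) _ := HasEv.X1
  have da := hasDerivAt_evalAt hρ hc.a hu h.delta_fst
    (((eB.mul ec).sub (eC.mul eb)).add ((HasEv.const (1 / 2)).mul
      ((((HasEv.const (1 + P.k)).mul et).mul ec).sub (((HasEv.const (1 - P.k)).mul es).mul eb))))
  have db := hasDerivAt_evalAt hρ hc.b hu h.delta_snd
    ((((HasEv.const 2).mul ((eA.mul eb).sub (eB.mul ea))).add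
      (((HasEv.const P.k).mul ex).mul eb)).sub (((HasEv.const (1 + P.k)).mul et).mul ea))
  have dc := hasDerivAt_evalAt hρ hc.c hu h.delta_trd
    ((((HasEv.const 2).mul ((eC.mul ea).sub (eA.mul ec))).add
      (((HasEv.const (1 - P.k)).mul es).mul ea)).sub (((HasEv.const P.k).mul ex).mul ec))
  have dA := hasDerivAt_evalAt hρ hc.pertA hu h.delta_pertA
    ((HasEv.const (1 / 2)).mul
      ((((HasEv.const (1 + P.k)).mul et).mul ec).sub (((HasEv.const (1 - P.k)).mul es).mul eb)))
  have dB := hasDerivAt_evalAt hρ hc.pertB hu h.delta_pertB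
    ((((HasEv.const P.σ).mul eB).neg.add (((HasEv.const P.k).mul ex).mul eb)).sub
      (((HasEv.const (1 + P.k)).mul et).mul ea))
  have dN := hasDerivAt_evalAt hρ hc.pertNu hu h.delta_pertNu
    ((((HasEv.const (1 - P.k)).mul ex).mul ea).sub (((HasEv.const P.k).mul et).mul ec))
  have hξ := rhoPow_ne_zero hρ P.σ u
  have dξ := hasDerivAt_rhoPow P.σ ρ u
  have dι := dξ.inv hξ
  obtain ⟨hd, -, -⟩ := hc.mainIdentities h hA hρ hu
  have hx := (rhoPow_mul_tVar hρ P.σ u).symm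
  refine ⟨?_, ?_, ?_⟩
  · refine (((da.const_mul 2).sub (dξ.mul db)).add (dι.mul dc)).congr_deriv ?_
    rw [hd, hx]
    simp only [entryX11, entryX12, entryM12, Pi.inv_apply]
    field_simp
    ring
  · refine ((((dA.const_mul 2).const_add P.σ).sub (dξ.mul dB)).add dN).congr_deriv ?_
    rw [hx]
    simp only [entryX12]
    field_simp
    ring
  · refine ((da.const_mul P.k).add ((((dι.mul dc).const_mul (1 + P.k)).add
      ((dξ.mul db).const_mul (1 - P.k))).div_const 2)).congr_deriv ?_
    simp only [entryX12, entryX21, entryM12, entryM21, Pi.inv_apply]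
    field_simp
    ring

theorem ConvergentAt.isMeromorphicSolutionOn (hc : P.ConvergentAt r) (h : P.Regular)
    (hA : P.Admissible θ₀ θₓ θᵢ) (hρ : ρ ≠ 0) :
    IsMeromorphicSolutionOn θ₀ θₓ θᵢ (P.transcendent ρ θ₀ θₓ θᵢ) (omegaFull P.σ ρ r) := by
  have hopen := isOpen_omegaFull hρ P.σ r
  have an : ∀ {f f' : ℂ → ℂ}, (∀ v ∈ omegaFull P.σ ρ r, HasDerivAt f (f' v) v) →
      ∀ v ∈ omegaFull P.σ ρ r, MeromorphicAt f v := fun {f f'} hf v hv =>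
    (DifferentiableOn.analyticAt (fun w hw => (hf w hw).differentiableAt.differentiableWithinAt)
      (hopen.mem_nhds hv)).meromorphicAt
  have hd := fun v (hv : v ∈ omegaFull P.σ ρ r) => hc.hasDerivAt_entries h hA hρ hv
  refine ⟨fun v hv => ?_, fun v hv _ h0 h1 => ?_⟩
  · have m1 := an (fun v hv => (hd v hv).1) v hv
    have m2 := an (fun v hv => (hd v hv).2.1) v hv
    have m3 := an (fun v hv => (hd v hv).2.2) v hv
    exact (m1.mul (((MeromorphicAt.const _ _).sub m3).add (MeromorphicAt.const _ _))).div
      ((m2.sub m1).mul (m3.add (MeromorphicAt.const _ _)))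
  · exact equation_of_schlesinger hopen (fun v hv => (hd v hv).1) (fun v hv => (hd v hv).2.1)
      (fun v hv => (hd v hv).2.2) (fun v hv => (hc.mainIdentities h hA hρ hv).2.1)
      (fun v hv => (hc.mainIdentities h hA hρ hv).2.2) (fun _ => rfl) hv h0 h1

end InitData

end PainleveFive

/-! ### Rational dependence of the coefficients on σ. -/

namespace PainleveFive

open MvPowerSeries Finset
open scoped ENNReal NNReal

namespace IsRationalOn

variable {θ₀ θₓ θᵢ : ℂ} {S : Set ℂ} {c d : ℂ → ℂ}

theorem congr (hc : IsRationalOn θ₀ θₓ θᵢ S c) (h : ∀ σ ∈ S, d σ = c σ) :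
    IsRationalOn θ₀ θₓ θᵢ S d := by
  obtain ⟨p, q, hpq⟩ := hc
  exact ⟨p, q, fun σ hσ => ⟨(hpq σ hσ).1, (h σ hσ).trans (hpq σ hσ).2⟩⟩

theorem const {z : ℂ} (hz : z ∈ QTheta θ₀ θₓ θᵢ) : IsRationalOn θ₀ θₓ θᵢ S fun _ => z :=
  ⟨Polynomial.C ⟨z, hz⟩, 1, fun σ _ => by
    simp only [map_one, Polynomial.aeval_C, div_one]
    exact ⟨one_ne_zero, rfl⟩⟩

theorem id : IsRationalOn θ₀ θₓ θᵢ S fun σ => σ :=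
  ⟨Polynomial.X, 1, fun σ _ => by simp⟩

theorem add (hc : IsRationalOn θ₀ θₓ θᵢ S c) (hd : IsRationalOn θ₀ θₓ θᵢ S d) :
    IsRationalOn θ₀ θₓ θᵢ S fun σ => c σ + d σ := by
  obtain ⟨p, q, h⟩ := hc
  obtain ⟨p', q', h'⟩ := hd
  refine ⟨p * q' + q * p', q * q', fun σ hσ => ?_⟩
  obtain ⟨h1, h2⟩ := h σ hσ
  obtain ⟨h3, h4⟩ := h' σ hσ
  simp only [map_mul, map_add]
  exact ⟨mul_ne_zero h1 h3, by rw [h2, h4, div_add_div _ _ h1 h3]⟩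

theorem mul (hc : IsRationalOn θ₀ θₓ θᵢ S c) (hd : IsRationalOn θ₀ θₓ θᵢ S d) :
    IsRationalOn θ₀ θₓ θᵢ S fun σ => c σ * d σ := by
  obtain ⟨p, q, h⟩ := hc
  obtain ⟨p', q', h'⟩ := hd
  refine ⟨p * p', q * q', fun σ hσ => ?_⟩
  obtain ⟨h1, h2⟩ := h σ hσ
  obtain ⟨h3, h4⟩ := h' σ hσ
  simp only [map_mul]
  exact ⟨mul_ne_zero h1 h3, by rw [h2, h4, div_mul_div_comm]⟩

theorem natCast (n : ℕ) : IsRationalOn θ₀ θₓ θᵢ S fun _ => (n : ℂ) := const (natCast_mem _ n)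

theorem neg (hc : IsRationalOn θ₀ θₓ θᵢ S c) : IsRationalOn θ₀ θₓ θᵢ S fun σ => -c σ :=
  ((const (neg_mem (one_mem _))).mul hc).congr fun σ _ => by ring

theorem sub (hc : IsRationalOn θ₀ θₓ θᵢ S c) (hd : IsRationalOn θ₀ θₓ θᵢ S d) :
    IsRationalOn θ₀ θₓ θᵢ S fun σ => c σ - d σ :=
  (hc.add hd.neg).congr fun _ _ => sub_eq_add_neg _ _

theorem inv (hc : IsRationalOn θ₀ θₓ θᵢ S c) (h0 : ∀ σ ∈ S, c σ ≠ 0) :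
    IsRationalOn θ₀ θₓ θᵢ S fun σ => (c σ)⁻¹ := by
  obtain ⟨p, q, h⟩ := hc
  refine ⟨q, p, fun σ hσ => ?_⟩
  obtain ⟨h1, h2⟩ := h σ hσ
  refine ⟨fun h3 => h0 σ hσ (by rw [h2, h3, zero_div]), by simp only [h2, inv_div]⟩

theorem div (hc : IsRationalOn θ₀ θₓ θᵢ S c) (hd : IsRationalOn θ₀ θₓ θᵢ S d)
    (h0 : ∀ σ ∈ S, d σ ≠ 0) : IsRationalOn θ₀ θₓ θᵢ S fun σ => c σ / d σ :=
  (hc.mul (hd.inv h0)).congr fun _ _ => div_eq_mul_inv _ _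

theorem sum {ι : Type*} (s : Finset ι) {c : ι → ℂ → ℂ}
    (h : ∀ i ∈ s, IsRationalOn θ₀ θₓ θᵢ S (c i)) :
    IsRationalOn θ₀ θₓ θᵢ S fun σ => ∑ i ∈ s, c i σ := by
  classical
  induction s using Finset.induction_on with
  | empty => exact (natCast 0).congr fun σ _ => by simp
  | insert i s hi ih =>
    exact ((h i (mem_insert_self i s)).add (ih fun j hj => h j (mem_insert_of_mem hj))).congr
      fun σ _ => sum_insert hi

theorem comp_neg (hc : IsRationalOn θ₀ θₓ θᵢ (-S) c) :
    IsRationalOn θ₀ θₓ θᵢ S fun σ => c (-σ) := by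
  obtain ⟨p, q, h⟩ := hc
  refine ⟨p.comp (-Polynomial.X), q.comp (-Polynomial.X), fun σ hσ => ?_⟩
  simpa [Polynomial.aeval_comp] using h (-σ) (by simpa using hσ)

end IsRationalOn

/-- All coefficients of the family `F` of series are rational on `S`. -/
def RatFam (θ₀ θₓ θᵢ : ℂ) (S : Set ℂ) (F : ℂ → Ser) : Prop :=
  ∀ α, IsRationalOn θ₀ θₓ θᵢ S fun σ => coeff α (F σ)

namespace RatFam

variable {θ₀ θₓ θᵢ : ℂ} {S : Set ℂ} {F G : ℂ → Ser}

theorem congr (hF : RatFam θ₀ θₓ θᵢ S F) (h : ∀ σ ∈ S, G σ = F σ) : RatFam θ₀ θₓ θᵢ S G :=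
  fun α => (hF α).congr fun σ hσ => by rw [h σ hσ]

theorem add (hF : RatFam θ₀ θₓ θᵢ S F) (hG : RatFam θ₀ θₓ θᵢ S G) :
    RatFam θ₀ θₓ θᵢ S fun σ => F σ + G σ := fun α =>
  ((hF α).add (hG α)).congr fun _ _ => map_add _ _ _

theorem sub (hF : RatFam θ₀ θₓ θᵢ S F) (hG : RatFam θ₀ θₓ θᵢ S G) :
    RatFam θ₀ θₓ θᵢ S fun σ => F σ - G σ := fun α =>
  ((hF α).sub (hG α)).congr fun _ _ => map_sub _ _ _

theorem mul (hF : RatFam θ₀ θₓ θᵢ S F) (hG : RatFam θ₀ θₓ θᵢ S G) :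
    RatFam θ₀ θₓ θᵢ S fun σ => F σ * G σ := fun α =>
  (IsRationalOn.sum (antidiagonal α) (c := fun p σ => coeff p.1 (F σ) * coeff p.2 (G σ))
    fun p _ => (hF p.1).mul (hG p.2)).congr fun _ _ => coeff_mul _ _ _

theorem of_const {f : Ser} (h : ∀ α, coeff α f ∈ QTheta θ₀ θₓ θᵢ) :
    RatFam θ₀ θₓ θᵢ S fun _ => f := fun α => IsRationalOn.const (h α)

theorem X (i : Fin 2) : RatFam θ₀ θₓ θᵢ S fun _ => X i := of_const fun α => by
  rw [coeff_X]
  split_ifs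
  exacts [one_mem _, zero_mem _]

theorem C {c : ℂ → ℂ} (hc : IsRationalOn θ₀ θₓ θᵢ S c) :
    RatFam θ₀ θₓ θᵢ S fun σ => C (c σ) := fun α => by
  by_cases h : α = 0
  · exact hc.congr fun σ _ => by rw [h, coeff_zero_C]
  · exact (IsRationalOn.natCast 0).congr fun σ _ => by rw [coeff_C_of_ne_zero h, Nat.cast_zero]

theorem serX : RatFam θ₀ θₓ θᵢ S fun _ => serX := (X 0).mul (X 1)

theorem serS : RatFam θ₀ θₓ θᵢ S fun _ => serS :=
  (((X 0).mul (X 0)).mul (X 1)).congr fun σ _ => by rw [PainleveFive.serS, pow_two]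

/-- A divisor that vanished at some points of `S` only would spoil rationality, since `0⁻¹ = 0`.
Hence the dichotomy: nowhere zero, or identically zero as for the exponent 0 with `lam = 0`. -/
theorem invDelta (hF : RatFam θ₀ θₓ θᵢ S F) (hs : ∀ σ ∈ S, Supported (F σ)) {lam : ℂ → ℂ}
    (hl : IsRationalOn θ₀ θₓ θᵢ S lam) (h : ∀ α : Idx, α 0 ≤ 2 * α 1 →
      (∀ σ ∈ S, eig σ α + lam σ ≠ 0) ∨ ∀ σ ∈ S, eig σ α + lam σ = 0) :
    RatFam θ₀ θₓ θᵢ S fun σ => invDelta σ (lam σ) (F σ) := fun α => by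
  by_cases hα : α 0 ≤ 2 * α 1
  · rcases h α hα with h1 | h1
    · have he : IsRationalOn θ₀ θₓ θᵢ S fun σ => eig σ α + lam σ :=
        (((IsRationalOn.natCast (α 0)).mul IsRationalOn.id).add
          ((IsRationalOn.natCast (α 1)).mul
            ((IsRationalOn.const (one_mem _)).sub IsRationalOn.id))).add hl
      exact (he.inv h1).mul (hF α)
    · exact (IsRationalOn.natCast 0).congr fun σ hσ => by
        rw [coeff_invDelta, h1 σ hσ, inv_zero, zero_mul, Nat.cast_zero]
  · exact (IsRationalOn.natCast 0).congr fun σ hσ => by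
      rw [coeff_invDelta, hs σ hσ α (by omega), mul_zero, Nat.cast_zero]

/-- The recursion for the coefficients of an inverse series divides by the constant coefficient
only. -/
theorem inv (hF : RatFam θ₀ θₓ θᵢ S F) (h0 : ∀ σ ∈ S, constantCoeff (F σ) ≠ 0) :
    RatFam θ₀ θₓ θᵢ S fun σ => (F σ)⁻¹ := fun α => by
  induction α using WellFoundedLT.induction with
  | ind α ih =>
    have hc : IsRationalOn θ₀ θₓ θᵢ S fun σ => (constantCoeff (F σ))⁻¹ := (hF 0).inv h0
    by_cases hα : α = 0
    · exact hc.congr fun σ _ => by rw [coeff_inv, if_pos hα]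
    · refine (hc.neg.mul (IsRationalOn.sum (antidiagonal α)
        (c := fun p σ => if p.2 < α then coeff p.1 (F σ) * coeff p.2 (F σ)⁻¹ else 0)
        fun p _ => ?_)).congr fun σ _ => by rw [coeff_inv, if_neg hα]
      by_cases hp : p.2 < α
      · simp only [if_pos hp]
        exact (hF p.1).mul (ih p.2 hp)
      · simp only [if_neg hp]
        exact IsRationalOn.const (zero_mem _)

end RatFam

/-- A family of initial data that depends rationally on `σ`, with uniform bounds. -/
structure IsDataFam (θ₀ θₓ θᵢ : ℂ) (S : Set ℂ) (P : ℂ → InitData) : Prop where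
  σ : ∀ σ, (P σ).σ = σ
  k : IsRationalOn θ₀ θₓ θᵢ S fun σ => (P σ).k
  a : IsRationalOn θ₀ θₓ θᵢ S fun σ => (P σ).a
  b : IsRationalOn θ₀ θₓ θᵢ S fun σ => (P σ).b
  c : IsRationalOn θ₀ θₓ θᵢ S fun σ => (P σ).c
  nonres : ∃ c : ℝ≥0, c ≠ 0 ∧ ∀ σ ∈ S, NonResonant c σ
  bound : ∃ K : ℝ≥0, ∀ σ ∈ S, ‖(P σ).k‖ₑ ≤ K ∧ ‖(P σ).a‖ₑ ≤ K ∧ ‖(P σ).b‖ₑ ≤ K ∧ ‖(P σ).c‖ₑ ≤ K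

namespace IsDataFam

variable {θ₀ θₓ θᵢ : ℂ} {S : Set ℂ} {P : ℂ → InitData} {F : ℂ → Ser × Ser × Ser}

/-- The radius depends only on the common bound `K` of the data and the common non-resonance
constant, so one radius serves all of `S`. -/
theorem exists_tBound (h : IsDataFam θ₀ θₓ θᵢ S P) :
    ∃ (K q r B : ℝ≥0), r ≠ 0 ∧ r ≤ 1 ∧ (∀ σ ∈ S, (P σ).BoundedBy K q ∧
      TBound (coneWeight r) B (P σ).sol ∧ ∀ N, TBound (coneWeight r) B ((P σ).iter N)) := by
  obtain ⟨c, hc, hn⟩ := h.nonres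
  obtain ⟨K, hK⟩ := h.bound
  obtain ⟨r, B, hr, hr1, hB⟩ := exists_radius K c⁻¹
  refine ⟨K, c⁻¹, r, B, hr, hr1, fun σ hσ => ?_⟩
  obtain ⟨h1, h2, h3, h4⟩ := hK σ hσ
  have hb : (P σ).BoundedBy K c⁻¹ := by
    refine ⟨h1, h2, h3, h4, ?_, ?_, ?_, ?_⟩ <;> rw [h.σ]
    · exact (hn σ hσ).invBound_zero hc
    · exact (hn σ hσ).invBound_one hc
    · exact (hn σ hσ).invBound_one_add hc
    · exact (hn σ hσ).invBound_one_sub hc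
  exact ⟨hb, hb.sol_tBound hr hB, hb.iter_tBound hr hB⟩

/-- A family of triples of supported series with rational coefficients. -/
structure TRat (θ₀ θₓ θᵢ : ℂ) (S : Set ℂ) (F : ℂ → Ser × Ser × Ser) : Prop where
  supp : ∀ σ ∈ S, InitData.TSupported (F σ)
  fst : RatFam θ₀ θₓ θᵢ S fun σ => (F σ).1
  snd : RatFam θ₀ θₓ θᵢ S fun σ => (F σ).2.1
  trd : RatFam θ₀ θₓ θᵢ S fun σ => (F σ).2.2

theorem ratFam_invDelta_one (h : IsDataFam θ₀ θₓ θᵢ S P) {f : ℂ → Ser}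
    (hf : RatFam θ₀ θₓ θᵢ S f) (hs : ∀ σ ∈ S, Supported (f σ)) :
    RatFam θ₀ θₓ θᵢ S fun σ => invDelta (P σ).σ 1 (f σ) := by
  obtain ⟨c, hc, hn⟩ := h.nonres
  exact (hf.invDelta hs (IsRationalOn.const (one_mem _)) fun α hα => Or.inl fun σ hσ =>
    (hn σ hσ).eig_add_one_ne hc hα).congr fun σ _ => by rw [h.σ]

theorem ratFam_invDelta_one_add (h : IsDataFam θ₀ θₓ θᵢ S P) {f : ℂ → Ser}
    (hf : RatFam θ₀ θₓ θᵢ S f) (hs : ∀ σ ∈ S, Supported (f σ)) :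
    RatFam θ₀ θₓ θᵢ S fun σ => invDelta (P σ).σ (1 + (P σ).σ) (f σ) := by
  obtain ⟨c, hc, hn⟩ := h.nonres
  exact (hf.invDelta hs ((IsRationalOn.const (one_mem _)).add IsRationalOn.id) fun α hα =>
    Or.inl fun σ hσ => (hn σ hσ).eig_add_one_add_ne hc hα).congr fun σ _ => by rw [h.σ]

theorem ratFam_invDelta_one_sub (h : IsDataFam θ₀ θₓ θᵢ S P) {f : ℂ → Ser}
    (hf : RatFam θ₀ θₓ θᵢ S f) (hs : ∀ σ ∈ S, Supported (f σ)) :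
    RatFam θ₀ θₓ θᵢ S fun σ => invDelta (P σ).σ (1 - (P σ).σ) (f σ) := by
  obtain ⟨c, hc, hn⟩ := h.nonres
  exact (hf.invDelta hs ((IsRationalOn.const (one_mem _)).sub IsRationalOn.id) fun α hα =>
    Or.inl fun σ hσ => (hn σ hσ).eig_add_one_sub_ne hc hα).congr fun σ _ => by rw [h.σ]

theorem ratFam_invDelta_zero (h : IsDataFam θ₀ θₓ θᵢ S P) {f : ℂ → Ser}
    (hf : RatFam θ₀ θₓ θᵢ S f) (hs : ∀ σ ∈ S, Supported (f σ)) :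
    RatFam θ₀ θₓ θᵢ S fun σ => invDelta (P σ).σ 0 (f σ) := by
  obtain ⟨c, hc, hn⟩ := h.nonres
  refine (hf.invDelta hs (IsRationalOn.const (zero_mem _)) fun α hα => ?_).congr
    fun σ _ => by rw [h.σ]
  by_cases h0 : α = 0
  · exact Or.inr fun σ _ => by simp [h0, eig]
  · exact Or.inl fun σ hσ => by simpa using (hn σ hσ).eig_ne hc hα h0

theorem C_k (h : IsDataFam θ₀ θₓ θᵢ S P) : RatFam θ₀ θₓ θᵢ S fun σ => C (P σ).k := RatFam.C h.k

theorem C_one_add_k (h : IsDataFam θ₀ θₓ θᵢ S P) : RatFam θ₀ θₓ θᵢ S fun σ => C (1 + (P σ).k) :=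
  RatFam.C ((IsRationalOn.const (one_mem _)).add h.k)

theorem C_one_sub_k (h : IsDataFam θ₀ θₓ θᵢ S P) : RatFam θ₀ θₓ θᵢ S fun σ => C (1 - (P σ).k) :=
  RatFam.C ((IsRationalOn.const (one_mem _)).sub h.k)

theorem half_mem : (1 / 2 : ℂ) ∈ QTheta θ₀ θₓ θᵢ := by
  simpa using (QTheta θ₀ θₓ θᵢ).algebraMap_mem (1 / 2 : ℚ)

theorem C_half : RatFam θ₀ θₓ θᵢ S fun _ => C (1 / 2) := RatFam.C (IsRationalOn.const half_mem)

theorem C_two : RatFam θ₀ θₓ θᵢ S fun _ => C 2 :=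
  RatFam.C ((IsRationalOn.natCast 2).congr fun σ _ => by simp)

theorem ratFam_pertB (h : IsDataFam θ₀ θₓ θᵢ S P) (hF : TRat θ₀ θₓ θᵢ S F) :
    RatFam θ₀ θₓ θᵢ S fun σ => (P σ).pertB (F σ) :=
  ((h.C_k.mul .serX).mul (h.ratFam_invDelta_one_add hF.snd fun σ hσ => (hF.supp σ hσ).2.1)).sub
    ((h.C_one_add_k.mul (.X 1)).mul (h.ratFam_invDelta_one hF.fst fun σ hσ => (hF.supp σ hσ).1))

theorem ratFam_pertNu (h : IsDataFam θ₀ θₓ θᵢ S P) (hF : TRat θ₀ θₓ θᵢ S F) :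
    RatFam θ₀ θₓ θᵢ S fun σ => (P σ).pertNu (F σ) :=
  ((h.C_one_sub_k.mul .serX).mul (h.ratFam_invDelta_one hF.fst fun σ hσ => (hF.supp σ hσ).1)).sub
    ((h.C_k.mul (.X 1)).mul (h.ratFam_invDelta_one_sub hF.trd fun σ hσ => (hF.supp σ hσ).2.2))

theorem ratFam_pertC (h : IsDataFam θ₀ θₓ θᵢ S P) (hF : TRat θ₀ θₓ θᵢ S F) :
    RatFam θ₀ θₓ θᵢ S fun σ => (P σ).pertC (F σ) :=
  ((RatFam.X 0).mul (h.ratFam_pertNu hF)).congr fun σ _ => (P σ).pertC_eq_mul_pertNu _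

theorem ratFam_pertA (h : IsDataFam θ₀ θₓ θᵢ S P) (hF : TRat θ₀ θₓ θᵢ S F) :
    RatFam θ₀ θₓ θᵢ S fun σ => (P σ).pertA (F σ) :=
  C_half.mul (((h.C_one_add_k.mul (.X 1)).mul
    (h.ratFam_invDelta_one_sub hF.trd fun σ hσ => (hF.supp σ hσ).2.2)).sub
    ((h.C_one_sub_k.mul .serS).mul
      (h.ratFam_invDelta_one_add hF.snd fun σ hσ => (hF.supp σ hσ).2.1)))

theorem tRat_step (h : IsDataFam θ₀ θₓ θᵢ S P) (hF : TRat θ₀ θₓ θᵢ S F)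
    (hs : ∀ σ ∈ S, InitData.TSupported ((P σ).step (F σ))) :
    TRat θ₀ θₓ θᵢ S fun σ => (P σ).step (F σ) := by
  have hA := h.ratFam_pertA hF
  have hB := h.ratFam_pertB hF
  have hC := h.ratFam_pertC hF
  refine ⟨hs, ?_, ?_, ?_⟩
  · refine (RatFam.C h.a).add (h.ratFam_invDelta_zero ?_ fun σ hσ =>
      InitData.supported_rhsA (hF.supp σ hσ))
    exact ((hB.mul hF.trd).sub (hC.mul hF.snd)).add (C_half.mul
      (((h.C_one_add_k.mul (.X 1)).mul hF.trd).sub ((h.C_one_sub_k.mul .serS).mul hF.snd)))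
  · refine (RatFam.C h.b).add (h.ratFam_invDelta_zero ?_ fun σ hσ =>
      InitData.supported_rhsB (hF.supp σ hσ))
    exact ((C_two.mul ((hA.mul hF.snd).sub (hB.mul hF.fst))).add
      ((h.C_k.mul .serX).mul hF.snd)).sub ((h.C_one_add_k.mul (.X 1)).mul hF.fst)
  · refine (RatFam.C h.c).add (h.ratFam_invDelta_zero ?_ fun σ hσ =>
      InitData.supported_rhsC (hF.supp σ hσ))
    exact ((C_two.mul ((hC.mul hF.fst).sub (hA.mul hF.trd))).add
      ((h.C_one_sub_k.mul .serS).mul hF.fst)).sub ((h.C_k.mul .serX).mul hF.trd)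

theorem tSupported_of_tBound {r B : ℝ≥0} {F : Ser × Ser × Ser} (h : TBound (coneWeight r) B F) :
    InitData.TSupported F :=
  ⟨.of_wnorm (ne_top_of_le_ne_top ENNReal.coe_ne_top h.1),
    .of_wnorm (ne_top_of_le_ne_top ENNReal.coe_ne_top h.2.1),
    .of_wnorm (ne_top_of_le_ne_top ENNReal.coe_ne_top h.2.2)⟩

theorem tRat_iter (h : IsDataFam θ₀ θₓ θᵢ S P) (N : ℕ) :
    TRat θ₀ θₓ θᵢ S fun σ => (P σ).iter N := by
  obtain ⟨K, q, r, B, -, -, hb⟩ := h.exists_tBound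
  induction N with
  | zero =>
    have hz : RatFam θ₀ θₓ θᵢ S fun _ => (0 : Ser) := RatFam.of_const fun α => by
      rw [map_zero]; exact zero_mem _
    exact ⟨fun σ hσ => tSupported_of_tBound ((hb σ hσ).2.2 0), hz, hz, hz⟩
  | succ N ih =>
    simp only [InitData.iter_succ]
    refine h.tRat_step ih fun σ hσ => ?_
    rw [← InitData.iter_succ]
    exact tSupported_of_tBound ((hb σ hσ).2.2 (N + 1))

/-- Each coefficient of the solution is a coefficient of one iterate, obtained by finitely many
rational operations. -/
theorem tRat_sol (h : IsDataFam θ₀ θₓ θᵢ S P) : TRat θ₀ θₓ θᵢ S fun σ => (P σ).sol := by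
  obtain ⟨K, q, r, B, -, -, hb⟩ := h.exists_tBound
  exact ⟨fun σ hσ => tSupported_of_tBound (hb σ hσ).2.1, fun α => (h.tRat_iter (α 1 + 1)).fst α,
    fun α => (h.tRat_iter (α 1 + 1)).snd α, fun α => (h.tRat_iter (α 1 + 1)).trd α⟩

end IsDataFam

end PainleveFive

/-! ### Norms for small ξ and t, and inversion of power series. -/

namespace PainleveFive

open MvPowerSeries Finset
open scoped ENNReal NNReal

/-- The weight `r ^ (j + n)` on the monomials `ξ ^ j t ^ n`. -/
noncomputable def polyWeight (r : ℝ≥0) (α : Idx) : ℝ≥0∞ := (r : ℝ≥0∞) ^ (α 0 + α 1)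

theorem isWeight_polyWeight (r : ℝ≥0) : IsWeight (polyWeight r) := fun α β => by
  simp only [polyWeight, Finsupp.add_apply, ← pow_add]
  rw [show α 0 + β 0 + (α 1 + β 1) = α 0 + α 1 + (β 0 + β 1) by ring]

theorem polyWeight_le_coneWeight {r : ℝ≥0} (hr : r ≤ 1) (α : Idx) :
    polyWeight r α ≤ coneWeight r α := by
  unfold polyWeight coneWeight
  split_ifs
  · exact pow_le_pow_right_of_le_one' (by exact_mod_cast hr) (by omega)
  · exact le_top

theorem wnorm_polyWeight_C (r : ℝ≥0) (z : ℂ) : wnorm (polyWeight r) (C z) = ‖z‖ₑ := by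
  rw [wnorm_C]; simp [polyWeight]

theorem wnorm_polyWeight_X (r : ℝ≥0) (i : Fin 2) : wnorm (polyWeight r) (X i) = r := by
  rw [wnorm_X]; fin_cases i <;> simp [polyWeight]

theorem polyWeight_mono {r r' : ℝ≥0} (h : r' ≤ r) (α : Idx) : polyWeight r' α ≤ polyWeight r α := by
  unfold polyWeight; gcongr

/-- Shrinking the radius gains a factor `r'/r` on every monomial of positive degree. -/
theorem wnorm_polyWeight_le_of_constantCoeff_eq_zero {r r' : ℝ≥0} (hr : r ≠ 0) (h : r' ≤ r)
    {f : Ser} (hf : constantCoeff f = 0) :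
    wnorm (polyWeight r') f ≤ ((r' / r : ℝ≥0) : ℝ≥0∞) * wnorm (polyWeight r) f := by
  unfold wnorm
  rw [← ENNReal.tsum_mul_left]
  refine ENNReal.tsum_le_tsum fun α => ?_
  by_cases hα : α = 0
  · simp [hα, hf]
  · have h1 : 1 ≤ α 0 + α 1 := by
      by_contra h1
      exact hα (eq_zero_of_cone (by omega) (by omega))
    rw [mul_left_comm]
    gcongr
    unfold polyWeight
    obtain ⟨m, hm⟩ := Nat.exists_eq_add_of_le h1
    rw [hm]
    norm_cast
    calc r' ^ (1 + m) = r' * r' ^ m := by ring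
      _ ≤ r' * r ^ m := by gcongr
      _ = r' / r * r ^ (1 + m) := by field_simp; ring

/-- A weight, cut off at total degree `N`. -/
noncomputable def truncWeight (N : ℕ) (w : Idx → ℝ≥0∞) (α : Idx) : ℝ≥0∞ :=
  if α 0 + α 1 ≤ N then w α else 0

theorem IsWeight.trunc {w : Idx → ℝ≥0∞} (hw : IsWeight w) (N : ℕ) :
    IsWeight (truncWeight N w) := fun α β => by
  unfold truncWeight
  split_ifs with h h1 h2 h2
  · exact hw α β
  all_goals simp at *
  all_goals omega

theorem wnorm_le_of_trunc {w : Idx → ℝ≥0∞} {f : Ser} {B : ℝ≥0∞}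
    (h : ∀ N, wnorm (truncWeight N w) f ≤ B) : wnorm w f ≤ B := by
  unfold wnorm
  rw [ENNReal.tsum_eq_iSup_sum]
  refine iSup_le fun s => ?_
  refine le_trans ?_ (h (s.sup fun α => α 0 + α 1))
  refine le_trans (le_of_eq ?_) (ENNReal.sum_le_tsum s)
  refine sum_congr rfl fun α hα => ?_
  rw [truncWeight, if_pos (le_sup (f := fun α : Idx => α 0 + α 1) hα)]

theorem wnorm_trunc_ne_top {w : Idx → ℝ≥0∞} (hw : ∀ α, w α ≠ ∞) (N : ℕ) (f : Ser) :
    wnorm (truncWeight N w) f ≠ ∞ := by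
  have hfin : {α : Idx | α 0 + α 1 ≤ N}.Finite := by
    refine (Set.finite_Iic (Finsupp.single 0 N + Finsupp.single 1 N : Idx)).subset fun α hα => ?_
    intro i
    simp only [Set.mem_ofPred_eq] at hα
    fin_cases i
    · simp; omega
    · simp; omega
  unfold wnorm
  rw [tsum_eq_sum (s := hfin.toFinset) fun α hα => ?_]
  · refine ENNReal.sum_ne_top.2 fun α _ => ENNReal.mul_ne_top enorm_ne_top ?_
    unfold truncWeight
    split_ifs
    exacts [hw α, ENNReal.zero_ne_top]
  · rw [Set.Finite.mem_toFinset, Set.mem_ofPred_eq] at hα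
    rw [truncWeight, if_neg hα, mul_zero]

theorem wnorm_sub_C_constantCoeff_le (w : Idx → ℝ≥0∞) (f : Ser) :
    wnorm w (f - C (constantCoeff f)) ≤ wnorm w f := by
  refine ENNReal.tsum_le_tsum fun α => ?_
  gcongr
  by_cases hα : α = 0
  · simp [hα]
  · rw [map_sub, coeff_C_of_ne_zero hα, sub_zero]

/-- With `d` the constant coefficient, `f⁻¹ = d⁻¹ - d⁻¹ (f - d) f⁻¹` gives `T ≤ K + T/2` for the
norm `T` of `f⁻¹`, hence `T ≤ 2K`. As `T` is not known to be finite, the argument runs with weights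
cut off in degree, whose norms are finite and still submultiplicative. -/
theorem wnorm_inv_le {f : Ser} {r r' B K : ℝ≥0} (hr : r ≠ 0) (h : r' ≤ r)
    (hf : wnorm (polyWeight r) f ≤ B) (h0 : constantCoeff f ≠ 0)
    (hK : ‖(constantCoeff f)⁻¹‖ₑ ≤ K) (hr' : K * (r' / r * B) ≤ 1 / 2) :
    wnorm (polyWeight r') f⁻¹ ≤ ((2 * K : ℝ≥0) : ℝ≥0∞) := by
  set d := constantCoeff f
  have h1 : f⁻¹ = C d⁻¹ - C d⁻¹ * ((f - C d) * f⁻¹) := by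
    have e1 : f * f⁻¹ = 1 := MvPowerSeries.mul_inv_cancel f h0
    have e2 : C d⁻¹ * C d = (1 : Ser) := by rw [← map_mul, inv_mul_cancel₀ h0, map_one]
    linear_combination C d⁻¹ * e1 - f⁻¹ * e2
  have h2 : wnorm (polyWeight r) (f - C d) ≤ B := (wnorm_sub_C_constantCoeff_le _ f).trans hf
  have h3 : wnorm (polyWeight r') (f - C d) ≤ ((r' / r * B : ℝ≥0) : ℝ≥0∞) := by
    refine (wnorm_polyWeight_le_of_constantCoeff_eq_zero hr h (by simp [d])).trans ?_
    rw [ENNReal.coe_mul]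
    gcongr
  refine wnorm_le_of_trunc fun N => ?_
  have hw := (isWeight_polyWeight r').trunc N
  have hle : ∀ α, truncWeight N (polyWeight r') α ≤ polyWeight r' α := fun α => by
    unfold truncWeight; split_ifs <;> simp
  have hfin := wnorm_trunc_ne_top (w := polyWeight r') (fun α => by simp [polyWeight]) N f⁻¹
  obtain ⟨T, hT⟩ : ∃ T : ℝ≥0, (T : ℝ≥0∞) = wnorm (truncWeight N (polyWeight r')) f⁻¹ :=
    ⟨_, ENNReal.coe_toNNReal hfin⟩
  have h4 : wnorm (truncWeight N (polyWeight r')) f⁻¹ ≤ K + K * ((r' / r * B : ℝ≥0) * T) := by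
    conv_lhs => rw [h1]
    refine wnorm_sub_le_of_le ?_ ?_
    · refine (wnorm_mono hle _).trans ?_
      rw [wnorm_polyWeight_C]; exact hK
    · exact wnorm_C_mul_le_of_le hK (wnorm_mul_le_of_le hw ((wnorm_mono hle _).trans h3) hT.ge)
  rw [← hT] at h4 ⊢
  norm_cast at h4 ⊢
  rw [← NNReal.coe_le_coe] at h4 hr' ⊢
  push_cast at *
  have hT0 : (0 : ℝ) ≤ T := T.2
  nlinarith [mul_le_mul_of_nonneg_right hr' hT0]

/-- The family `F` of series is uniformly bounded on `S`. -/
def UBound (w : Idx → ℝ≥0∞) (S : Set ℂ) (F : ℂ → Ser) : Prop :=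
  ∃ B : ℝ≥0, ∀ σ ∈ S, wnorm w (F σ) ≤ B

/-- The function `c` is bounded on `S`. -/
def CBound (S : Set ℂ) (c : ℂ → ℂ) : Prop := ∃ B : ℝ≥0, ∀ σ ∈ S, ‖c σ‖ₑ ≤ B

namespace UBound

variable {w : Idx → ℝ≥0∞} {S : Set ℂ} {F G : ℂ → Ser} {r : ℝ≥0}

theorem add (hF : UBound w S F) (hG : UBound w S G) : UBound w S fun σ => F σ + G σ := by
  obtain ⟨A, hA⟩ := hF
  obtain ⟨B, hB⟩ := hG
  exact ⟨A + B, fun σ hσ => by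
    rw [ENNReal.coe_add]; exact wnorm_add_le_of_le (hA σ hσ) (hB σ hσ)⟩

theorem sub (hF : UBound w S F) (hG : UBound w S G) : UBound w S fun σ => F σ - G σ := by
  obtain ⟨A, hA⟩ := hF
  obtain ⟨B, hB⟩ := hG
  exact ⟨A + B, fun σ hσ => by
    rw [ENNReal.coe_add]; exact wnorm_sub_le_of_le (hA σ hσ) (hB σ hσ)⟩

theorem mul (hF : UBound (polyWeight r) S F) (hG : UBound (polyWeight r) S G) :
    UBound (polyWeight r) S fun σ => F σ * G σ := by
  obtain ⟨A, hA⟩ := hF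
  obtain ⟨B, hB⟩ := hG
  exact ⟨A * B, fun σ hσ => by
    rw [ENNReal.coe_mul]; exact wnorm_mul_le_of_le (isWeight_polyWeight r) (hA σ hσ) (hB σ hσ)⟩

theorem C {c : ℂ → ℂ} (h : CBound S c) : UBound (polyWeight r) S fun σ => C (c σ) := by
  obtain ⟨B, hB⟩ := h
  exact ⟨B, fun σ hσ => by rw [wnorm_polyWeight_C]; exact hB σ hσ⟩

theorem const (z : ℂ) : UBound (polyWeight r) S fun _ => MvPowerSeries.C z :=
  C ⟨‖z‖₊, fun _ _ => le_rfl⟩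

theorem X (i : Fin 2) : UBound (polyWeight r) S fun _ => X i :=
  ⟨r, fun _ _ => (wnorm_polyWeight_X r i).le⟩

theorem mono {r' : ℝ≥0} (h : r' ≤ r) (hF : UBound (polyWeight r) S F) :
    UBound (polyWeight r') S F := by
  obtain ⟨A, hA⟩ := hF
  exact ⟨A, fun σ hσ => (wnorm_mono (polyWeight_mono h) _).trans (hA σ hσ)⟩

theorem exists_inv (hr : r ≠ 0) (hF : UBound (polyWeight r) S F)
    (h0 : ∀ σ ∈ S, constantCoeff (F σ) ≠ 0) (hc : CBound S fun σ => (constantCoeff (F σ))⁻¹) :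
    ∃ r' : ℝ≥0, r' ≠ 0 ∧ r' ≤ r ∧ UBound (polyWeight r') S fun σ => (F σ)⁻¹ := by
  obtain ⟨B, hB⟩ := hF
  obtain ⟨K, hK⟩ := hc
  -- With `r' = r/A` the smallness condition reads `K B / A ≤ 1/2`; the summand 1 ensures `A ≥ 1`,
  -- hence `r' ≤ r`.
  set A : ℝ≥0 := 2 * (K * B + 1)
  have hA : 1 ≤ A := by
    have : (1 : ℝ≥0) ≤ K * B + 1 := by simp
    calc (1 : ℝ≥0) ≤ K * B + 1 := this
      _ ≤ A := by simp only [A]; rw [two_mul]; exact le_add_self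
  refine ⟨r / A, by positivity, div_le_self (by simp) hA, 2 * K, fun σ hσ =>
    wnorm_inv_le hr (div_le_self (by simp) hA) (hB σ hσ) (h0 σ hσ) (hK σ hσ) ?_⟩
  have e : K * (r / A / r * B) = (K * B) / A := by field_simp
  rw [e, div_le_div_iff₀ (by positivity) (by positivity)]
  simp only [A]
  calc K * B * 2 ≤ K * B * 2 + 2 := by simp
    _ = _ := by ring

end UBound

end PainleveFive

/-! ### Expansion of the transcendent in ξ and t. -/

namespace PainleveFive

open MvPowerSeries Finset
open scoped ENNReal NNReal

theorem HasEv.enorm_le {ξ t v : ℂ} {f : Ser} {w : Idx → ℝ≥0∞} (hf : HasEv ξ t f v)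
    (h : ∀ α, ‖chr ξ t α‖ₑ ≤ w α) : ‖v‖ₑ ≤ wnorm w f := by
  rw [← hf.tsum]
  refine enorm_tsum_le_tsum_enorm.trans (ENNReal.tsum_le_tsum fun α => ?_)
  rw [enorm_mul]
  gcongr
  exact h α

theorem enorm_chr_le_polyWeight {ξ t : ℂ} {r : ℝ≥0} (hξ : ‖ξ‖ₑ ≤ r) (ht : ‖t‖ₑ ≤ r) (α : Idx) :
    ‖chr ξ t α‖ₑ ≤ polyWeight r α := by
  rw [chr, enorm_mul, enorm_pow, enorm_pow, polyWeight, pow_add]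
  gcongr

namespace InitData

variable (P : InitData)

/-- `ξ` times the upper right entry of `Aₓ`, as a power series in `ξ` and `t`. -/
noncomputable def serG : Ser := P.sol.2.2 + C 2 * (X 0 * P.sol.1) - X 0 * X 0 * P.sol.2.1

/-- `ξ` times the upper left entry of `Aₓ`, as a power series in `ξ` and `t`. -/
noncomputable def serH : Ser :=
  C P.k * (X 0 * P.sol.1)
    + C (1 / 2) * (C (1 + P.k) * P.sol.2.2 + C (1 - P.k) * (X 0 * X 0 * P.sol.2.1))

/-- The upper right entry of `A₀ + Aₓ`, as a power series in `ξ` and `t`. -/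
noncomputable def serM : Ser :=
  C P.σ + C 2 * P.pertA P.sol - X 0 * P.pertB P.sol + P.pertNu P.sol

/-- The denominator of the transcendent, times `ξ ^ 2`. -/
noncomputable def serD (θₓ : ℂ) : Ser :=
  (X 0 * P.serM - P.serG) * (P.serH + C (θₓ / 2) * X 0)

/-- The numerator of the transcendent minus its denominator, times `ξ`. -/
noncomputable def serV (θ₀ θₓ θᵢ : ℂ) : Ser :=
  C ((θ₀ + θₓ - θᵢ) / 2) * P.serG - P.serM * (P.serH + C (θₓ / 2) * X 0)

/-- The expansion of `(y - 1) / ξ`. -/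
noncomputable def serZ (θ₀ θₓ θᵢ : ℂ) : Ser := P.serV θ₀ θₓ θᵢ * (P.serD θₓ)⁻¹

/-- The expansion of the transcendent in powers of `ξ` and `t`. -/
noncomputable def serY (θ₀ θₓ θᵢ : ℂ) : Ser := C 1 + X 0 * P.serZ θ₀ θₓ θᵢ

/-- At `ξ = t = 0` only `c` survives in the entries of `Aₓ` multiplied by `ξ`. So `D` is invertible
exactly when `c ≠ 0` and `k ≠ -1`. -/
theorem constantCoeff_serD (θₓ : ℂ) :
    constantCoeff (P.serD θₓ) = -((1 + P.k) * P.c ^ 2 / 2) := by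
  simp [serD, serG, serH, serM, constantCoeff_sol_trd, coeff_zero_pertA, coeff_zero_pertNu]
  ring

theorem constantCoeff_serV (θ₀ θₓ θᵢ : ℂ) : constantCoeff (P.serV θ₀ θₓ θᵢ) =
    P.c * ((θ₀ + θₓ - θᵢ) - P.σ * (1 + P.k)) / 2 := by
  simp [serV, serG, serH, serM, constantCoeff_sol_trd, coeff_zero_pertA, coeff_zero_pertNu]
  ring

theorem constantCoeff_serZ (θ₀ θₓ θᵢ : ℂ) : constantCoeff (P.serZ θ₀ θₓ θᵢ) =
    (P.c * ((θ₀ + θₓ - θᵢ) - P.σ * (1 + P.k)) / 2) * (-((1 + P.k) * P.c ^ 2 / 2))⁻¹ := by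
  rw [serZ, map_mul, constantCoeff_inv, constantCoeff_serD, constantCoeff_serV]

variable {P} {ρ : ℂ} {θ₀ θₓ θᵢ : ℂ} {r : ℝ≥0} {u : ℂ}

/-- In numerator minus denominator of `y` the product `(Aₓ)₁₂ (Aₓ)₁₁` cancels. The difference
therefore needs only one factor `ξ` to become a power series, the denominator two, whence `y - 1 = ξ
V/D`. -/
theorem transcendent_eq (hc : P.ConvergentAt r) (hr : r ≤ 1) {r' : ℝ≥0} (hr' : r' ≤ r)
    (hD : wnorm (polyWeight r') (P.serD θₓ)⁻¹ ≠ ∞) (hD0 : constantCoeff (P.serD θₓ) ≠ 0)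
    (hρ : ρ ≠ 0) (hξ : ‖rhoPow P.σ ρ u‖ₑ ≤ r') (ht : ‖tVar P.σ ρ u‖ₑ ≤ r') :
    ∃ z, HasEv (rhoPow P.σ ρ u) (tVar P.σ ρ u) (P.serZ θ₀ θₓ θᵢ) z ∧
      P.transcendent ρ θ₀ θₓ θᵢ u = 1 + rhoPow P.σ ρ u * z := by
  have hchr := fun α => (enorm_chr_le_polyWeight hξ ht α)
  have hchr' := fun α => (hchr α).trans
    ((polyWeight_mono hr' α).trans (polyWeight_le_coneWeight hr α))
  have ea := HasEv.of_wnorm hc.a hchr'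
  have eb := HasEv.of_wnorm hc.b hchr'
  have ec := HasEv.of_wnorm hc.c hchr'
  have eA := HasEv.of_wnorm hc.pertA hchr'
  have eB := HasEv.of_wnorm hc.pertB hchr'
  have eN := HasEv.of_wnorm hc.pertNu hchr'
  have eI := HasEv.of_wnorm hD hchr
  change HasEv _ _ _ (evalAt P.σ ρ _ u) at ea eb ec eA eB eN eI
  have eX : HasEv (rhoPow P.σ ρ u) (tVar P.σ ρ u) (X 0) _ := HasEv.X0
  have eG : HasEv (rhoPow P.σ ρ u) (tVar P.σ ρ u) P.serG _ :=
    (ec.add ((HasEv.const 2).mul (eX.mul ea))).sub ((eX.mul eX).mul eb)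
  have eH : HasEv (rhoPow P.σ ρ u) (tVar P.σ ρ u) P.serH _ :=
    ((HasEv.const P.k).mul (eX.mul ea)).add ((HasEv.const (1 / 2)).mul
      (((HasEv.const (1 + P.k)).mul ec).add ((HasEv.const (1 - P.k)).mul ((eX.mul eX).mul eb))))
  have eM : HasEv (rhoPow P.σ ρ u) (tVar P.σ ρ u) P.serM _ :=
    (((HasEv.const P.σ).add ((HasEv.const 2).mul eA)).sub (eX.mul eB)).add eN
  have eHθ := eH.add ((HasEv.const (θₓ / 2)).mul eX)
  have eD : HasEv (rhoPow P.σ ρ u) (tVar P.σ ρ u) (P.serD θₓ) _ := ((eX.mul eM).sub eG).mul eHθ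
  have eV : HasEv (rhoPow P.σ ρ u) (tVar P.σ ρ u) (P.serV θ₀ θₓ θᵢ) _ :=
    ((HasEv.const ((θ₀ + θₓ - θᵢ) / 2)).mul eG).sub (eM.mul eHθ)
  -- The inverse series converges at this point too, so the value of `D` is nonzero there.
  have h1 := (eD.mul eI).of_eq HasEv.one (MvPowerSeries.mul_inv_cancel _ hD0)
  refine ⟨_, eV.mul eI, ?_⟩
  have hx := rhoPow_ne_zero hρ P.σ u
  have hD1 := left_ne_zero_of_mul_eq_one h1
  have h12 : rhoPow P.σ ρ u * P.entryX12 ρ u = evalAt P.σ ρ P.sol.2.2 u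
      + 2 * (rhoPow P.σ ρ u * evalAt P.σ ρ P.sol.1 u)
      - rhoPow P.σ ρ u * rhoPow P.σ ρ u * evalAt P.σ ρ P.sol.2.1 u := by
    rw [entryX12]; field_simp; ring
  have h11 : rhoPow P.σ ρ u * P.entryX11 ρ u = P.k * (rhoPow P.σ ρ u * evalAt P.σ ρ P.sol.1 u)
      + 1 / 2 * ((1 + P.k) * evalAt P.σ ρ P.sol.2.2 u
        + (1 - P.k) * (rhoPow P.σ ρ u * rhoPow P.σ ρ u * evalAt P.σ ρ P.sol.2.1 u)) := by
    rw [entryX11]; field_simp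
  have hM : P.entryM12 ρ u = P.σ + 2 * evalAt P.σ ρ (P.pertA P.sol) u
      - rhoPow P.σ ρ u * evalAt P.σ ρ (P.pertB P.sol) u + evalAt P.σ ρ (P.pertNu P.sol) u := rfl
  rw [← h12, ← h11, ← hM] at h1 hD1
  rw [← h12, ← h11, ← hM]
  generalize evalAt P.σ ρ (P.serD θₓ)⁻¹ u = I at *
  generalize rhoPow P.σ ρ u = ξ at *
  rw [transcendent]
  have hden : ξ * ξ * ((P.entryM12 ρ u - P.entryX12 ρ u) * (P.entryX11 ρ u + θₓ / 2)) ≠ 0 := by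
    convert hD1 using 1; ring
  rw [div_eq_iff (right_ne_zero_of_mul hden)]
  refine mul_left_cancel₀ (mul_ne_zero hx hx) ?_
  linear_combination (-ξ * ((θ₀ + θₓ - θᵢ) / 2 * (ξ * P.entryX12 ρ u)
    - P.entryM12 ρ u * (ξ * P.entryX11 ρ u + θₓ / 2 * ξ))) * h1

end InitData

namespace IsDataFam

variable {θ₀ θₓ θᵢ : ℂ} {S : Set ℂ} {P : ℂ → InitData}

theorem exists_convergentAt (h : IsDataFam θ₀ θₓ θᵢ S P) :
    ∃ r : ℝ≥0, r ≠ 0 ∧ r ≤ 1 ∧ (∀ σ ∈ S, (P σ).ConvergentAt r ∧ (P σ).Regular) ∧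
      (UBound (polyWeight r) S fun σ => (P σ).sol.1) ∧
      (UBound (polyWeight r) S fun σ => (P σ).sol.2.1) ∧
      (UBound (polyWeight r) S fun σ => (P σ).sol.2.2) ∧
      (UBound (polyWeight r) S fun σ => (P σ).pertA (P σ).sol) ∧
      (UBound (polyWeight r) S fun σ => (P σ).pertB (P σ).sol) ∧
      (UBound (polyWeight r) S fun σ => (P σ).pertNu (P σ).sol) := by
  obtain ⟨K, q, r, B, hr, hr1, hb⟩ := h.exists_tBound
  obtain ⟨c, hc, hn⟩ := h.nonres
  have hle : ∀ f, wnorm (polyWeight r) f ≤ wnorm (coneWeight r) f :=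
    wnorm_mono (polyWeight_le_coneWeight hr1)
  have hfin : ∀ {f : Ser} {A : ℝ≥0}, wnorm (coneWeight r) f ≤ A → wnorm (coneWeight r) f ≠ ∞ :=
    fun hf => ne_top_of_le_ne_top ENNReal.coe_ne_top hf
  refine ⟨r, hr, hr1, fun σ hσ => ?_, ⟨B, fun σ hσ => (hle _).trans (hb σ hσ).2.1.1⟩,
    ⟨B, fun σ hσ => (hle _).trans (hb σ hσ).2.1.2.1⟩,
    ⟨B, fun σ hσ => (hle _).trans (hb σ hσ).2.1.2.2⟩,
    ⟨_, fun σ hσ => (hle _).trans ((hb σ hσ).1.wnorm_pertA_le hr (hb σ hσ).2.1)⟩,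
    ⟨_, fun σ hσ => (hle _).trans ((hb σ hσ).1.wnorm_pertB_le hr (hb σ hσ).2.1)⟩,
    ⟨_, fun σ hσ => (hle _).trans ((hb σ hσ).1.wnorm_pertNu_le hr (hb σ hσ).2.1)⟩⟩
  obtain ⟨h1, h2, -⟩ := hb σ hσ
  exact ⟨⟨hfin h2.1, hfin h2.2.1, hfin h2.2.2, hfin (h1.wnorm_pertA_le hr h2),
    hfin (h1.wnorm_pertB_le hr h2), hfin (h1.wnorm_pertNu_le hr h2)⟩,
    tSupported_of_tBound h2, c, hc, by rw [h.σ]; exact hn σ hσ⟩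

theorem ratFam_serY (h : IsDataFam θ₀ θₓ θᵢ S P)
    (h0 : ∀ σ ∈ S, constantCoeff ((P σ).serD θₓ) ≠ 0) :
    RatFam θ₀ θₓ θᵢ S fun σ => (P σ).serY θ₀ θₓ θᵢ := by
  have hs := h.tRat_sol
  have hX : RatFam θ₀ θₓ θᵢ S fun _ => X 0 := RatFam.X 0
  have m0 : θ₀ ∈ QTheta θ₀ θₓ θᵢ := Algebra.subset_adjoin (by simp)
  have mx : θₓ ∈ QTheta θ₀ θₓ θᵢ := Algebra.subset_adjoin (by simp)
  have mi : θᵢ ∈ QTheta θ₀ θₓ θᵢ := Algebra.subset_adjoin (by simp)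
  have mh : ∀ z ∈ QTheta θ₀ θₓ θᵢ, z / 2 ∈ QTheta θ₀ θₓ θᵢ := fun z hz => by
    rw [div_eq_mul_one_div]; exact mul_mem hz half_mem
  have hG : RatFam θ₀ θₓ θᵢ S fun σ => (P σ).serG :=
    (hs.trd.add (C_two.mul (hX.mul hs.fst))).sub ((hX.mul hX).mul hs.snd)
  have hH : RatFam θ₀ θₓ θᵢ S fun σ => (P σ).serH :=
    (h.C_k.mul (hX.mul hs.fst)).add (C_half.mul ((h.C_one_add_k.mul hs.trd).add
      (h.C_one_sub_k.mul ((hX.mul hX).mul hs.snd))))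
  have hσ : RatFam θ₀ θₓ θᵢ S fun σ => C (P σ).σ :=
    (RatFam.C IsRationalOn.id).congr fun σ _ => by rw [h.σ]
  have hM : RatFam θ₀ θₓ θᵢ S fun σ => (P σ).serM :=
    ((hσ.add (C_two.mul (h.ratFam_pertA hs))).sub (hX.mul (h.ratFam_pertB hs))).add
      (h.ratFam_pertNu hs)
  have hHθ := hH.add ((RatFam.C (IsRationalOn.const (mh _ mx))).mul hX)
  have hD : RatFam θ₀ θₓ θᵢ S fun σ => (P σ).serD θₓ := ((hX.mul hM).sub hG).mul hHθ
  have hV : RatFam θ₀ θₓ θᵢ S fun σ => (P σ).serV θ₀ θₓ θᵢ :=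
    ((RatFam.C (IsRationalOn.const (mh _ (sub_mem (add_mem m0 mx) mi)))).mul hG).sub (hM.mul hHθ)
  exact (RatFam.C (IsRationalOn.const (one_mem _))).add (hX.mul (hV.mul (hD.inv h0)))

theorem exists_uBound_serZ (h : IsDataFam θ₀ θₓ θᵢ S P) (hS : CBound S fun σ => σ)
    (h0 : ∀ σ ∈ S, constantCoeff ((P σ).serD θₓ) ≠ 0)
    (hc : CBound S fun σ => (constantCoeff ((P σ).serD θₓ))⁻¹) :
    ∃ r r' : ℝ≥0, r ≤ 1 ∧ r' ≠ 0 ∧ r' ≤ r ∧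
      (∀ σ ∈ S, (P σ).ConvergentAt r ∧ (P σ).Regular) ∧
      (∀ σ ∈ S, wnorm (polyWeight r') ((P σ).serD θₓ)⁻¹ ≠ ∞) ∧
      UBound (polyWeight r') S fun σ => (P σ).serZ θ₀ θₓ θᵢ := by
  obtain ⟨r, hr, hr1, hreg, ha, hb, hc', hA, hB, hN⟩ := h.exists_convergentAt
  obtain ⟨K, hK⟩ := h.bound
  have hX : UBound (polyWeight r) S fun _ => X 0 := UBound.X 0
  have hk : UBound (polyWeight r) S fun σ => C (P σ).k := UBound.C ⟨K, fun σ hσ => (hK σ hσ).1⟩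
  have hk1 : UBound (polyWeight r) S fun σ => C (1 + (P σ).k) := by
    simpa only [map_add] using (UBound.const 1).add hk
  have hk2 : UBound (polyWeight r) S fun σ => C (1 - (P σ).k) := by
    simpa only [map_sub] using (UBound.const 1).sub hk
  have hG : UBound (polyWeight r) S fun σ => (P σ).serG :=
    (hc'.add ((UBound.const 2).mul (hX.mul ha))).sub ((hX.mul hX).mul hb)
  have hH : UBound (polyWeight r) S fun σ => (P σ).serH :=
    (hk.mul (hX.mul ha)).add ((UBound.const _).mul ((hk1.mul hc').add
      (hk2.mul ((hX.mul hX).mul hb))))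
  have hσ : UBound (polyWeight r) S fun σ => C (P σ).σ := by
    simp only [h.σ]
    exact UBound.C hS
  have hM : UBound (polyWeight r) S fun σ => (P σ).serM :=
    ((hσ.add ((UBound.const 2).mul hA)).sub (hX.mul hB)).add hN
  have hHθ := hH.add ((UBound.const (θₓ / 2)).mul hX)
  have hD : UBound (polyWeight r) S fun σ => (P σ).serD θₓ := ((hX.mul hM).sub hG).mul hHθ
  have hV : UBound (polyWeight r) S fun σ => (P σ).serV θ₀ θₓ θᵢ :=
    ((UBound.const _).mul hG).sub (hM.mul hHθ)
  obtain ⟨r', hr0, hr', hI⟩ := hD.exists_inv hr h0 hc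
  refine ⟨r, r', hr1, hr0, hr', hreg, fun σ hσ => ?_, (hV.mono hr').mul hI⟩
  obtain ⟨B, hB⟩ := hI
  exact ne_top_of_le_ne_top ENNReal.coe_ne_top (hB σ hσ)

end IsDataFam

end PainleveFive

/-! ### Joint holomorphy in (σ, ρ, x). -/

namespace PainleveFive

open MvPowerSeries Finset
open scoped ENNReal NNReal

/-- The Weierstrass theorem for series of holomorphic functions on an open subset of a complex
normed space. -/
theorem differentiableOn_tsum_of_summable {E ι : Type*} [NormedAddCommGroup E] [NormedSpace ℂ E]
    {f : ι → E → ℂ} {U : Set E} {b : ι → ℝ} (hU : IsOpen U) (hb : Summable b)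
    (hf : ∀ i, DifferentiableOn ℂ (f i) U) (hle : ∀ i, ∀ x ∈ U, ‖f i x‖ ≤ b i) :
    DifferentiableOn ℂ (fun x => ∑' i, f i x) U := by
  intro x₀ hx₀
  obtain ⟨R, hR, hball⟩ : ∃ R > 0, Metric.ball x₀ (2 * R) ⊆ U := by
    obtain ⟨R, hR, h⟩ := Metric.isOpen_iff.1 hU x₀ hx₀
    exact ⟨R / 2, by positivity, by convert h using 2; ring⟩
  have hsub : Metric.ball x₀ R ⊆ U := (Metric.ball_subset_ball (by linarith)).trans hball
  have hderiv : ∀ i, ∀ x ∈ Metric.ball x₀ R, HasFDerivAt (f i) (fderiv ℂ (f i) x) x :=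
    fun i x hx => ((hf i).differentiableAt (hU.mem_nhds (hsub hx))).hasFDerivAt
  -- Cauchy's estimate on the complex line `z ↦ x + z • v`: the disc of radius `R / ‖v‖` is mapped
  -- into the ball of radius `2 * R` about `x₀`, hence into `U`.
  have hbound : ∀ i, ∀ x ∈ Metric.ball x₀ R, ‖fderiv ℂ (f i) x‖ ≤ b i / R := fun i x hx => by
    have hbi : 0 ≤ b i := (norm_nonneg _).trans (hle i x (hsub hx))
    refine ContinuousLinearMap.opNorm_le_bound _ (by positivity) fun v => ?_
    rcases eq_or_ne v 0 with rfl | hv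
    · simp
    have hv' : 0 < ‖v‖ := norm_pos_iff.2 hv
    have hmem : ∀ z ∈ Metric.closedBall (0 : ℂ) (R / ‖v‖), x + z • v ∈ U := fun z hz => by
      apply hball
      rw [mem_closedBall_zero_iff, le_div_iff₀ hv'] at hz
      rw [Metric.mem_ball, dist_eq_norm] at hx ⊢
      calc ‖x + z • v - x₀‖ = ‖(x - x₀) + z • v‖ := by congr 1; abel
        _ ≤ ‖x - x₀‖ + ‖z‖ * ‖v‖ := (norm_add_le _ _).trans (by rw [norm_smul])
        _ < 2 * R := by linarith
    have hline : ∀ z : ℂ, HasFDerivAt (fun z : ℂ => x + z • v)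
        (ContinuousLinearMap.toSpanSingleton ℂ v) z := fun z =>
      ((ContinuousLinearMap.toSpanSingleton ℂ v).hasFDerivAt).const_add x
    have hd : DifferentiableOn ℂ (fun z : ℂ => f i (x + z • v))
        (Metric.closedBall (0 : ℂ) (R / ‖v‖)) := fun z hz =>
      (((hf i).differentiableAt (hU.mem_nhds (hmem z hz))).comp z
        (hline z).differentiableAt).differentiableWithinAt
    have h0 : HasFDerivAt (f i) (fderiv ℂ (f i) x) (x + (0 : ℂ) • v) := by
      simpa using hderiv i x hx
    have h1 : deriv (fun z : ℂ => f i (x + z • v)) 0 = fderiv ℂ (f i) x v := by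
      have := (h0.comp (0 : ℂ) (hline 0)).hasDerivAt.deriv
      simpa [Function.comp_def] using this
    rw [← h1]
    refine (Complex.norm_deriv_le_of_forall_mem_sphere_norm_le (div_pos hR hv')
      (hd.diffContOnCl_ball subset_rfl) fun z hz =>
        hle i _ (hmem z (Metric.sphere_subset_closedBall hz))).trans (le_of_eq ?_)
    field_simp
  have hs : Summable fun i => f i x₀ := (hb.of_norm_bounded fun i => hle i x₀ hx₀)
  exact (hasFDerivAt_tsum_of_isPreconnected (hb.div_const R) Metric.isOpen_ball
    (Metric.isPreconnected_ball) hderiv hbound (Metric.mem_ball_self hR) hs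
    (Metric.mem_ball_self hR)).differentiableAt.differentiableWithinAt

/-- Exponents as pairs. -/
noncomputable def idxEquiv : ℕ × ℕ ≃ Idx :=
  (finTwoArrowEquiv ℕ).symm.trans Finsupp.equivFunOnFinite.symm

theorem idxEquiv_apply_zero (p : ℕ × ℕ) : idxEquiv p 0 = p.1 := rfl

theorem idxEquiv_apply_one (p : ℕ × ℕ) : idxEquiv p 1 = p.2 := rfl

theorem summable_half_pow : Summable fun α : Idx => (1 / 2 : ℝ) ^ (α 0 + α 1) := by
  rw [← idxEquiv.summable_iff]
  have := summable_geometric_two.mul_of_nonneg summable_geometric_two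
    (fun _ => by positivity) (fun _ => by positivity)
  refine this.congr fun p => ?_
  simp [idxEquiv_apply_zero, idxEquiv_apply_one, pow_add]

theorem IsRationalOn.differentiableOn {θ₀ θₓ θᵢ : ℂ} {S : Set ℂ} {c : ℂ → ℂ}
    (hc : IsRationalOn θ₀ θₓ θᵢ S c) : DifferentiableOn ℂ c S := by
  obtain ⟨p, q, h⟩ := hc
  have : DifferentiableOn ℂ (fun σ => Polynomial.aeval σ p / Polynomial.aeval σ q) S :=
    (Polynomial.differentiable_aeval p).differentiableOn.div
      (Polynomial.differentiable_aeval q).differentiableOn fun σ hσ => (h σ hσ).1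
  exact this.congr fun σ hσ => (h σ hσ).2

theorem isOpen_omegaPlusTotal {S : Set ℂ} (hS : IsOpen S) (ε : ℝ) :
    IsOpen (OmegaPlusTotal S ε) := by
  have hV : IsOpen {p : ℂ × ℂ × ℂ | p.1 ∈ S ∧ p.2.1 ≠ 0} :=
    (hS.preimage continuous_fst).inter
      (isOpen_compl_singleton.preimage (continuous_fst.comp continuous_snd))
  have h1 : Continuous fun p : ℂ × ℂ × ℂ => rhoPow p.1 p.2.1 p.2.2 := by
    unfold rhoPow; fun_prop
  have h2 : ContinuousOn (fun p : ℂ × ℂ × ℂ => Complex.exp p.2.2 * (rhoPow p.1 p.2.1 p.2.2)⁻¹)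
      {p : ℂ × ℂ × ℂ | p.1 ∈ S ∧ p.2.1 ≠ 0} := by
    refine ContinuousOn.mul (by fun_prop) (h1.continuousOn.inv₀ fun p hp => rhoPow_ne_zero hp.2 _ _)
  have h3 : ContinuousOn (fun p : ℂ × ℂ × ℂ => (‖rhoPow p.1 p.2.1 p.2.2‖,
      ‖Complex.exp p.2.2 * (rhoPow p.1 p.2.1 p.2.2)⁻¹‖)) {p : ℂ × ℂ × ℂ | p.1 ∈ S ∧ p.2.1 ≠ 0} :=
    h1.norm.continuousOn.prodMk h2.norm
  have h4 := h3.isOpen_inter_preimage hV (isOpen_Iio (a := ε) |>.prod (isOpen_Iio (a := ε)))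
  convert h4 using 1
  ext p
  simp [OmegaPlusTotal, omegaPlus, and_assoc]

theorem UBound.norm_coeff_le {S : Set ℂ} {F : ℂ → Ser} {r : ℝ≥0}
    (hF : UBound (polyWeight r) S F) : ∃ B : ℝ≥0, ∀ σ ∈ S, ∀ α,
      ‖coeff α (F σ)‖ * r ^ (α 0 + α 1) ≤ B := by
  obtain ⟨B, hB⟩ := hF
  refine ⟨B, fun σ hσ α => ?_⟩
  have h1 : ‖coeff α (F σ)‖ₑ * polyWeight r α ≤ B := (ENNReal.le_tsum α).trans (hB σ hσ)
  rw [enorm_eq_nnnorm, polyWeight] at h1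
  norm_cast at h1

/-- A bounded family of power series in `ξ` and `t` with rational coefficients has a sum that is
jointly holomorphic. -/
theorem RatFam.differentiableOn {θ₀ θₓ θᵢ : ℂ} {S : Set ℂ} (hS : IsOpen S) {F : ℂ → Ser}
    (hF : RatFam θ₀ θₓ θᵢ S F) {r : ℝ≥0} (hr : r ≠ 0) (hb : UBound (polyWeight r) S F) {ε : ℝ}
    (hε : ε ≤ r / 2) :
    DifferentiableOn ℂ (fun p : ℂ × ℂ × ℂ => evalAt p.1 p.2.1 (F p.1) p.2.2)
      (OmegaPlusTotal S ε) := by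
  obtain ⟨B, hB⟩ := hb.norm_coeff_le
  have hr0 : (0 : ℝ) < r := by exact_mod_cast pos_iff_ne_zero.2 hr
  refine differentiableOn_tsum_of_summable (isOpen_omegaPlusTotal hS ε)
    (summable_half_pow.mul_left (B : ℝ)) (fun α => ?_) fun α p hp => ?_
  · have h1 : Differentiable ℂ fun p : ℂ × ℂ × ℂ => rhoPow p.1 p.2.1 p.2.2 := by
      unfold rhoPow; fun_prop
    have h2 : DifferentiableOn ℂ (fun p : ℂ × ℂ × ℂ => tVar p.1 p.2.1 p.2.2)
        (OmegaPlusTotal S ε) := by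
      unfold tVar
      exact DifferentiableOn.mul (by fun_prop)
        (h1.differentiableOn.inv fun p hp => rhoPow_ne_zero hp.2.1 _ _)
    have h3 : DifferentiableOn ℂ (fun p : ℂ × ℂ × ℂ => coeff α (F p.1)) (OmegaPlusTotal S ε) :=
      (hF α).differentiableOn.comp differentiableOn_fst fun p hp => hp.1
    exact h3.mul ((h1.differentiableOn.pow _).mul (h2.pow _))
  · obtain ⟨hp1, hp2, hp3, hp4⟩ := hp
    have h1 := hB p.1 hp1 α
    change ‖tVar p.1 p.2.1 p.2.2‖ < ε at hp4
    rw [chr, norm_mul, norm_mul, norm_pow, norm_pow]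
    -- Evaluating at half the radius of the coefficient bound leaves the summable factor
    -- `(1/2)^(j+n)`.
    calc _ ≤ ‖coeff α (F p.1)‖ * ((r / 2) ^ α 0 * (r / 2) ^ α 1) := by
          gcongr <;> linarith
      _ = ‖coeff α (F p.1)‖ * r ^ (α 0 + α 1) * (1 / 2) ^ (α 0 + α 1) := by
          rw [← pow_add, div_eq_mul_one_div, mul_pow]; ring
      _ ≤ _ := by gcongr

end PainleveFive

/-! ### The family of solutions on Ω⁺. -/

namespace PainleveFive

open MvPowerSeries Finset
open scoped ENNReal NNReal

theorem omegaPlus_subset_omegaFull {σ ρ : ℂ} (hρ : ρ ≠ 0) {ε : ℝ} (hε : ε ≤ 1) :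
    omegaPlus σ ρ ε ⊆ omegaFull σ ρ ε := by
  rintro u ⟨h1, h2⟩
  refine ⟨?_, h2⟩
  change ‖tVar σ ρ u‖ < ε at h2
  rw [← rhoPow_mul_tVar hρ σ u, norm_mul, norm_mul]
  have h3 : 0 ≤ ‖rhoPow σ ρ u‖ := norm_nonneg _
  have h4 : 0 ≤ ‖tVar σ ρ u‖ := norm_nonneg _
  calc ‖rhoPow σ ρ u‖ * ‖tVar σ ρ u‖ * ‖rhoPow σ ρ u‖ ≤ 1 * ‖tVar σ ρ u‖ * 1 := by
        gcongr <;> linarith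
    _ < ε := by linarith

theorem isOpen_omegaPlus {σ ρ : ℂ} (hρ : ρ ≠ 0) (ε : ℝ) : IsOpen (omegaPlus σ ρ ε) := by
  have h1 : Continuous (rhoPow σ ρ) := by unfold rhoPow; fun_prop
  have h2 : Continuous fun u => (rhoPow σ ρ u)⁻¹ := h1.inv₀ (rhoPow_ne_zero hρ σ)
  exact (isOpen_lt h1.norm continuous_const).inter
    (isOpen_lt (Complex.continuous_exp.mul h2).norm continuous_const)

theorem IsMeromorphicSolutionOn.mono {θ₀ θₓ θᵢ : ℂ} {f : ℂ → ℂ} {U V : Set ℂ}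
    (h : IsMeromorphicSolutionOn θ₀ θₓ θᵢ f U) (hVU : V ⊆ U) :
    IsMeromorphicSolutionOn θ₀ θₓ θᵢ f V :=
  ⟨fun u hu => h.1 u (hVU hu), fun u hu => h.2 u (hVU hu)⟩

theorem omegaFull_mono {σ ρ : ℂ} {ε ε' : ℝ} (h : ε ≤ ε') : omegaFull σ ρ ε ⊆ omegaFull σ ρ ε' :=
  fun _ hu => ⟨hu.1.trans_le h, hu.2.trans_le h⟩

theorem omegaPlus_mono {σ ρ : ℂ} {ε ε' : ℝ} (h : ε ≤ ε') : omegaPlus σ ρ ε ⊆ omegaPlus σ ρ ε' :=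
  fun _ hu => ⟨hu.1.trans_le h, hu.2.trans_le h⟩

theorem omegaPlusTotal_mono {S : Set ℂ} {ε ε' : ℝ} (h : ε ≤ ε') :
    OmegaPlusTotal S ε ⊆ OmegaPlusTotal S ε' :=
  fun _ hp => ⟨hp.1, hp.2.1, omegaPlus_mono h hp.2.2⟩

/-- Near the origin of the `(ξ, t)`-plane, a sum of `Z` is close to the constant coefficient. -/
theorem HasEv.ne_zero_of_bound {ξ t z : ℂ} {Z : Ser} {r ε B K : ℝ≥0} (hz : HasEv ξ t Z z)
    (hr : r ≠ 0) (hε : ε ≤ r) (hξ : ‖ξ‖ₑ ≤ ε) (ht : ‖t‖ₑ ≤ ε) (hB : wnorm (polyWeight r) Z ≤ B)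
    (hZ : constantCoeff Z ≠ 0) (hK : ‖(constantCoeff Z)⁻¹‖ₑ ≤ K) (hs : ε / r * B * K < 1) :
    z ≠ 0 := by
  rintro rfl
  have h1 := (hz.sub (HasEv.const (constantCoeff Z))).enorm_le (enorm_chr_le_polyWeight hξ ht)
  rw [zero_sub, enorm_neg] at h1
  have h2 : ‖constantCoeff Z‖ₑ ≤ ((ε / r * B : ℝ≥0) : ℝ≥0∞) := by
    refine h1.trans ((wnorm_polyWeight_le_of_constantCoeff_eq_zero hr hε (by simp)).trans ?_)
    rw [ENNReal.coe_mul]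
    gcongr
    exact (wnorm_sub_C_constantCoeff_le _ _).trans hB
  have h3 : ‖constantCoeff Z * (constantCoeff Z)⁻¹‖ₑ ≤ ((ε / r * B * K : ℝ≥0) : ℝ≥0∞) := by
    rw [enorm_mul, ENNReal.coe_mul]
    gcongr
  rw [mul_inv_cancel₀ hZ, enorm_one] at h3
  exact absurd hs (not_lt.2 (by exact_mod_cast h3))

namespace IsDataFam

variable {θ₀ θₓ θᵢ : ℂ} {S : Set ℂ} {P : ℂ → InitData}

/-- The two-parameter family of solutions, its expansion in `Ω⁺`, and joint holomorphy there. -/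
theorem exists_plus (h : IsDataFam θ₀ θₓ θᵢ S P) (hSo : IsOpen S) (hS : CBound S fun σ => σ)
    (hadm : ∀ σ ∈ S, (P σ).Admissible θ₀ θₓ θᵢ)
    (hD0 : ∀ σ ∈ S, constantCoeff ((P σ).serD θₓ) ≠ 0)
    (hDb : CBound S fun σ => (constantCoeff ((P σ).serD θₓ))⁻¹)
    (hZ0 : ∀ σ ∈ S, constantCoeff ((P σ).serZ θ₀ θₓ θᵢ) ≠ 0)
    (hZb : CBound S fun σ => (constantCoeff ((P σ).serZ θ₀ θₓ θᵢ))⁻¹) :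
    ∃ ε : ℝ, 0 < ε ∧ ε ≤ 1 ∧
      (∀ σ ∈ S, ∀ ρ : ℂ, ρ ≠ 0 → IsMeromorphicSolutionOn θ₀ θₓ θᵢ
        ((P σ).transcendent ρ θ₀ θₓ θᵢ) (omegaFull σ ρ ε)) ∧
      (∀ σ ∈ S, ∀ ρ : ℂ, ρ ≠ 0 → ∀ u ∈ omegaPlus σ ρ ε,
        HasEv (rhoPow σ ρ u) (tVar σ ρ u) ((P σ).serY θ₀ θₓ θᵢ)
          ((P σ).transcendent ρ θ₀ θₓ θᵢ u) ∧
        (P σ).transcendent ρ θ₀ θₓ θᵢ u ≠ 0 ∧ (P σ).transcendent ρ θ₀ θₓ θᵢ u ≠ 1) ∧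
      DifferentiableOn ℂ (fun p : ℂ × ℂ × ℂ => (P p.1).transcendent p.2.1 θ₀ θₓ θᵢ p.2.2)
        (OmegaPlusTotal S ε) := by
  obtain ⟨r, r', hr1, hr0, hr', hreg, hI, hZ⟩ := h.exists_uBound_serZ (θ₀ := θ₀) (θₓ := θₓ)
    (θᵢ := θᵢ) hS hD0 hDb
  obtain ⟨B, hB⟩ := id hZ
  obtain ⟨K, hK⟩ := hZb
  -- The choice `ε = r'/A` meets three demands: `ε ≤ r'/2` for joint holomorphy, `ε B K / r' < 1`
  -- for `y ≠ 1`, and `ε B < 1` for `y ≠ 0`.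
  set A : ℝ≥0 := 2 * ((1 + B) * (1 + K))
  have hAB : 2 * (1 + B) ≤ A := by
    simp only [A]
    gcongr
    exact le_mul_of_one_le_right (by simp) (by simp)
  have hA2 : 2 ≤ A := le_trans (by simp) hAB
  have hA0 : A ≠ 0 := (zero_lt_two.trans_le hA2).ne'
  set ε : ℝ≥0 := r' / A
  have hε0 : 0 < ε := by positivity
  have hεr2 : ε ≤ r' / 2 := by simp only [ε]; gcongr
  have hεr : ε ≤ r' := hεr2.trans (half_le_self (by simp))
  have hεr1 : ε ≤ r := hεr.trans hr'
  have hε1 : ε ≤ 1 := hεr1.trans hr1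
  have hsmall : ε / r' * B * K < 1 := by
    have : ε / r' * B * K = B * K / A := by simp only [ε]; field_simp
    rw [this, div_lt_one (by positivity)]
    calc B * K ≤ (1 + B) * (1 + K) := by gcongr <;> simp
      _ < A := by simp only [A]; rw [two_mul]; exact lt_add_of_pos_left _ (by positivity)
  have hεB : ε * B < 1 := by
    calc ε * B ≤ 1 / A * B := by
          simp only [ε]; gcongr; exact hr'.trans hr1
      _ < 1 := by
        rw [one_div_mul_eq_div, div_lt_one (by positivity)]
        calc B ≤ 1 + B := by simp
          _ < 2 * (1 + B) := by rw [two_mul]; exact lt_add_of_pos_left _ (by positivity)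
          _ ≤ A := hAB
  have key : ∀ σ ∈ S, ∀ ρ : ℂ, ρ ≠ 0 → ∀ u ∈ omegaPlus σ ρ ε,
        HasEv (rhoPow σ ρ u) (tVar σ ρ u) ((P σ).serY θ₀ θₓ θᵢ)
          ((P σ).transcendent ρ θ₀ θₓ θᵢ u) ∧
        (P σ).transcendent ρ θ₀ θₓ θᵢ u ≠ 0 ∧ (P σ).transcendent ρ θ₀ θₓ θᵢ u ≠ 1 := by
    intro σ hσ ρ hρ u hu
    have hξ : ‖rhoPow σ ρ u‖ₑ ≤ ε := by
      rw [enorm_eq_nnnorm]; exact_mod_cast (hu.1.le : ‖rhoPow σ ρ u‖ ≤ ε)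
    have ht : ‖tVar σ ρ u‖ₑ ≤ ε := by
      rw [enorm_eq_nnnorm]; exact_mod_cast (hu.2.le : ‖tVar σ ρ u‖ ≤ ε)
    have hle : (ε : ℝ≥0∞) ≤ r' := by exact_mod_cast hεr
    obtain ⟨z, hz, hy⟩ := InitData.transcendent_eq (θ₀ := θ₀) (θᵢ := θᵢ) (hreg σ hσ).1 hr1 hr'
      (hI σ hσ) (hD0 σ hσ) hρ (u := u) (by rw [h.σ]; exact hξ.trans hle)
      (by rw [h.σ]; exact ht.trans hle)
    rw [h.σ] at hz hy
    have hx := rhoPow_ne_zero hρ σ u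
    have hz0 := hz.ne_zero_of_bound hr0 hεr hξ ht (hB σ hσ) (hZ0 σ hσ) (hK σ hσ) hsmall
    have hzB : ‖z‖ₑ ≤ B := (hz.enorm_le fun α => (enorm_chr_le_polyWeight hξ ht α).trans
      (polyWeight_mono hεr α)).trans (hB σ hσ)
    rw [hy]
    refine ⟨(HasEv.const 1).add (HasEv.X0.mul hz), fun h0 => ?_, fun h1 => ?_⟩
    · have h2 : rhoPow σ ρ u * z = -1 := by linear_combination h0
      have h3 : ‖rhoPow σ ρ u * z‖ₑ ≤ ((ε * B : ℝ≥0) : ℝ≥0∞) := by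
        rw [enorm_mul, ENNReal.coe_mul]; gcongr
      rw [h2, enorm_neg, enorm_one] at h3
      exact absurd hεB (not_lt.2 (by exact_mod_cast h3))
    · exact mul_ne_zero hx hz0 (by linear_combination h1)
  refine ⟨ε, by exact_mod_cast hε0, by exact_mod_cast hε1, fun σ hσ ρ hρ => ?_, key, ?_⟩
  · have := (hreg σ hσ).1.isMeromorphicSolutionOn (hreg σ hσ).2 (hadm σ hσ) hρ
    rw [h.σ] at this
    exact this.mono (omegaFull_mono (by exact_mod_cast hεr1))
  · have hY : UBound (polyWeight r') S fun σ => (P σ).serY θ₀ θₓ θᵢ :=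
      (UBound.const 1).add ((UBound.X 0).mul hZ)
    refine ((h.ratFam_serY hD0).differentiableOn hSo hr0 hY (ε := ε)
      (by exact_mod_cast hεr2)).congr fun p hp => ?_
    exact (key p.1 hp.1 p.2.1 hp.2.1 p.2.2 hp.2.2).1.tsum.symm

end IsDataFam

end PainleveFive

/-! ### The symmetry (σ, ρ) ↦ (-σ, ρ⁻¹). -/

namespace PainleveFive

open MvPowerSeries Finset
open scoped ENNReal NNReal

/-- The involution `ξ ^ j t ^ n ↦ ξ ^ (2 n - j) t ^ n` on exponents with `j ≤ 2 n`, which is induced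
by `ξ ↦ ξ⁻¹`, `x ↦ x`. -/
noncomputable def flip (α : Idx) : Idx :=
  if α 0 ≤ 2 * α 1 then idxEquiv (2 * α 1 - α 0, α 1) else α

theorem flip_of_le {α : Idx} (h : α 0 ≤ 2 * α 1) : flip α = idxEquiv (2 * α 1 - α 0, α 1) := if_pos h

theorem flip_of_lt {α : Idx} (h : 2 * α 1 < α 0) : flip α = α := if_neg (by omega)

theorem idx_ext {α β : Idx} (h0 : α 0 = β 0) (h1 : α 1 = β 1) : α = β := by
  ext i; fin_cases i; exacts [h0, h1]

theorem flip_apply_one (α : Idx) : flip α 1 = α 1 := by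
  unfold flip; split_ifs <;> rfl

theorem flip_apply_zero {α : Idx} (h : α 0 ≤ 2 * α 1) : flip α 0 = 2 * α 1 - α 0 := by
  rw [flip_of_le h]; rfl

theorem flip_le {α : Idx} (h : α 0 ≤ 2 * α 1) : flip α 0 ≤ 2 * flip α 1 := by
  rw [flip_apply_zero h, flip_apply_one]; omega

theorem flip_flip (α : Idx) : flip (flip α) = α := by
  by_cases h : α 0 ≤ 2 * α 1
  · refine idx_ext ?_ ?_
    · rw [flip_apply_zero (flip_le h), flip_apply_zero h, flip_apply_one]; omega
    · rw [flip_apply_one, flip_apply_one]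
  · have h1 : flip α = α := flip_of_lt (by omega)
    rw [h1, h1]

theorem flip_add {α β : Idx} (hα : α 0 ≤ 2 * α 1) (hβ : β 0 ≤ 2 * β 1) :
    flip (α + β) = flip α + flip β := by
  have h : (α + β) 0 ≤ 2 * (α + β) 1 := by simp only [Finsupp.add_apply]; omega
  refine idx_ext ?_ ?_
  · rw [flip_apply_zero h]
    simp only [Finsupp.add_apply]
    rw [flip_apply_zero hα, flip_apply_zero hβ]
    omega
  · simp only [flip_apply_one, Finsupp.add_apply]

/-- The substitution `ξ ↦ ξ⁻¹`, `x ↦ x` in a series supported on `j ≤ 2 n`. -/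
noncomputable def swap (f : Ser) : Ser := fun α => coeff (flip α) f

theorem coeff_swap (f : Ser) (α : Idx) : coeff α (swap f) = coeff (flip α) f := rfl

theorem Supported.swap {f : Ser} (hf : Supported f) : Supported (swap f) := fun α hα => by
  rw [coeff_swap, flip_of_lt hα, hf α hα]

/-- On the cone `flip` is additive and involutive, so it matches antidiagonals. Pairs outside the
cone contribute zero by the support conditions, which is why only nonzero terms are put in
bijection. -/
theorem swap_mul {f g : Ser} (hf : Supported f) (hg : Supported g) :
    swap (f * g) = swap f * swap g := by
  ext α
  by_cases hα : α 0 ≤ 2 * α 1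
  · rw [coeff_swap, coeff_mul, coeff_mul]
    have key : ∀ {f g : Ser}, Supported f → Supported g → ∀ p : Idx × Idx,
        coeff p.1 f * coeff p.2 g ≠ 0 → p.1 0 ≤ 2 * p.1 1 ∧ p.2 0 ≤ 2 * p.2 1 :=
      fun hf hg p hp => ⟨hf.le_of_coeff_ne (left_ne_zero_of_mul hp),
        hg.le_of_coeff_ne (right_ne_zero_of_mul hp)⟩
    refine sum_bij_ne_zero (fun p _ _ => (flip p.1, flip p.2)) (fun p hp hp0 => ?_)
      (fun p _ _ p' _ _ h => ?_) (fun p hp hp0 => ?_) (fun p _ _ => ?_)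
    · obtain ⟨h1, h2⟩ := key hf hg p hp0
      rw [HasAntidiagonal.mem_antidiagonal] at hp ⊢
      rw [← flip_add h1 h2, hp, flip_flip]
    · rw [Prod.mk.injEq] at h
      exact Prod.ext (by rw [← flip_flip p.1, h.1, flip_flip])
        (by rw [← flip_flip p.2, h.2, flip_flip])
    · obtain ⟨h1, h2⟩ := key hf.swap hg.swap p hp0
      refine ⟨(flip p.1, flip p.2), ?_, ?_, ?_⟩
      · rw [HasAntidiagonal.mem_antidiagonal] at hp ⊢
        rw [← flip_add h1 h2, hp]
      · exact hp0
      · simp only [flip_flip]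
    · simp only [coeff_swap, flip_flip]
  · rw [(hf.mul hg).swap α (by omega), (hf.swap.mul hg.swap) α (by omega)]

theorem swap_monomial (β : Idx) (z : ℂ) : swap (monomial β z) = monomial (flip β) z := by
  ext α
  rw [coeff_swap, coeff_monomial, coeff_monomial]
  refine if_congr ⟨fun h => ?_, fun h => ?_⟩ rfl rfl
  · rw [← h, flip_flip]
  · rw [h, flip_flip]

/-- The series `f` is supported on `j ≤ 2 n`, and `g` arises from it by `ξ ↦ ξ⁻¹`, `x ↦ x`. -/
def SwapEq (f g : Ser) : Prop := Supported f ∧ swap f = g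

namespace SwapEq

variable {f g f' g' : Ser}

theorem of_supported (hf : Supported f) : SwapEq f (swap f) := ⟨hf, rfl⟩

theorem add (h : SwapEq f g) (h' : SwapEq f' g') : SwapEq (f + f') (g + g') :=
  ⟨h.1.add h'.1, by rw [← h.2, ← h'.2]; rfl⟩

theorem sub (h : SwapEq f g) (h' : SwapEq f' g') : SwapEq (f - f') (g - g') :=
  ⟨h.1.sub h'.1, by rw [← h.2, ← h'.2]; rfl⟩

theorem mul (h : SwapEq f g) (h' : SwapEq f' g') : SwapEq (f * f') (g * g') :=
  ⟨h.1.mul h'.1, by rw [← h.2, ← h'.2, swap_mul h.1 h'.1]⟩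

theorem const (z : ℂ) : SwapEq (C z) (C z) := by
  refine ⟨Supported.const z, ?_⟩
  change swap (monomial 0 z) = monomial 0 z
  rw [swap_monomial, show flip 0 = 0 from idx_ext rfl rfl]

theorem serX : SwapEq serX serX := by
  refine ⟨Supported.serX, ?_⟩
  rw [serX_eq_monomial, swap_monomial]
  congr 2
  refine idx_ext ?_ ?_
  · rw [flip_apply_zero] <;> simp
  · rw [flip_apply_one]

theorem serS : SwapEq serS (X 1) := by
  refine ⟨Supported.serS, ?_⟩
  rw [serS_eq_monomial, X_eq_monomial, swap_monomial]
  congr 2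
  refine idx_ext ?_ ?_
  · rw [flip_apply_zero] <;> simp
  · rw [flip_apply_one]; simp

theorem X1 : SwapEq (X 1) PainleveFive.serS := by
  refine ⟨Supported.X1, ?_⟩
  rw [serS_eq_monomial, X_eq_monomial, swap_monomial]
  congr 2
  refine idx_ext ?_ ?_
  · rw [flip_apply_zero] <;> simp
  · rw [flip_apply_one]; simp

/-- The eigenvalue `n + (j-n)σ` is invariant under `j ↦ 2n - j`, `σ ↦ -σ`. -/
theorem invDelta (h : SwapEq f g) (σ lam : ℂ) :
    SwapEq (invDelta σ lam f) (invDelta (-σ) lam g) := by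
  refine ⟨h.1.invDelta _ _, ?_⟩
  ext α
  rw [coeff_swap, coeff_invDelta, coeff_invDelta, ← h.2, coeff_swap]
  by_cases hα : α 0 ≤ 2 * α 1
  · congr 3
    rw [eig, eig, flip_apply_zero hα, flip_apply_one, Nat.cast_sub hα]
    push_cast
    ring
  · rw [flip_of_lt (by omega), h.1 α (by omega), mul_zero, mul_zero]

end SwapEq

namespace InitData

/-- The initial data for the exponent `-σ`. -/
def symm (P : InitData) : InitData := ⟨-P.σ, -P.k, -P.a, P.c, P.b⟩

/-- The formal solution belonging to the exponent `-σ`. -/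
noncomputable def tswap (F : Ser × Ser × Ser) : Ser × Ser × Ser :=
  (-swap F.1, swap F.2.2, swap F.2.1)

variable {P : InitData} {F : Ser × Ser × Ser}

theorem invDelta_neg (σ lam : ℂ) (f : Ser) : invDelta σ lam (-f) = -invDelta σ lam f := by
  ext α; simp [coeff_invDelta]

theorem swapEq_pertA (hF : TSupported F) :
    SwapEq (P.pertA F) (-P.symm.pertA (tswap F)) := by
  obtain ⟨hs1, hs2, hs3⟩ := hF
  have h := (SwapEq.const (1 / 2)).mul ((((SwapEq.const (1 + P.k)).mul .X1).mul
    ((SwapEq.of_supported hs3).invDelta P.σ (1 - P.σ))).sub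
    (((SwapEq.const (1 - P.k)).mul .serS).mul ((SwapEq.of_supported hs2).invDelta P.σ (1 + P.σ))))
  refine ⟨h.1, h.2.trans ?_⟩
  simp only [pertA, symm, tswap, sub_neg_eq_add, ← sub_eq_add_neg]
  ring

theorem swapEq_pertC (hF : TSupported F) :
    SwapEq (P.pertC F) (P.symm.pertB (tswap F)) := by
  obtain ⟨hs1, hs2, hs3⟩ := hF
  have h := (((SwapEq.const (1 - P.k)).mul .serS).mul
    ((SwapEq.of_supported hs1).invDelta P.σ 1)).sub
    (((SwapEq.const P.k).mul .serX).mul ((SwapEq.of_supported hs3).invDelta P.σ (1 - P.σ)))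
  refine ⟨h.1, h.2.trans ?_⟩
  simp only [pertB, symm, tswap, ← sub_eq_add_neg, invDelta_neg, map_neg]
  ring

theorem swapEq_pertB (hF : TSupported F) :
    SwapEq (P.pertB F) (P.symm.pertC (tswap F)) := by
  obtain ⟨hs1, hs2, hs3⟩ := hF
  have h := (((SwapEq.const P.k).mul .serX).mul
    ((SwapEq.of_supported hs2).invDelta P.σ (1 + P.σ))).sub
    (((SwapEq.const (1 + P.k)).mul .X1).mul ((SwapEq.of_supported hs1).invDelta P.σ 1))
  refine ⟨h.1, h.2.trans ?_⟩
  simp only [pertC, symm, tswap, sub_neg_eq_add, invDelta_neg, map_neg]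
  ring

theorem swapEq_X0_mul_pertB (hF : TSupported F) :
    SwapEq (X 0 * P.pertB F) (P.symm.pertNu (tswap F)) := by
  obtain ⟨hs1, hs2, hs3⟩ := hF
  have h := (((SwapEq.const P.k).mul .serS).mul
    ((SwapEq.of_supported hs2).invDelta P.σ (1 + P.σ))).sub
    (((SwapEq.const (1 + P.k)).mul .serX).mul ((SwapEq.of_supported hs1).invDelta P.σ 1))
  have e : C P.k * serS * invDelta P.σ (1 + P.σ) F.2.1
      - C (1 + P.k) * serX * invDelta P.σ 1 F.1 = X 0 * P.pertB F := by
    simp only [pertB, serS, serX]; ring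
  rw [e] at h
  refine ⟨h.1, h.2.trans ?_⟩
  simp only [pertNu, symm, tswap, sub_neg_eq_add, invDelta_neg, map_neg]
  ring

/-- Conjugation by the permutation of the two eigenvectors negates `σ`, `k` and the diagonal
entries, and exchanges `b` with `c` and `t` with `x ξ`. The Schlesinger system is equivariant under
it. -/
theorem step_tswap (hF : TSupported F) : P.symm.step (tswap F) = tswap (P.step F) := by
  have hA := swapEq_pertA (P := P) hF
  have hB := swapEq_pertB (P := P) hF
  have hC := swapEq_pertC (P := P) hF
  obtain ⟨hs1, hs2, hs3⟩ := hF
  have h1 := SwapEq.of_supported hs1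
  have h2 := SwapEq.of_supported hs2
  have h3 := SwapEq.of_supported hs3
  have e1 := (SwapEq.const P.a).add ((((hB.mul h3).sub (hC.mul h2)).add
    ((SwapEq.const (1 / 2)).mul ((((SwapEq.const (1 + P.k)).mul .X1).mul h3).sub
      (((SwapEq.const (1 - P.k)).mul .serS).mul h2)))).invDelta P.σ 0)
  have e2 := (SwapEq.const P.b).add (((((SwapEq.const 2).mul ((hA.mul h2).sub (hB.mul h1))).add
    (((SwapEq.const P.k).mul .serX).mul h2)).sub
    (((SwapEq.const (1 + P.k)).mul .X1).mul h1)).invDelta P.σ 0)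
  have e3 := (SwapEq.const P.c).add (((((SwapEq.const 2).mul ((hC.mul h1).sub (hA.mul h3))).add
    (((SwapEq.const (1 - P.k)).mul .serS).mul h1)).sub
    (((SwapEq.const P.k).mul .serX).mul h3)).invDelta P.σ 0)
  refine Prod.ext ?_ (Prod.ext ?_ ?_)
  · refine Eq.trans ?_ (congrArg Neg.neg e1.2.symm)
    rw [neg_add, ← invDelta_neg, ← map_neg]
    change C (-P.a) + invDelta (-P.σ) 0 (P.symm.rhsA (tswap F)) = _
    congr 2
    simp only [rhsA, symm, tswap, sub_neg_eq_add, ← sub_eq_add_neg]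
    ring
  · refine Eq.trans ?_ e3.2.symm
    change C P.c + invDelta (-P.σ) 0 (P.symm.rhsB (tswap F)) = _
    congr 2
    simp only [rhsB, symm, tswap, ← sub_eq_add_neg, map_neg]
    ring
  · refine Eq.trans ?_ e2.2.symm
    change C P.b + invDelta (-P.σ) 0 (P.symm.rhsC (tswap F)) = _
    congr 2
    simp only [rhsC, symm, tswap, sub_neg_eq_add, map_neg]
    ring

theorem tswap_sol (hF : TSupported P.sol) : P.symm.sol = tswap P.sol :=
  (P.symm.eq_sol_of_step_eq (by rw [step_tswap hF, P.step_sol])).symm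

end InitData

theorem rhoPow_neg_inv (σ ρ u : ℂ) : rhoPow (-σ) ρ⁻¹ u = (rhoPow σ ρ u)⁻¹ := by
  rw [rhoPow, rhoPow, mul_inv, ← Complex.exp_neg, neg_mul]

/-- Both sides equal `x^n ξ^(j-n)`: the substitution sends `ξ` to `ξ⁻¹` and `t` to `x ξ`. -/
theorem chr_flip {σ ρ u : ℂ} (hρ : ρ ≠ 0) {α : Idx} (hα : α 0 ≤ 2 * α 1) :
    chr (rhoPow (-σ) ρ⁻¹ u) (tVar (-σ) ρ⁻¹ u) (flip α) = chr (rhoPow σ ρ u) (tVar σ ρ u) α := by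
  have hx := rhoPow_ne_zero hρ σ u
  rw [chr, chr, flip_apply_zero hα, flip_apply_one, tVar, tVar, rhoPow_neg_inv, inv_inv,
    mul_pow, mul_pow]
  obtain ⟨m, hm⟩ := Nat.exists_eq_add_of_le hα
  rw [hm, Nat.add_sub_cancel_left]
  have e : rhoPow σ ρ u ^ α 1 * rhoPow σ ρ u ^ α 1 = rhoPow σ ρ u ^ α 0 * rhoPow σ ρ u ^ m := by
    rw [← pow_add, ← pow_add, ← hm]; ring
  simp only [inv_pow]
  field_simp
  linear_combination e

theorem evalAt_swap {σ ρ : ℂ} (hρ : ρ ≠ 0) {f : Ser} (hf : Supported f) (u : ℂ) :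
    evalAt (-σ) ρ⁻¹ (swap f) u = evalAt σ ρ f u := by
  unfold evalAt
  rw [← (Function.Involutive.toPerm flip flip_flip).tsum_eq]
  refine tsum_congr fun α => ?_
  change coeff (flip (flip α)) f * _ = _
  rw [flip_flip]
  by_cases hα : α 0 ≤ 2 * α 1
  · congr 1
    exact chr_flip hρ hα
  · rw [hf α (by omega), zero_mul, zero_mul]

theorem SwapEq.evalAt {σ ρ : ℂ} (hρ : ρ ≠ 0) {f g : Ser} (h : SwapEq f g) (u : ℂ) :
    evalAt (-σ) ρ⁻¹ g u = evalAt σ ρ f u := h.2 ▸ evalAt_swap hρ h.1 u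

theorem evalAt_neg (σ ρ : ℂ) (f : Ser) (u : ℂ) : evalAt σ ρ (-f) u = -evalAt σ ρ f u := by
  simp [evalAt, tsum_neg]

/-- The solutions for `σ` and `-σ` agree. -/
theorem InitData.ConvergentAt.transcendent_symm {P : InitData} {r : ℝ≥0} (hc : P.ConvergentAt r)
    (h : P.Regular) {ρ u : ℂ} (hρ : ρ ≠ 0) (hu : u ∈ omegaFull P.σ ρ r) (θ₀ θₓ θᵢ : ℂ) :
    P.symm.transcendent ρ⁻¹ θ₀ θₓ θᵢ u = P.transcendent ρ θ₀ θₓ θᵢ u := by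
  have hs := h.supp
  have hsol := InitData.tswap_sol hs
  have hx := rhoPow_ne_zero hρ P.σ u
  have e1 := (SwapEq.of_supported hs.1).evalAt (σ := P.σ) hρ u
  have e2 := (SwapEq.of_supported hs.2.1).evalAt (σ := P.σ) hρ u
  have e3 := (SwapEq.of_supported hs.2.2).evalAt (σ := P.σ) hρ u
  have eA := (InitData.swapEq_pertA (P := P) hs).evalAt (σ := P.σ) hρ u
  have eC := (InitData.swapEq_pertC (P := P) hs).evalAt (σ := P.σ) hρ u
  have eN := (InitData.swapEq_X0_mul_pertB (P := P) hs).evalAt (σ := P.σ) hρ u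
  have hB : evalAt P.σ ρ (X 0 * P.pertB P.sol) u = rhoPow P.σ ρ u * evalAt P.σ ρ (P.pertB P.sol) u :=
    (HasEv.X0.mul (hasEv_evalAt hρ hc.pertB hu)).tsum
  have hN : evalAt P.σ ρ (P.pertC P.sol) u = rhoPow P.σ ρ u * evalAt P.σ ρ (P.pertNu P.sol) u := by
    rw [InitData.pertC_eq_mul_pertNu]
    exact (HasEv.X0.mul (hasEv_evalAt hρ hc.pertNu hu)).tsum
  rw [evalAt_neg] at eA
  -- In the original basis the exchange negates the upper right entries of `Aₓ` and `A₀ + Aₓ` and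
  -- fixes the upper left entry of `Aₓ`; the two signs cancel in `y`.
  have h12 : P.symm.entryX12 ρ⁻¹ u = -P.entryX12 ρ u := by
    rw [InitData.entryX12, InitData.entryX12, hsol]
    simp only [InitData.tswap, InitData.symm, evalAt_neg, rhoPow_neg_inv, inv_inv, e1, e2, e3]
    ring
  have h11 : P.symm.entryX11 ρ⁻¹ u = P.entryX11 ρ u := by
    rw [InitData.entryX11, InitData.entryX11, hsol]
    simp only [InitData.tswap, InitData.symm, evalAt_neg, rhoPow_neg_inv, inv_inv, e1, e2, e3]
    ring
  have hM : P.symm.entryM12 ρ⁻¹ u = -P.entryM12 ρ u := by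
    rw [InitData.entryM12, InitData.entryM12, hsol]
    change -P.σ + 2 * evalAt (-P.σ) ρ⁻¹ (P.symm.pertA (InitData.tswap P.sol)) u
      - rhoPow (-P.σ) ρ⁻¹ u * evalAt (-P.σ) ρ⁻¹ (P.symm.pertB (InitData.tswap P.sol)) u
      + evalAt (-P.σ) ρ⁻¹ (P.symm.pertNu (InitData.tswap P.sol)) u = _
    rw [eC, eN, hN, hB, rhoPow_neg_inv, ← eA]
    field_simp
    ring
  rw [InitData.transcendent, InitData.transcendent, h12, h11, hM]
  rw [show -P.entryM12 ρ u - -P.entryX12 ρ u = -(P.entryM12 ρ u - P.entryX12 ρ u) by ring,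
    neg_mul, neg_mul, neg_div_neg_eq]

end PainleveFive

/-! ### Explicit initial data and uniformity over the set of exponents. -/

namespace PainleveFive

open MvPowerSeries Finset
open scoped ENNReal NNReal

/-- Since `ξ^j t^n = x^n ξ^(j-n)`, the row `n = 0` is the single series, with its terms `j = 0, 1`
split off, and the rows `n ≥ 1` form the double series. -/
theorem HasEv.isPlusSum {σ ρ u v a : ℂ} (hρ : ρ ≠ 0) {Y : Ser}
    (hY : HasEv (rhoPow σ ρ u) (tVar σ ρ u) Y v) (h0 : coeff (idxEquiv (0, 0)) Y = 1)
    (h1 : coeff (idxEquiv (1, 0)) Y = a) :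
    IsPlusSum σ ρ u a (fun j => coeff (idxEquiv (j, 0)) Y)
      (fun j n => coeff (idxEquiv (j, n)) Y) v := by
  have hx := rhoPow_ne_zero hρ σ u
  have hterm : ∀ p : ℕ × ℕ, Complex.exp u ^ (p.1 + 1) * (coeff (idxEquiv (p.2, p.1 + 1)) Y *
      rhoPow σ ρ u ^ (-((p.1 : ℤ) + 1) + (p.2 : ℤ))) =
      coeff (idxEquiv (p.2, p.1 + 1)) Y * (rhoPow σ ρ u ^ p.2 * tVar σ ρ u ^ (p.1 + 1)) :=
    fun p => by
      rw [← rhoPow_mul_tVar hρ σ u, mul_pow, zpow_add₀ hx, zpow_neg, zpow_natCast]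
      have : rhoPow σ ρ u ^ ((p.1 : ℤ) + 1) = rhoPow σ ρ u ^ (p.1 + 1) := by
        rw [← zpow_natCast]; push_cast; rfl
      rw [this]
      field_simp
  have hs : HasSum (fun p : ℕ × ℕ => coeff (idxEquiv (p.2, p.1)) Y *
      (rhoPow σ ρ u ^ p.2 * tVar σ ρ u ^ p.1)) v :=
    (((Equiv.prodComm ℕ ℕ).trans idxEquiv).hasSum_iff.2 hY.hasSum)
  have hinj : Function.Injective fun p : ℕ × ℕ => (p.1 + 1, p.2) := fun p q h => by
    simp only [Prod.mk.injEq] at h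
    exact Prod.ext (by omega) h.2
  have hs2 := hs.summable.comp_injective hinj
  have hs0 := hs.summable.prod_factor 0
  refine ⟨?_, ?_, ?_⟩
  · simpa using (summable_nat_add_iff 2).2 hs0
  · exact hs2.congr fun p => (hterm p).symm
  · rw [← hs.tsum_eq, hs.summable.tsum_prod, hs.summable.prod.tsum_eq_zero_add,
      ← hs0.sum_add_tsum_nat_add 2, sum_range_succ, sum_range_one, h0, h1]
    congr 1
    · simp
    · refine tsum_congr fun n => ?_
      rw [← tsum_mul_left]
      exact tsum_congr fun j => (hterm (n, j)).symm

theorem IsPlusSum.isMinusSum {σ ρ u v a a' : ℂ} {c : ℕ → ℂ} {d : ℕ → ℕ → ℂ} (ha : a = -a')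
    (h : IsPlusSum (-σ) ρ⁻¹ u a c d v) : IsMinusSum σ ρ u a' c d v := by
  have e1 : ∀ j : ℕ, (rhoPow σ ρ u)⁻¹ ^ (j + 2) = rhoPow σ ρ u ^ (-((j : ℤ) + 2)) := fun j => by
    rw [inv_pow, zpow_neg, ← zpow_natCast]; push_cast; rfl
  have e2 : ∀ n j : ℕ, (rhoPow σ ρ u)⁻¹ ^ (-((n : ℤ) + 1) + (j : ℤ)) =
      rhoPow σ ρ u ^ (((n : ℤ) + 1) - (j : ℤ)) := fun n j => by
    rw [inv_zpow', neg_add_rev, neg_neg]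
    congr 1
    ring
  obtain ⟨h1, h2, h3⟩ := h
  simp only [rhoPow_neg_inv, e1, e2, ha] at h1 h2 h3
  exact ⟨h1, h2, by rw [h3]; ring⟩

/-- The initial data belonging to the exponent `σ` and the parameters of the equation. -/
noncomputable def dataOf (θ₀ θₓ θᵢ σ : ℂ) : InitData where
  σ := σ
  k := -θᵢ / σ
  a := (σ ^ 2 + θₓ ^ 2 - θ₀ ^ 2) / (4 * σ)
  b := (θ₀ ^ 2 - (σ - θₓ) ^ 2) * (σ - θᵢ) / (4 * σ * (σ + θᵢ))
  c := (σ + θᵢ) * ((σ + θₓ) ^ 2 - θ₀ ^ 2) / (4 * σ * (σ - θᵢ))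

/-- The constraints fix only the product `b c`; its splitting is a normalisation of `ρ`. The one
chosen is compatible with `σ ↦ -σ` and produces the stated coefficient of `ρ x^σ`. -/
theorem dataOf_neg (θ₀ θₓ θᵢ σ : ℂ) : dataOf θ₀ θₓ θᵢ (-σ) = (dataOf θ₀ θₓ θᵢ σ).symm := by
  simp only [dataOf, InitData.symm, InitData.mk.injEq, true_and]
  refine ⟨by rw [div_neg], ?_, ?_, ?_⟩
  · rw [mul_neg, div_neg, neg_sq]
  · congr 1 <;> ring
  · congr 1 <;> ring

/-- The sets of exponents considered in the main theorem. -/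
structure IsExponentSet (θ₀ θₓ θᵢ : ℂ) (S : Set ℂ) : Prop where
  isOpen : IsOpen S
  bdd : Bornology.IsBounded S
  exists_le_dist : ∃ δ : ℝ, 0 < δ ∧ ∀ σ ∈ S, ∀ s ∈ sigmaStar, δ ≤ dist σ s
  plus : ∀ σ ∈ closure S, (σ ^ 2 - (θ₀ + θₓ) ^ 2) * (σ ^ 2 - θᵢ ^ 2) ≠ 0
  minus : ∀ σ ∈ closure S, (σ ^ 2 - (θ₀ - θₓ) ^ 2) * (σ ^ 2 - θᵢ ^ 2) ≠ 0

namespace IsExponentSet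

variable {θ₀ θₓ θᵢ : ℂ} {S : Set ℂ}

theorem neg (h : IsExponentSet θ₀ θₓ θᵢ S) : IsExponentSet θ₀ θₓ θᵢ (-S) := by
  have hcl : ∀ σ ∈ closure (-S), -σ ∈ closure S := fun σ hσ =>
    map_mem_closure continuous_neg hσ fun _ h => h
  refine ⟨h.isOpen.neg, h.bdd.neg, ?_, fun σ hσ => ?_, fun σ hσ => ?_⟩
  · obtain ⟨δ, hδ, hd⟩ := h.exists_le_dist
    refine ⟨δ, hδ, fun σ hσ s hs => ?_⟩
    rw [← dist_neg_neg]
    refine hd _ hσ _ ?_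
    obtain ⟨r, hr, rfl⟩ := hs
    refine ⟨-r, ?_, by push_cast; rfl⟩
    rcases hr with hr | hr | hr
    · exact Or.inr (Or.inr (by linarith))
    · exact Or.inr (Or.inl (by linarith))
    · exact Or.inl (by linarith)
  · simpa using h.plus _ (hcl σ hσ)
  · simpa using h.minus _ (hcl σ hσ)

theorem exists_nonResonant (h : IsExponentSet θ₀ θₓ θᵢ S) :
    ∃ c : ℝ≥0, c ≠ 0 ∧ ∀ σ ∈ S, NonResonant c σ := by
  obtain ⟨δ, hδ, hd⟩ := h.exists_le_dist
  have hmin : 0 < min 1 δ := by positivity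
  refine ⟨(min 1 δ).toNNReal, (Real.toNNReal_pos.2 hmin).ne', fun σ hσ N m hN hm => ?_⟩
  rw [Real.toNNReal_le_iff_le_coe]
  change min 1 δ ≤ ‖(N : ℂ) + m * σ‖
  have hN' : (1 : ℝ) ≤ N := by exact_mod_cast hN
  rcases eq_or_ne m 0 with rfl | hm0
  · simpa using Or.inl hN
  · have hm1 : (1 : ℝ) ≤ |(m : ℝ)| := by exact_mod_cast Int.one_le_abs hm0
    have hmN : |(m : ℝ)| ≤ N := by exact_mod_cast hm
    have hm0' : (m : ℝ) ≠ 0 := by exact_mod_cast hm0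
    have hmC : (m : ℂ) ≠ 0 := by exact_mod_cast hm0
    -- Write `N + m σ = m (σ - (-N/m))`. As `1 ≤ |m| ≤ N`, the point `-N/m` lies in `Σ_*`, so the
    -- second factor is at least `δ`.
    have hmem : ((-(N : ℝ) / m : ℝ) : ℂ) ∈ sigmaStar := by
      refine ⟨_, ?_, rfl⟩
      rcases lt_or_gt_of_ne hm0' with hneg | hpos
      · refine Or.inr (Or.inr ?_)
        rw [abs_of_neg hneg] at hmN
        rw [le_div_iff_of_neg hneg]
        linarith
      · refine Or.inl ?_
        rw [abs_of_pos hpos] at hmN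
        rw [div_le_iff₀ hpos]
        linarith
    have h1 := hd σ hσ _ hmem
    rw [dist_eq_norm] at h1
    have e : (N : ℂ) + m * σ = m * (σ - ((-(N : ℝ) / m : ℝ) : ℂ)) := by
      push_cast; field_simp; ring
    rw [e, norm_mul, Complex.norm_intCast]
    calc min 1 δ ≤ δ := min_le_right _ _
      _ ≤ 1 * ‖σ - ((-(N : ℝ) / m : ℝ) : ℂ)‖ := by linarith
      _ ≤ _ := by gcongr

theorem ne_zero (h : IsExponentSet θ₀ θₓ θᵢ S) {σ : ℂ} (hσ : σ ∈ closure S) : σ ≠ 0 := by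
  obtain ⟨δ, hδ, hd⟩ := h.exists_le_dist
  have hcl : closure S ⊆ {σ | δ ≤ dist σ 0} :=
    closure_minimal (fun σ hσ => hd σ hσ 0 ⟨0, Or.inr (Or.inl rfl), by simp⟩)
      (isClosed_le continuous_const (continuous_id.dist continuous_const))
  rintro rfl
  have := hcl hσ
  simp only [Set.mem_ofPred_eq, dist_self] at this
  linarith

theorem nondeg (h : IsExponentSet θ₀ θₓ θᵢ S) {σ : ℂ} (hσ : σ ∈ closure S) :
    σ + θᵢ ≠ 0 ∧ σ - θᵢ ≠ 0 ∧ (σ + θₓ) ^ 2 - θ₀ ^ 2 ≠ 0 ∧ θ₀ + θₓ - σ ≠ 0 := by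
  have h1 := h.plus σ hσ
  have h2 := h.minus σ hσ
  refine ⟨fun h0 => h1 ?_, fun h0 => h1 ?_, fun h0 => ?_, fun h0 => h1 ?_⟩
  · linear_combination (σ ^ 2 - (θ₀ + θₓ) ^ 2) * (σ - θᵢ) * h0
  · linear_combination (σ ^ 2 - (θ₀ + θₓ) ^ 2) * (σ + θᵢ) * h0
  -- Uses `(σ² - (θ₀+θₓ)²)(σ² - (θ₀-θₓ)²) = ((σ+θₓ)² - θ₀²)((σ-θₓ)² - θ₀²)`.
  · refine mul_ne_zero h1 h2 ?_
    linear_combination (σ - θₓ - θ₀) * (σ - θₓ + θ₀) * (σ ^ 2 - θᵢ ^ 2) ^ 2 * h0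
  · linear_combination -(σ + θ₀ + θₓ) * (σ ^ 2 - θᵢ ^ 2) * h0

/-- Uniform bounds on `S` come from compactness of its closure; this is where non-degeneracy on the
closure, rather than on `S`, matters. -/
theorem cBound (h : IsExponentSet θ₀ θₓ θᵢ S) {c : ℂ → ℂ} (hc : ContinuousOn c (closure S)) :
    CBound S c := by
  obtain ⟨B, hB⟩ := h.bdd.isCompact_closure.exists_bound_of_continuousOn hc
  refine ⟨B.toNNReal, fun σ hσ => ?_⟩
  rw [enorm_eq_nnnorm, ENNReal.coe_le_coe]
  exact NNReal.le_toNNReal_of_coe_le (hB σ (subset_closure hσ))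

theorem continuousOn_k (h : IsExponentSet θ₀ θₓ θᵢ S) :
    ContinuousOn (fun σ => (dataOf θ₀ θₓ θᵢ σ).k) (closure S) :=
  ContinuousOn.div (by fun_prop) (by fun_prop) fun σ hσ => h.ne_zero hσ

theorem continuousOn_c (h : IsExponentSet θ₀ θₓ θᵢ S) :
    ContinuousOn (fun σ => (dataOf θ₀ θₓ θᵢ σ).c) (closure S) :=
  ContinuousOn.div (by fun_prop) (by fun_prop) fun σ hσ =>
    mul_ne_zero (mul_ne_zero (by norm_num) (h.ne_zero hσ)) (h.nondeg hσ).2.1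

theorem isDataFam (h : IsExponentSet θ₀ θₓ θᵢ S) :
    IsDataFam θ₀ θₓ θᵢ S (dataOf θ₀ θₓ θᵢ) := by
  have m0 : IsRationalOn θ₀ θₓ θᵢ S fun _ => θ₀ :=
    IsRationalOn.const (Algebra.subset_adjoin (by simp))
  have mx : IsRationalOn θ₀ θₓ θᵢ S fun _ => θₓ :=
    IsRationalOn.const (Algebra.subset_adjoin (by simp))
  have mi : IsRationalOn θ₀ θₓ θᵢ S fun _ => θᵢ :=
    IsRationalOn.const (Algebra.subset_adjoin (by simp))
  have m4 : IsRationalOn θ₀ θₓ θᵢ S fun _ => (4 : ℂ) := by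
    simpa using IsRationalOn.natCast (θ₀ := θ₀) (θₓ := θₓ) (θᵢ := θᵢ) (S := S) 4
  have mσ : IsRationalOn θ₀ θₓ θᵢ S fun σ => σ := IsRationalOn.id
  have sq : ∀ {c : ℂ → ℂ}, IsRationalOn θ₀ θₓ θᵢ S c →
      IsRationalOn θ₀ θₓ θᵢ S fun σ => c σ ^ 2 := fun hc =>
    (hc.mul hc).congr fun _ _ => pow_two _
  have h0 : ∀ σ ∈ S, σ ≠ 0 := fun σ hσ => h.ne_zero (subset_closure hσ)
  have h4 : ∀ σ ∈ closure S, 4 * σ ≠ 0 := fun σ hσ => mul_ne_zero (by norm_num) (h.ne_zero hσ)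
  have hp : ∀ σ ∈ closure S, 4 * σ * (σ + θᵢ) ≠ 0 := fun σ hσ =>
    mul_ne_zero (h4 σ hσ) (h.nondeg hσ).1
  have hm : ∀ σ ∈ closure S, 4 * σ * (σ - θᵢ) ≠ 0 := fun σ hσ =>
    mul_ne_zero (h4 σ hσ) (h.nondeg hσ).2.1
  refine ⟨fun _ => rfl, mi.neg.div mσ h0, ?_, ?_, ?_, h.exists_nonResonant, ?_⟩
  · exact (((sq mσ).add (sq mx)).sub (sq m0)).div (m4.mul mσ) fun σ hσ => h4 σ (subset_closure hσ)
  · exact (((sq m0).sub (sq (mσ.sub mx))).mul (mσ.sub mi)).div ((m4.mul mσ).mul (mσ.add mi))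
      fun σ hσ => hp σ (subset_closure hσ)
  · exact ((mσ.add mi).mul ((sq (mσ.add mx)).sub (sq m0))).div ((m4.mul mσ).mul (mσ.sub mi))
      fun σ hσ => hm σ (subset_closure hσ)
  · obtain ⟨K1, hK1⟩ := h.cBound h.continuousOn_k
    obtain ⟨K2, hK2⟩ := h.cBound (c := fun σ => (dataOf θ₀ θₓ θᵢ σ).a)
      (ContinuousOn.div (by fun_prop) (by fun_prop) h4)
    obtain ⟨K3, hK3⟩ := h.cBound (c := fun σ => (dataOf θ₀ θₓ θᵢ σ).b)
      (ContinuousOn.div (by fun_prop) (by fun_prop) hp)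
    obtain ⟨K4, hK4⟩ := h.cBound h.continuousOn_c
    refine ⟨K1 + K2 + K3 + K4, fun σ hσ => ⟨(hK1 σ hσ).trans ?_, (hK2 σ hσ).trans ?_,
      (hK3 σ hσ).trans ?_, (hK4 σ hσ).trans ?_⟩⟩
    all_goals
      rw [ENNReal.coe_le_coe, ← NNReal.coe_le_coe]
      push_cast
      linarith [K1.2, K2.2, K3.2, K4.2, K1.coe_nonneg, K2.coe_nonneg, K3.coe_nonneg, K4.coe_nonneg]

/-- Subtracting the determinant conditions leaves `σ²/4 - σ a = (θ₀² - θₓ²)/4`, which determines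
`a`; then `b c = θₓ²/4 - a²`. -/
theorem admissible (h : IsExponentSet θ₀ θₓ θᵢ S) {σ : ℂ} (hσ : σ ∈ S) :
    (dataOf θ₀ θₓ θᵢ σ).Admissible θ₀ θₓ θᵢ := by
  have h0 := h.ne_zero (subset_closure hσ)
  obtain ⟨h1, h2, -, -⟩ := h.nondeg (subset_closure hσ)
  refine ⟨?_, ?_, ?_⟩
  · simp only [dataOf]; field_simp
  · simp only [dataOf]; field_simp; ring
  · simp only [dataOf]; field_simp; ring

theorem constantCoeff_serD_eq (h : IsExponentSet θ₀ θₓ θᵢ S) {σ : ℂ} (hσ : σ ∈ closure S) :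
    constantCoeff ((dataOf θ₀ θₓ θᵢ σ).serD θₓ) =
      -((σ + θᵢ) ^ 2 * ((σ + θₓ) ^ 2 - θ₀ ^ 2) ^ 2 / (32 * σ ^ 3 * (σ - θᵢ))) := by
  have h0 := h.ne_zero hσ
  obtain ⟨h1, h2, -, -⟩ := h.nondeg hσ
  rw [InitData.constantCoeff_serD]
  simp only [dataOf]
  field_simp
  ring

/-- The parameter `θ_∞` drops out of the first factor: `θ₀ + θₓ - θ_∞ - σ (1 + k) = θ₀ + θₓ - σ`
because `σ k = -θ_∞`. -/
theorem constantCoeff_serZ_eq (h : IsExponentSet θ₀ θₓ θᵢ S) {σ : ℂ} (hσ : σ ∈ closure S) :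
    constantCoeff ((dataOf θ₀ θₓ θᵢ σ).serZ θ₀ θₓ θᵢ) =
      4 * σ ^ 2 * (θ₀ + θₓ - σ) / ((σ + θᵢ) * (θ₀ ^ 2 - (σ + θₓ) ^ 2)) := by
  have h0 := h.ne_zero hσ
  obtain ⟨h1, h2, h3, -⟩ := h.nondeg hσ
  have h3' : θ₀ ^ 2 - (σ + θₓ) ^ 2 ≠ 0 := fun h' => h3 (by linear_combination -h')
  have h4 : (1 + -θᵢ / σ) = (σ - θᵢ) / σ := by field_simp; ring
  rw [InitData.constantCoeff_serZ]
  simp only [dataOf, h4]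
  rw [show θ₀ ^ 2 - (σ + θₓ) ^ 2 = -((σ + θₓ) ^ 2 - θ₀ ^ 2) by ring]
  field_simp
  ring

theorem exists_plus (h : IsExponentSet θ₀ θₓ θᵢ S) :
    ∃ ε : ℝ, 0 < ε ∧ ε ≤ 1 ∧
      (∀ σ ∈ S, ∀ ρ : ℂ, ρ ≠ 0 → IsMeromorphicSolutionOn θ₀ θₓ θᵢ
        ((dataOf θ₀ θₓ θᵢ σ).transcendent ρ θ₀ θₓ θᵢ) (omegaFull σ ρ ε)) ∧
      (∀ σ ∈ S, ∀ ρ : ℂ, ρ ≠ 0 → ∀ u ∈ omegaPlus σ ρ ε,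
        HasEv (rhoPow σ ρ u) (tVar σ ρ u) ((dataOf θ₀ θₓ θᵢ σ).serY θ₀ θₓ θᵢ)
          ((dataOf θ₀ θₓ θᵢ σ).transcendent ρ θ₀ θₓ θᵢ u) ∧
        (dataOf θ₀ θₓ θᵢ σ).transcendent ρ θ₀ θₓ θᵢ u ≠ 0 ∧
        (dataOf θ₀ θₓ θᵢ σ).transcendent ρ θ₀ θₓ θᵢ u ≠ 1) ∧
      DifferentiableOn ℂ
        (fun p : ℂ × ℂ × ℂ => (dataOf θ₀ θₓ θᵢ p.1).transcendent p.2.1 θ₀ θₓ θᵢ p.2.2)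
        (OmegaPlusTotal S ε) := by
  have hD : ∀ σ ∈ closure S, (σ + θᵢ) ^ 2 * ((σ + θₓ) ^ 2 - θ₀ ^ 2) ^ 2 ≠ 0 := fun σ hσ =>
    mul_ne_zero (pow_ne_zero _ (h.nondeg hσ).1) (pow_ne_zero _ (h.nondeg hσ).2.2.1)
  have hD' : ∀ σ ∈ closure S, 32 * σ ^ 3 * (σ - θᵢ) ≠ 0 := fun σ hσ =>
    mul_ne_zero (mul_ne_zero (by norm_num) (pow_ne_zero _ (h.ne_zero hσ))) (h.nondeg hσ).2.1
  have hD0 : ∀ σ ∈ closure S, constantCoeff ((dataOf θ₀ θₓ θᵢ σ).serD θₓ) ≠ 0 := fun σ hσ => by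
    rw [h.constantCoeff_serD_eq hσ]
    exact neg_ne_zero.2 (div_ne_zero (hD σ hσ) (hD' σ hσ))
  have hDc : ContinuousOn (fun σ => constantCoeff ((dataOf θ₀ θₓ θᵢ σ).serD θₓ)) (closure S) := by
    refine ContinuousOn.congr ?_ fun σ hσ => h.constantCoeff_serD_eq hσ
    exact (ContinuousOn.div (by fun_prop) (by fun_prop) hD').neg
  have hZ : ∀ σ ∈ closure S, 4 * σ ^ 2 * (θ₀ + θₓ - σ) ≠ 0 := fun σ hσ =>
    mul_ne_zero (mul_ne_zero (by norm_num) (pow_ne_zero _ (h.ne_zero hσ))) (h.nondeg hσ).2.2.2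
  have hZ' : ∀ σ ∈ closure S, (σ + θᵢ) * (θ₀ ^ 2 - (σ + θₓ) ^ 2) ≠ 0 := fun σ hσ =>
    mul_ne_zero (h.nondeg hσ).1 fun h' => (h.nondeg hσ).2.2.1 (by linear_combination -h')
  have hZ0 : ∀ σ ∈ closure S, constantCoeff ((dataOf θ₀ θₓ θᵢ σ).serZ θ₀ θₓ θᵢ) ≠ 0 :=
    fun σ hσ => by
      rw [h.constantCoeff_serZ_eq hσ]
      exact div_ne_zero (hZ σ hσ) (hZ' σ hσ)
  have hZc : ContinuousOn (fun σ => constantCoeff ((dataOf θ₀ θₓ θᵢ σ).serZ θ₀ θₓ θᵢ))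
      (closure S) := by
    refine ContinuousOn.congr ?_ fun σ hσ => h.constantCoeff_serZ_eq hσ
    exact ContinuousOn.div (by fun_prop) (by fun_prop) hZ'
  exact h.isDataFam.exists_plus h.isOpen (h.cBound continuousOn_id) (fun σ hσ => h.admissible hσ)
    (fun σ hσ => hD0 σ (subset_closure hσ)) (h.cBound (hDc.inv₀ hD0))
    (fun σ hσ => hZ0 σ (subset_closure hσ)) (h.cBound (hZc.inv₀ hZ0))

theorem ratFam_serY (h : IsExponentSet θ₀ θₓ θᵢ S) :
    RatFam θ₀ θₓ θᵢ S fun σ => (dataOf θ₀ θₓ θᵢ σ).serY θ₀ θₓ θᵢ :=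
  h.isDataFam.ratFam_serY fun σ hσ => by
    have hσ' := subset_closure hσ
    rw [h.constantCoeff_serD_eq hσ']
    exact neg_ne_zero.2 (div_ne_zero (mul_ne_zero (pow_ne_zero _ (h.nondeg hσ').1)
      (pow_ne_zero _ (h.nondeg hσ').2.2.1)) (mul_ne_zero (mul_ne_zero (by norm_num)
      (pow_ne_zero _ (h.ne_zero hσ'))) (h.nondeg hσ').2.1))

end IsExponentSet

theorem InitData.coeff_serY_zero (P : InitData) (θ₀ θₓ θᵢ : ℂ) :
    coeff (idxEquiv (0, 0)) (P.serY θ₀ θₓ θᵢ) = 1 := by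
  rw [show idxEquiv (0, 0) = 0 from idx_ext rfl rfl, coeff_zero_eq_constantCoeff_apply]
  simp [serY]

theorem InitData.coeff_serY_one (P : InitData) (θ₀ θₓ θᵢ : ℂ) :
    coeff (idxEquiv (1, 0)) (P.serY θ₀ θₓ θᵢ) = constantCoeff (P.serZ θ₀ θₓ θᵢ) := by
  have e : idxEquiv (1, 0) = Finsupp.single 0 1 + 0 := by
    refine idx_ext ?_ ?_
    · simp [idxEquiv_apply_zero]
    · simp [idxEquiv_apply_one]
  have e' : (Finsupp.single 0 1 + 0 : Idx) ≠ 0 := by simp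
  rw [e, serY, map_add, coeff_C_of_ne_zero e', zero_add, X_eq_monomial, coeff_add_monomial_mul,
    one_mul, coeff_zero_eq_constantCoeff_apply]

theorem omegaMinus_eq (σ ρ : ℂ) (ε : ℝ) : omegaMinus σ ρ ε = omegaPlus (-σ) ρ⁻¹ ε := by
  ext u
  simp only [omegaMinus, omegaPlus, rhoPow_neg_inv, inv_inv, Set.mem_ofPred_eq]
  exact and_comm

theorem omegaFull_neg_inv (σ ρ : ℂ) (ε : ℝ) : omegaFull (-σ) ρ⁻¹ ε = omegaFull σ ρ ε := by
  ext u
  simp only [omegaFull, rhoPow_neg_inv, inv_inv, Set.mem_ofPred_eq]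
  exact and_comm

end PainleveFive

/-! ### Transfer of holomorphy between Ω⁺ and Ω⁻. -/

namespace PainleveFive

open MvPowerSeries Finset
open scoped ENNReal NNReal

theorem omegaMinusTotal_eq (S : Set ℂ) (ε : ℝ) : OmegaMinusTotal S ε =
    {p | p.2.1 ≠ 0 ∧ (-p.1, p.2.1⁻¹, p.2.2) ∈ OmegaPlusTotal (-S) ε} := by
  ext p
  simp only [OmegaMinusTotal, OmegaPlusTotal, omegaMinus_eq, Set.mem_ofPred_eq, Set.mem_neg, neg_neg,
    ne_eq, _root_.inv_eq_zero]
  tauto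

theorem differentiableAt_neg_inv {p : ℂ × ℂ × ℂ} (hp : p.2.1 ≠ 0) :
    DifferentiableAt ℂ (fun p : ℂ × ℂ × ℂ => (-p.1, p.2.1⁻¹, p.2.2)) p :=
  DifferentiableAt.prodMk (by fun_prop) (DifferentiableAt.prodMk
    (DifferentiableAt.inv (by fun_prop) hp) (by fun_prop))

theorem isOpen_omegaMinusTotal {S : Set ℂ} (hS : IsOpen S) (ε : ℝ) :
    IsOpen (OmegaMinusTotal S ε) := by
  rw [omegaMinusTotal_eq]
  have hV : IsOpen {p : ℂ × ℂ × ℂ | p.2.1 ≠ 0} :=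
    isOpen_compl_singleton.preimage (continuous_fst.comp continuous_snd)
  exact ContinuousOn.isOpen_inter_preimage
    (f := fun p : ℂ × ℂ × ℂ => (-p.1, p.2.1⁻¹, p.2.2))
    (fun p hp => (differentiableAt_neg_inv hp).continuousAt.continuousWithinAt) hV
    (isOpen_omegaPlusTotal hS.neg ε)

/-- Holomorphy in `x` of a jointly holomorphic family. -/
theorem analyticAt_of_omegaPlusTotal {S : Set ℂ} (hS : IsOpen S) {ε : ℝ} {y : ℂ → ℂ → ℂ → ℂ}
    (hy : DifferentiableOn ℂ (fun p : ℂ × ℂ × ℂ => y p.1 p.2.1 p.2.2) (OmegaPlusTotal S ε))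
    {σ ρ u : ℂ} (hσ : σ ∈ S) (hρ : ρ ≠ 0) (hu : u ∈ omegaPlus σ ρ ε) :
    AnalyticAt ℂ (y σ ρ) u := by
  refine DifferentiableOn.analyticAt (s := omegaPlus σ ρ ε) (fun w hw => ?_)
    ((isOpen_omegaPlus hρ ε).mem_nhds hu)
  have h1 : DifferentiableAt ℂ (fun p : ℂ × ℂ × ℂ => y p.1 p.2.1 p.2.2) (σ, ρ, w) :=
    hy.differentiableAt ((isOpen_omegaPlusTotal hS ε).mem_nhds ⟨hσ, hρ, hw⟩)
  have h2 : DifferentiableAt ℂ (fun w : ℂ => (σ, ρ, w)) w := by fun_prop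
  exact (h1.comp w h2).differentiableWithinAt

end PainleveFive

/-! ### The main theorem, combining the expansions for σ and -σ. -/

theorem mainTheorem1 (θ₀ θₓ θᵢ : ℂ) (S : Set ℂ)
    (hSopen : IsOpen S) (hSconn : IsConnected S) (hSbdd : Bornology.IsBounded S)
    (hSsub : S ⊆ PainleveFive.sigmaStarᶜ)
    (hSdist : ∃ δ : ℝ, 0 < δ ∧ ∀ σ ∈ S, ∀ s ∈ PainleveFive.sigmaStar, δ ≤ dist σ s)
    (hSplus : ∀ σ ∈ closure S, (σ ^ 2 - (θ₀ + θₓ) ^ 2) * (σ ^ 2 - θᵢ ^ 2) ≠ 0)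
    (hSminus : ∀ σ ∈ closure S, (σ ^ 2 - (θ₀ - θₓ) ^ 2) * (σ ^ 2 - θᵢ ^ 2) ≠ 0) :
    ∃ (ε₀ : ℝ) (y : ℂ → ℂ → ℂ → ℂ)
      (cp cm : ℕ → ℂ → ℂ) (dp dm : ℕ → ℕ → ℂ → ℂ),
      0 < ε₀ ∧
      -- solutions of the equation
      (∀ σ ∈ S, ∀ ρ : ℂ, ρ ≠ 0 →
        PainleveFive.IsMeromorphicSolutionOn θ₀ θₓ θᵢ (y σ ρ)
          (PainleveFive.omegaFull σ ρ ε₀) ∧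
        ∀ u ∈ PainleveFive.omegaPlus σ ρ ε₀ ∪ PainleveFive.omegaMinus σ ρ ε₀,
          PainleveFive.SolvesAt θ₀ θₓ θᵢ (y σ ρ) u) ∧
      -- joint holomorphy
      DifferentiableOn ℂ (fun p : ℂ × ℂ × ℂ => y p.1 p.2.1 p.2.2)
        (PainleveFive.OmegaPlusTotal S ε₀ ∪ PainleveFive.OmegaMinusTotal S ε₀) ∧
      -- the coefficients
      (∀ j : ℕ, 2 ≤ j → PainleveFive.IsRationalOn θ₀ θₓ θᵢ S (cp j) ∧
        PainleveFive.IsRationalOn θ₀ θₓ θᵢ S (cm j)) ∧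
      (∀ j n : ℕ, 1 ≤ n → PainleveFive.IsRationalOn θ₀ θₓ θᵢ S (dp j n) ∧
        PainleveFive.IsRationalOn θ₀ θₓ θᵢ S (dm j n)) ∧
      -- the expansions
      (∀ σ ∈ S, ∀ ρ : ℂ, ρ ≠ 0 →
        (∀ u ∈ PainleveFive.omegaPlus σ ρ ε₀,
          PainleveFive.IsPlusSum σ ρ u
            (4 * σ ^ 2 * (θ₀ + θₓ - σ) / ((σ + θᵢ) * (θ₀ ^ 2 - (σ + θₓ) ^ 2)))
            (fun j => cp j σ) (fun j n => dp j n σ) (y σ ρ u)) ∧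
        (∀ u ∈ PainleveFive.omegaMinus σ ρ ε₀,
          PainleveFive.IsMinusSum σ ρ u
            (4 * σ ^ 2 * (θ₀ + θₓ + σ) / ((σ - θᵢ) * (θ₀ ^ 2 - (σ - θₓ) ^ 2)))
            (fun j => cm j σ) (fun j n => dm j n σ) (y σ ρ u))) := by
  have h : PainleveFive.IsExponentSet θ₀ θₓ θᵢ S := ⟨hSopen, hSbdd, hSdist, hSplus, hSminus⟩
  obtain ⟨ε₁, hε₁, hε₁', hmero, hplus, hdiff⟩ := h.exists_plus
  obtain ⟨ε₂, hε₂, -, -, hplus', hdiff'⟩ := h.neg.exists_plus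
  obtain ⟨r, hr, -, hreg, -⟩ := h.isDataFam.exists_convergentAt
  have hr' : (0 : ℝ) < r := by exact_mod_cast pos_iff_ne_zero.2 hr
  set y : ℂ → ℂ → ℂ → ℂ := fun σ ρ u =>
    (PainleveFive.dataOf θ₀ θₓ θᵢ σ).transcendent ρ θ₀ θₓ θᵢ u
  -- Here `ε₁` controls Ω⁺ for `σ`, `ε₂` controls Ω⁺ for `-σ`, which is Ω⁻ for `σ`, and `r` is a
  -- radius on which the two solutions agree.
  set ε₀ : ℝ := min ε₁ (min ε₂ r)
  have hε₀ : 0 < ε₀ := by positivity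
  have le₁ : ε₀ ≤ ε₁ := min_le_left _ _
  have le₂ : ε₀ ≤ ε₂ := (min_le_right _ _).trans (min_le_left _ _)
  have le₃ : ε₀ ≤ r := (min_le_right _ _).trans (min_le_right _ _)
  have hneg : ∀ {σ : ℂ}, σ ∈ S → -σ ∈ -S := fun hσ => by simpa using hσ
  have hsymm : ∀ σ ∈ S, ∀ ρ : ℂ, ρ ≠ 0 → ∀ u ∈ PainleveFive.omegaFull σ ρ ε₀,
      y σ ρ u = y (-σ) ρ⁻¹ u := fun σ hσ ρ hρ u hu => by
    have := (hreg σ hσ).1.transcendent_symm (hreg σ hσ).2 hρ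
      (PainleveFive.omegaFull_mono le₃ hu) θ₀ θₓ θᵢ
    rw [← PainleveFive.dataOf_neg] at this
    exact this.symm
  have hminus : ∀ {σ ρ u : ℂ}, ρ ≠ 0 → u ∈ PainleveFive.omegaMinus σ ρ ε₀ →
      u ∈ PainleveFive.omegaPlus (-σ) ρ⁻¹ ε₂ ∧ u ∈ PainleveFive.omegaFull σ ρ ε₀ :=
    fun {σ ρ u} hρ hu => by
      rw [PainleveFive.omegaMinus_eq] at hu
      refine ⟨PainleveFive.omegaPlus_mono le₂ hu, ?_⟩
      rw [← PainleveFive.omegaFull_neg_inv]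
      exact PainleveFive.omegaPlus_subset_omegaFull (inv_ne_zero hρ) (le₁.trans hε₁') hu
  refine ⟨ε₀, y,
    fun j σ => MvPowerSeries.coeff (PainleveFive.idxEquiv (j, 0))
      ((PainleveFive.dataOf θ₀ θₓ θᵢ σ).serY θ₀ θₓ θᵢ),
    fun j σ => MvPowerSeries.coeff (PainleveFive.idxEquiv (j, 0))
      ((PainleveFive.dataOf θ₀ θₓ θᵢ (-σ)).serY θ₀ θₓ θᵢ),
    fun j n σ => MvPowerSeries.coeff (PainleveFive.idxEquiv (j, n))
      ((PainleveFive.dataOf θ₀ θₓ θᵢ σ).serY θ₀ θₓ θᵢ),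
    fun j n σ => MvPowerSeries.coeff (PainleveFive.idxEquiv (j, n))
      ((PainleveFive.dataOf θ₀ θₓ θᵢ (-σ)).serY θ₀ θₓ θᵢ),
    hε₀, fun σ hσ ρ hρ => ?_, ?_, fun j _ => ⟨h.ratFam_serY _, (h.neg.ratFam_serY _).comp_neg⟩,
    fun j n _ => ⟨h.ratFam_serY _, (h.neg.ratFam_serY _).comp_neg⟩, fun σ hσ ρ hρ => ⟨?_, ?_⟩⟩
  · have hm := (hmero σ hσ ρ hρ).mono (PainleveFive.omegaFull_mono le₁)
    refine ⟨hm, ?_⟩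
    rintro u (hu | hu)
    · have hu' := PainleveFive.omegaPlus_mono le₁ hu
      obtain ⟨-, hy0, hy1⟩ := hplus σ hσ ρ hρ u hu'
      have han : AnalyticAt ℂ (y σ ρ) u :=
        PainleveFive.analyticAt_of_omegaPlusTotal hSopen hdiff hσ hρ hu'
      exact ⟨han, hy0, hy1, hm.2 u
        (PainleveFive.omegaPlus_subset_omegaFull hρ (le₁.trans hε₁') hu) han hy0 hy1⟩
    · obtain ⟨hu1, hu2⟩ := hminus hρ hu
      obtain ⟨-, hy0, hy1⟩ := hplus' (-σ) (hneg hσ) ρ⁻¹ (inv_ne_zero hρ) u hu1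
      have han' : AnalyticAt ℂ (y (-σ) ρ⁻¹) u :=
        PainleveFive.analyticAt_of_omegaPlusTotal hSopen.neg hdiff' (hneg hσ) (inv_ne_zero hρ) hu1
      have han : AnalyticAt ℂ (y σ ρ) u := han'.congr <| by
        filter_upwards [(PainleveFive.isOpen_omegaFull hρ σ ε₀).mem_nhds hu2] with w hw
        exact (hsymm σ hσ ρ hρ w hw).symm
      have hy0' : y σ ρ u ≠ 0 := by rw [hsymm σ hσ ρ hρ u hu2]; exact hy0
      have hy1' : y σ ρ u ≠ 1 := by rw [hsymm σ hσ ρ hρ u hu2]; exact hy1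
      exact ⟨han, hy0', hy1', hm.2 u hu2 han hy0' hy1'⟩
  · rintro p (hp | hp)
    · exact (hdiff.differentiableAt ((PainleveFive.isOpen_omegaPlusTotal hSopen ε₁).mem_nhds
        (PainleveFive.omegaPlusTotal_mono le₁ hp))).differentiableWithinAt
    · have hp' := hp
      rw [PainleveFive.omegaMinusTotal_eq] at hp'
      -- On Ω⁻ the function is the pullback under `(σ, ρ, x) ↦ (-σ, ρ⁻¹, x)` of the jointly
      -- holomorphic family over `-S`.
      have h1 := (hdiff'.differentiableAt ((PainleveFive.isOpen_omegaPlusTotal hSopen.neg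
        ε₂).mem_nhds (PainleveFive.omegaPlusTotal_mono le₂ hp'.2))).comp p
        (PainleveFive.differentiableAt_neg_inv hp'.1)
      refine DifferentiableAt.differentiableWithinAt (h1.congr_of_eventuallyEq ?_)
      filter_upwards [(PainleveFive.isOpen_omegaMinusTotal hSopen ε₀).mem_nhds hp] with q hq
      exact hsymm q.1 hq.1 q.2.1 hq.2.1 q.2.2 (hminus hq.2.1 hq.2.2).2
  · intro u hu
    refine (hplus σ hσ ρ hρ u (PainleveFive.omegaPlus_mono le₁ hu)).1.isPlusSum hρ
      (PainleveFive.InitData.coeff_serY_zero _ _ _ _) ?_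
    rw [PainleveFive.InitData.coeff_serY_one, h.constantCoeff_serZ_eq (subset_closure hσ)]
  · intro u hu
    obtain ⟨hu1, hu2⟩ := hminus hρ hu
    rw [hsymm σ hσ ρ hρ u hu2]
    refine PainleveFive.IsPlusSum.isMinusSum ?_
      ((hplus' (-σ) (hneg hσ) ρ⁻¹ (inv_ne_zero hρ) u hu1).1.isPlusSum (inv_ne_zero hρ)
        (PainleveFive.InitData.coeff_serY_zero _ _ _ _) rfl)
    -- Replacing `σ` by `-σ` turns the factor `σ + θ_∞` into `-(σ - θ_∞)`, the source of the minus
    -- sign in the expansion on Ω⁻.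
    rw [PainleveFive.InitData.coeff_serY_one,
      h.neg.constantCoeff_serZ_eq (subset_closure (hneg hσ)), ← div_neg]
    congr 1 <;> ring
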